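/- **Setting.** Let $V$ be a finite set and let $\mathcal P=\{p_j=0\}_{j}$ be a finite system of polynomial equations over a commutative ordered ring $K$ in variables $x_v,\bar x_v$ ($v\in V$). Let $I$ be the ideal generated by all $x_v(1-x_v)$, $\bar x_v(1-\bar x_v)$ and $1-\bar x_v-x_v$. A *(semantic) Sherali–Adams refutation* of $\mathcal P$ over $K$ consists of polynomials $g_j$ over $K$ and coefficients $0\le\alpha_{A,B}\in K$ ($A,B\subseteq V$) such that $$\sum_j g_jp_j+\sum_{A,B\subseteq V}\alpha_{A,B}\prod_{v\in A}x_v\prod_{v\in B}\bar x_v\equiv -1 \pmod I .$$ Consider the nonzero coefficients that occur when all polynomials on the left-hand side are expanded as sums of monomials, without cancellations. The *coefficient size* is the sum of their magnitudes; for $K=\mathbb Q$ the *size* is the sum of the lengths of their binary encodings, and the refutation has *$b$-bounded coefficients* if each of them has magnitude at most $b$. A *unary* Sherali–Adams refutation is an identity of the same form over $\mathbb Z$ with right-hand side $-M$ for some integer $M\ge1$ in place of $-1$, all of whose monomials are written with coefficient $+1$ or $-1$ (a monomial may be written repeatedly); its *size* is the number of monomials written. Let $G$ be a $k$-partite graph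 with blocks $V_1,\dots,V_k$ of size $n$. The *$k$-clique formula over $G$* consists of the block axioms $\sum_{v\in V_i}x_v-1=0$ ($1\le i\le k$) and the edge axioms $x_ux_v=0$ for all pairs of non-adjacent vertices $u,v$ in distinct blocks. Let $\mathcal G(n,k,p)$ be the random $k$-partite graph with blocks of size $n$ in which every pair of vertices in distinct blocks is an edge independently with probability $p$. "Asymptotically almost surely" means with probability tending to $1$ as $n\to\infty$, and $\log$ is to base $2$. **Theorem.** Let $k=k(n)\in\mathbb N$ and $D=D(n)\in\mathbb R$ be functions of $n$ with $0<D\le 2\log n$ and $k\le n^{1/66}$ for all large $n$, and let $G\sim\mathcal G(n,k,n^{-2/D})$. 1. There is an absolute constant $c>0$ (independent of $k$ and $D$) such that asymptotically almost surely every Sherali–Adams refutation over $\mathbb R$ of the $k$-clique formula over $G$ has coefficient size at least $n^{cD}$. 2. For every $a>0$ there is a constant $c>0$, depending only on $a$, such that asymptotically almost surely every Sherali–Adams refutation over $\mathbb Q$ of the $k$-clique formula over $G$ with $n^a$-bounded coefficients has size at least $n^{cD}$. 3. There is an absolute constant $c>0$ such that asymptotically almost surely every unary Sherali–Adams refutation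 of the $k$-clique formula over $G$ has size at least $n^{cD}$. -/

import Mathlib

open MvPolynomial MeasureTheory ProbabilityTheory Filter Topology

noncomputable section

/-! ### Semantic Sherali-Adams -/

/-- Polynomials over the variables `x_v` and their twin variables `x̄_v`, `v ∈ V`. -/
abbrev TwinPoly (V K : Type*) [CommRing K] := MvPolynomial (V ⊕ V) K

/-- The variable `x_v`. -/
def posVar {V : Type*} (K : Type*) [CommRing K] (v : V) : TwinPoly V K := X (Sum.inl v)

/-- The twin variable `x̄_v`. -/
def negVar {V : Type*} (K : Type*) [CommRing K] (v : V) : TwinPoly V K := X (Sum.inr v)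

/-- The ideal generated by the Boolean axioms `x_v(1 - x_v)`, `x̄_v(1 - x̄_v)` and the
negation axioms `1 - x̄_v - x_v`. -/
def boolIdeal (V K : Type*) [CommRing K] : Ideal (TwinPoly V K) :=
  Ideal.span
    (Set.range (fun v : V => posVar K v * (1 - posVar K v)) ∪
      Set.range (fun v : V => negVar K v * (1 - negVar K v)) ∪
      Set.range (fun v : V => 1 - negVar K v - posVar K v))

/-- The monomial `∏_{v ∈ A} x_v · ∏_{v ∈ B} x̄_v`, where `S = (A, B)`. -/
def genMonomial {V : Type*} (K : Type*) [CommRing K] (S : Finset V × Finset V) :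
    TwinPoly V K :=
  (∏ v ∈ S.1, posVar K v) * ∏ v ∈ S.2, negVar K v

/-- A semantic Sherali-Adams derivation of the constant `-M` from the polynomial equations
`p j = 0`: polynomials `g j` and nonnegative coefficients `α` such that
`∑ j, g j * p j + f₀ ≡ -M` modulo the Boolean and negation axioms, where
`f₀ = ∑_{A,B} α_{A,B} ∏_{v ∈ A} x_v ∏_{v ∈ B} x̄_v`. -/
structure SADerivation {V K ι : Type*} [Fintype V] [Fintype ι] [CommRing K] [LinearOrder K]
    (p : ι → TwinPoly V K) (M : K) where
  g : ι → TwinPoly V K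
  α : Finset V × Finset V → K
  α_nonneg : ∀ S, 0 ≤ α S
  identity :
    (∑ j, g j * p j + ∑ S, C (α S) * genMonomial K S) - (-C M) ∈ boolIdeal V K

/-- A semantic Sherali-Adams refutation is a derivation of `-1`. -/
abbrev SARefutation {V K ι : Type*} [Fintype V] [Fintype ι] [CommRing K] [LinearOrder K]
    (p : ι → TwinPoly V K) := SADerivation p 1

namespace SADerivation

variable {V K ι : Type*} [Fintype V] [Fintype ι] [CommRing K] [LinearOrder K]
  {p : ι → TwinPoly V K} {M : K}

open Classical in
/-- The multiset of the nonzero coefficients on the left-hand side `∑ j, g j * p j + f₀` when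
everything is expanded as a sum of monomials, without cancellations. -/
def coeffs (π : SADerivation p M) : Multiset K :=
  (∑ j, ((π.g j).support ×ˢ (p j).support).val.map
      (fun m => coeff m.1 (π.g j) * coeff m.2 (p j))) +
    (Finset.univ.filter (fun S => π.α S ≠ 0)).val.map π.α

/-- The coefficient size: the sum of the magnitudes of all coefficients. -/
def coeffSize (π : SADerivation p M) : K := (π.coeffs.map (fun c => |c|)).sum

end SADerivation

/-- The length of the binary encoding of a rational number: a sign bit followed by the binary
expansions of the numerator and of the denominator. -/
def bitLength (q : ℚ) : ℕ := 1 + q.num.natAbs.size + q.den.size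

/-- The size of a rational semantic Sherali-Adams refutation: the sum of the lengths of the binary
encodings of all nonzero coefficients. -/
def SADerivation.size {V ι : Type*} [Fintype V] [Fintype ι] {p : ι → TwinPoly V ℚ} {M : ℚ}
    (π : SADerivation p M) : ℕ := (π.coeffs.map bitLength).sum

/-- All coefficients of the (expanded) derivation have magnitude at most `b`. -/
def SADerivation.BoundedCoeffs {V ι : Type*} [Fintype V] [Fintype ι] {p : ι → TwinPoly V ℚ}
    {M : ℚ} (π : SADerivation p M) (b : ℝ) : Prop := ∀ c ∈ π.coeffs, |(c : ℝ)| ≤ b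

/-- A unary Sherali-Adams refutation: all monomials are written with coefficients `+1` or `-1`,
and the right-hand side is any negative integer `-M`. A monomial may be written repeatedly, so the
coefficients of the polynomials are arbitrary integers, `c` standing for `|c|` copies of `±1`. -/
structure UnarySARefutation {V ι : Type*} [Fintype V] [Fintype ι] (p : ι → TwinPoly V ℤ) where
  M : ℤ
  M_pos : 0 < M
  derivation : SADerivation p M

/-- The size of a unary refutation: the number of monomials with coefficient `±1` that it is
written with, so that an integer coefficient `c` counts `|c|` times. -/
def UnarySARefutation.size {V ι : Type*} [Fintype V] [Fintype ι] {p : ι → TwinPoly V ℤ}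
    (π : UnarySARefutation p) : ℕ := (π.derivation.coeffs.map Int.natAbs).sum

/-! ### The clique formula -/

/-- The vertices of a `k`-partite graph with blocks of size `n`; `(i, a)` lies in block `i`. -/
abbrev BlockVertex (n k : ℕ) := Fin k × Fin n

/-- The pairs of non-adjacent vertices in distinct blocks. Each unordered pair is listed once,
with the vertex from the lower block first. -/
abbrev NonEdge {n k : ℕ} (G : SimpleGraph (BlockVertex n k)) :=
  {e : BlockVertex n k × BlockVertex n k // e.1.1 < e.2.1 ∧ ¬ G.Adj e.1 e.2}

instance {n k : ℕ} (G : SimpleGraph (BlockVertex n k)) : Fintype (NonEdge G) :=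
  Fintype.ofFinite _

/-- The `k`-clique formula over `G`: the block axioms `∑_{v ∈ V_i} x_v - 1 = 0` and the edge
axioms `x_u x_v = 0` for the non-adjacent pairs `{u, v}` in distinct blocks. -/
def cliqueFormula {n k : ℕ} (K : Type*) [CommRing K] (G : SimpleGraph (BlockVertex n k)) :
    Fin k ⊕ NonEdge G → TwinPoly (BlockVertex n k) K
  | Sum.inl i => ∑ a : Fin n, posVar K (i, a) - 1
  | Sum.inr e => posVar K e.1.1 * posVar K e.1.2

/-! ### Random graphs -/

/-- The distribution `𝒢(n, k, p)`: every pair of vertices in distinct blocks is an edge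
independently with probability `p`, and there are no edges within a block. (A real number `p`
outside `[0, 1]` is replaced by the nearest endpoint.) -/
def partiteErdosRenyi (n k : ℕ) (p : ℝ) : Measure (SimpleGraph (BlockVertex n k)) :=
  (setBernoulli (SimpleGraph.completeEquipartiteGraph k n).edgeSet
    (Set.projIcc 0 1 zero_le_one p)).map SimpleGraph.fromEdgeSet

/-- For `G ∼ 𝒢(n, k(n), n ^ (-2 / D(n)))` the property `P n` of `G` holds asymptotically almost
surely, i.e. with probability tending to `1` as `n → ∞`. -/
def HoldsAAS (k : ℕ → ℕ) (D : ℕ → ℝ)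
    (P : (n : ℕ) → SimpleGraph (BlockVertex n (k n)) → Prop) : Prop :=
  Tendsto (fun n : ℕ => partiteErdosRenyi n (k n) ((n : ℝ) ^ (-2 / D n)) {G | P n G})
    atTop (𝓝 1)

/-- The admissible parameters: `0 < D ≤ 2 log₂ n` and `k ≤ n ^ (1 / 66)` for all large `n`. -/
def AdmissibleParams (k : ℕ → ℕ) (D : ℕ → ℝ) : Prop :=
  ∀ᶠ n : ℕ in atTop,
    0 < D n ∧ D n ≤ 2 * Real.logb 2 n ∧ (k n : ℝ) ≤ (n : ℝ) ^ ((1 : ℝ) / 66)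

end

/-!
The lower bound is proved by exhibiting a dual solution: a signed weight `w` on the tuples `t`
that pick one vertex from each block, such that the total weight is at least `1`, every rectangle
(set of tuples with `t i ∈ Q i` for all `i`) has weight at least `-ε`, and every rectangle of
tuples through a fixed pair of non-adjacent vertices has weight at most `ε` in absolute value
(`IsDual`). A tuple is a Boolean assignment that satisfies the block axioms, and under it every
monomial is the indicator function of a rectangle. Averaging a derivation of `-M` with respect to
`w` therefore shows that its coefficients sum to at least `M / ε` (`IsDual.le_sum_coeffs`), and
all three parts follow once `ε = n ^ (-c * D)`. When `D` is bounded, the uniform weight will do;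
for refutations with bounded rational coefficients one then counts the coefficients
(`le_card_coeffs`).

For large `D`, let `d` be a small multiple of `D`, let `x` be the inverse of the edge probability
and let `χ_e(t)` be the centred and scaled indicator of the pair of vertices that `t` picks from a
pair `e` of blocks being an edge, so that `1 + χ_e` is `x` or `0`. The weight of `t` is, up to
normalization, the sum of `∏_{e ∈ H} χ_e(t)` over all graphs `H` on the blocks whose greedy
matching has at most `5 d` edges (`wt`). Without the restriction this sum is `∏_e (1 + χ_e(t))`, a
multiple of the indicator of `t` being a clique; with it, the weight still has this shape locally.
The graphs on which a query procedure has a prescribed outcome fall into intervals `{H : P ⊆ H ⊆ P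
∪ F}`, so their characters sum to products `∏_{e ∈ P} χ_e ∏_{e ∈ F} (1 + χ_e)`
(`sum_prod_eq_of_isLocal`).

For a set `T` of blocks in which a rectangle has fixed vertices, the procedure used here computes
the core of `H` outside `T`: a matching `R` of edges of `H`, and a set `U` of `O(|R|)` blocks,
such that all pairs inside `U` are queried while every free pair outside `T` meets a first
endpoint of `R` (`exists_core`). The second endpoints of `R` see no free pairs, so by the
Cauchy-Schwarz inequality and the near orthogonality of characters each edge of `R` makes the
contribution of the interval smaller by a power of `n` (`sq_sum_interval_le`), which beats the
number of intervals. Hence graphs with a core of more than `d` edges are negligible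
(`Setting.abs_sum_le`). For graphs with a small core the bound on the greedy matching holds
automatically, and the pairs that meet `T` are all free: they contribute `∏ (1 + χ_e)`, which
vanishes if the fixed vertices are not adjacent to each other or to the tuple. This gives the
bound for non-adjacent pairs (`Setting.abs_sum_wt_le_of_not_adj`). If the fixed vertices are
adjacent to the rest of the rectangle, whose sides are large and well balanced, then the empty
core dominates and the weight is nonnegative up to the error (`Setting.sum_small_core_nonneg`). An
arbitrary rectangle is reduced to this case by a decision tree that fixes, one at a time, the
vertices in a small side and the few vertices that spoil the balance. Fixing a vertex reduces the
error by almost a factor `n`, which is more than the branching costs, and after `d` steps the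
error term alone suffices (`Setting.neg_le_sum_wt`).

The only random input is that, for any block, the products of the characters of two distinct sets
of `O(d)` vertices outside the block are nearly orthogonal on it (`NearOrtho`). It follows from
Hoeffding's inequality and a union bound (`le_partiteErdosRenyi_nearOrtho`, `eventually_setting`).
-/

namespace CliqueSA

/-! ### Query procedures and interval decompositions -/

/-- `Q H` is the set of elements that an adaptive procedure queries on the input set `H` and `f H` is
its outcome: both depend only on the answers to the queries that were made. -/
def IsLocal {E σ : Type*} [DecidableEq E] (Q : Finset E → Finset E) (f : Finset E → σ) : Prop :=
  ∀ H H' : Finset E, H ∩ Q H = H' ∩ Q H → Q H' = Q H ∧ f H' = f H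

section Local

variable {E σ τ : Type*} [DecidableEq E]

lemma IsLocal.comp {Q : Finset E → Finset E} {f : Finset E → σ} (h : IsLocal Q f) (g : σ → τ) :
    IsLocal Q (fun H => g (f H)) := fun H H' e =>
  ⟨(h H H' e).1, congrArg g (h H H' e).2⟩

lemma inter_eq_of_subset {A B H H' : Finset E} (hAB : A ⊆ B) (h : H ∩ B = H' ∩ B) :
    H ∩ A = H' ∩ A := by
  rw [← Finset.inter_eq_right.2 hAB, ← Finset.inter_assoc, ← Finset.inter_assoc, h]

/-- Running two query procedures one after the other. -/
lemma IsLocal.union {Q₁ Q₂ : Finset E → Finset E} {f₁ : Finset E → σ} {f₂ : Finset E → τ}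
    (h₁ : IsLocal Q₁ f₁) (h₂ : IsLocal Q₂ f₂) :
    IsLocal (fun H => Q₁ H ∪ Q₂ H) (fun H => (f₁ H, f₂ H)) := by
  intro H H' e
  have a := h₁ H H' (inter_eq_of_subset Finset.subset_union_left e)
  have b := h₂ H H' (inter_eq_of_subset Finset.subset_union_right e)
  simp only [a.1, a.2, b.1, b.2, and_self]

/-- Making further queries that depend on the outcome only. -/
lemma IsLocal.query {Q : Finset E → Finset E} {f : Finset E → σ} (h : IsLocal Q f)
    (R : σ → Finset E) : IsLocal (fun H => Q H ∪ R (f H)) f := by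
  intro H H' e
  have a := h H H' (inter_eq_of_subset Finset.subset_union_left e)
  simp only [a.1, a.2, and_self]

/-- Querying one more element, chosen on the basis of the outcome, and updating the outcome with
the answer. -/
lemma IsLocal.step {Q : Finset E → Finset E} {f : Finset E → σ} (h : IsLocal Q f) (e : E)
    (c : σ → Prop) [DecidablePred c] (g : σ → σ) :
    IsLocal (fun H => if c (f H) then insert e (Q H) else Q H)
      (fun H => if c (f H) ∧ e ∈ H then g (f H) else f H) := by
  intro H H' eq
  have a := h H H' (inter_eq_of_subset (by dsimp only; split_ifs <;> simp) eq)
  by_cases hc : c (f H)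
  · have he : e ∈ H ↔ e ∈ H' := by
      simp only [hc, if_true] at eq
      have := Finset.ext_iff.1 eq e
      simpa using this
    simp only [a.1, a.2, he, and_self]
  · simp only [a.1, a.2, hc, false_and, if_false, and_self]

/-- The sets on which a query procedure has a given outcome fall into intervals, one for each set
`P` of positive answers; the elements that were not queried are free. -/
lemma sum_prod_eq_of_isLocal [Fintype E] {Q : Finset E → Finset E} {f : Finset E → σ}
    (h : IsLocal Q f) (A : σ → Prop) [DecidablePred A] (c : E → ℝ) :
    ∑ H with A (f H), ∏ e ∈ H, c e =
      ∑ P with P ⊆ Q P ∧ A (f P), (∏ e ∈ P, c e) * ∏ e ∈ (Q P)ᶜ, (1 + c e) := by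
  have key : ∀ H, Q (H ∩ Q H) = Q H ∧ f (H ∩ Q H) = f H := fun H =>
    h H (H ∩ Q H) (by rw [Finset.inter_assoc, Finset.inter_self])
  rw [← Finset.sum_fiberwise_of_maps_to (s := Finset.univ.filter fun H => A (f H))
    (t := Finset.univ.filter fun P => P ⊆ Q P ∧ A (f P)) (g := fun H => H ∩ Q H)]
  · refine Finset.sum_congr rfl fun P hP => ?_
    simp only [Finset.mem_filter, Finset.mem_univ, true_and] at hP
    rw [Finset.prod_one_add, Finset.mul_sum]
    symm
    refine Finset.sum_bij' (fun R _ => P ∪ R) (fun H _ => H \ Q P) ?_ ?_ ?_ ?_ ?_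
    · intro R hR
      rw [Finset.mem_powerset] at hR
      have hd : Disjoint R (Q P) := by
        rw [Finset.disjoint_left]; intro a ha; simpa using hR ha
      have e1 : P ∩ Q P = (P ∪ R) ∩ Q P := by
        rw [Finset.union_inter_distrib_right, Finset.disjoint_iff_inter_eq_empty.1 hd,
          Finset.union_empty]
      have := h P (P ∪ R) e1
      simp only [Finset.mem_filter, Finset.mem_univ, true_and, this.1, this.2, ← e1]
      exact ⟨hP.2, Finset.inter_eq_left.2 hP.1⟩
    · intro H hH
      rw [Finset.mem_powerset]
      intro a ha
      simp only [Finset.mem_sdiff] at ha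
      simpa using ha.2
    · intro R hR
      rw [Finset.mem_powerset] at hR
      ext a
      simp only [Finset.mem_sdiff, Finset.mem_union]
      constructor
      · rintro ⟨ha | ha, hb⟩
        · exact absurd (hP.1 ha) hb
        · exact ha
      · intro ha
        exact ⟨Or.inr ha, by simpa using hR ha⟩
    · intro H hH
      simp only [Finset.mem_filter, Finset.mem_univ, true_and] at hH
      have hQ : Q P = Q H := by rw [← hH.2]; exact (key H).1
      ext a
      have := Finset.ext_iff.1 hH.2 a
      simp only [Finset.mem_inter] at this
      simp only [Finset.mem_sdiff, Finset.mem_union, hQ]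
      tauto
    · intro R hR
      rw [Finset.mem_powerset] at hR
      rw [Finset.prod_union]
      rw [Finset.disjoint_left]
      intro a ha hb
      have := hR hb
      simp at this
      exact this (hP.1 ha)
  · intro H hH
    simp only [Finset.mem_filter, Finset.mem_univ, true_and] at hH ⊢
    rw [(key H).1, (key H).2]
    exact ⟨Finset.inter_subset_right, hH⟩

end Local

/-! ### Greedy matchings -/

/-- The pairs of distinct blocks; sets of them are the graphs `H` over which weights are expanded. -/
abbrev Pr (k : ℕ) := {e : Fin k × Fin k // e.1 < e.2}

/-- The two blocks of a pair. -/
def ends {k : ℕ} (e : Pr k) : Finset (Fin k) := {e.1.1, e.1.2}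

/-- The blocks that are covered by a set of pairs. -/
def cover {k : ℕ} (M : Finset (Pr k)) : Finset (Fin k) := M.biUnion ends

section Greedy

variable {k : ℕ}

lemma ends_injective : Function.Injective (ends (k := k)) := by
  rintro ⟨⟨a, b⟩, h⟩ ⟨⟨c, d⟩, h'⟩ e
  simp only [ends] at e h h'
  have h1 := Finset.ext_iff.1 e a
  have h2 := Finset.ext_iff.1 e b
  have h3 := Finset.ext_iff.1 e c
  have h4 := Finset.ext_iff.1 e d
  simp only [Finset.mem_insert, Finset.mem_singleton, true_or, or_true, true_iff, iff_true] at *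
  grind

lemma card_ends (e : Pr k) : (ends e).card = 2 := Finset.card_pair e.2.ne

/-- The greedy maximal matching `M H` among the pairs of `H` disjoint from `T`, as a query procedure:
the pairs are processed in some order, and a pair is queried unless it meets `T` or an edge that was
already chosen. In particular the queried pairs that are present are exactly those of `M H`. -/
lemma exists_greedy_matching (T : Finset (Fin k)) :
    ∃ (Q M : Finset (Pr k) → Finset (Pr k)), IsLocal Q M ∧ ∀ H,
      M H ⊆ H ∧
      (∀ e ∈ M H, ∀ e' ∈ M H, e ≠ e' → Disjoint (ends e) (ends e')) ∧
      (∀ e ∈ M H, Disjoint (ends e) T) ∧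
      (∀ e ∉ Q H, ¬ Disjoint (ends e) (T ∪ cover (M H))) ∧
      (∀ e ∈ Q H, Disjoint (ends e) T) ∧
      (∀ e ∈ H, e ∈ Q H → e ∈ M H) := by
  classical
  -- `s` is the set of pairs that have been processed
  suffices h : ∀ s : Finset (Pr k), ∃ (Q M : Finset (Pr k) → Finset (Pr k)), IsLocal Q M ∧ ∀ H,
      M H ⊆ H ∧
      (∀ e ∈ M H, ∀ e' ∈ M H, e ≠ e' → Disjoint (ends e) (ends e')) ∧
      (∀ e ∈ M H, Disjoint (ends e) T) ∧
      (∀ e ∈ s, e ∉ Q H → ¬ Disjoint (ends e) (T ∪ cover (M H))) ∧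
      (∀ e ∈ Q H, Disjoint (ends e) T) ∧
      (∀ e ∈ H, e ∈ Q H → e ∈ M H) by
    obtain ⟨Q, M, h1, h2⟩ := h Finset.univ
    refine ⟨Q, M, h1, fun H => ?_⟩
    obtain ⟨a, b, c, d, e⟩ := h2 H
    exact ⟨a, b, c, fun e => d e (Finset.mem_univ e), e⟩
  intro s
  induction s using Finset.induction with
  | empty => exact ⟨fun _ => ∅, fun _ => ∅, fun _ _ _ => ⟨rfl, rfl⟩, by simp⟩
  | insert e s hes ih =>
    obtain ⟨Q, M, hl, hs⟩ := ih
    refine ⟨_, _, hl.step e (fun M => Disjoint (ends e) (T ∪ cover M)) (insert e), fun H => ?_⟩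
    obtain ⟨h1, h2, h3, h4, h5, h6⟩ := hs H
    by_cases hc : Disjoint (ends e) (T ∪ cover (M H))
    · have hT : Disjoint (ends e) T := (Finset.disjoint_union_right.1 hc).1
      have hM : ∀ e' ∈ M H, Disjoint (ends e) (ends e') := fun e' he' =>
        (Finset.disjoint_union_right.1 hc).2.mono_right
          (Finset.subset_biUnion_of_mem ends he')
      by_cases heH : e ∈ H
      · simp only [hc, heH, and_self, if_true]
        refine ⟨Finset.insert_subset heH h1, ?_, ?_, ?_, ?_, ?_⟩
        · intro a ha b hb hab
          rw [Finset.mem_insert] at ha hb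
          rcases ha with rfl | ha <;> rcases hb with rfl | hb
          · exact absurd rfl hab
          · exact hM _ hb
          · exact (hM _ ha).symm
          · exact h2 a ha b hb hab
        · intro a ha
          rcases Finset.mem_insert.1 ha with rfl | ha
          · exact hT
          · exact h3 a ha
        · intro a ha haQ
          rw [Finset.mem_insert, not_or] at haQ
          have := h4 a ((Finset.mem_insert.1 ha).resolve_left haQ.1) haQ.2
          refine fun h => this (h.mono_right ?_)
          exact Finset.union_subset_union_right
            (Finset.biUnion_subset_biUnion_of_subset_left _ (Finset.subset_insert _ _))
        · intro a ha
          rcases Finset.mem_insert.1 ha with rfl | ha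
          · exact hT
          · exact h5 a ha
        · intro a ha haQ
          rcases Finset.mem_insert.1 haQ with rfl | haQ
          · exact Finset.mem_insert_self _ _
          · exact Finset.mem_insert_of_mem (h6 a ha haQ)
      · simp only [hc, heH, and_false, if_true, if_false]
        refine ⟨h1, h2, h3, ?_, ?_, ?_⟩
        · intro a ha haQ
          rw [Finset.mem_insert, not_or] at haQ
          exact h4 a ((Finset.mem_insert.1 ha).resolve_left haQ.1) haQ.2
        · intro a ha
          rcases Finset.mem_insert.1 ha with rfl | ha
          · exact hT
          · exact h5 a ha
        · intro a ha haQ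
          rcases Finset.mem_insert.1 haQ with rfl | haQ
          · exact absurd ha heH
          · exact h6 a ha haQ
    · simp only [hc, false_and, if_false]
      refine ⟨h1, h2, h3, ?_, h5, h6⟩
      intro a ha haQ
      rcases Finset.mem_insert.1 ha with rfl | ha
      · exact hc
      · exact h4 a ha haQ

end Greedy

section Core

variable {k : ℕ}

lemma mem_cover {M : Finset (Pr k)} {i : Fin k} : i ∈ cover M ↔ ∃ e ∈ M, i ∈ ends e := by
  simp [cover]

/-- A greedy matching of a graph between a set `C` of blocks, which is the outcome of a first query
procedure, and the blocks outside `T ∪ C`. -/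
lemma exists_greedy_bipartite_matching {σ : Type*} (T : Finset (Fin k)) (C : σ → Finset (Fin k))
    {Q : Finset (Pr k) → Finset (Pr k)} {f : Finset (Pr k) → σ} (hl : IsLocal Q f)
    (hQT : ∀ H, ∀ e ∈ Q H, Disjoint (ends e) T)
    (hCT : ∀ H, Disjoint (C (f H)) T)
    (hQC : ∀ H, ∀ e ∉ Q H, ¬ Disjoint (ends e) (T ∪ C (f H)))
    (hQH : ∀ H, ∀ e ∈ H, e ∈ Q H → ends e ⊆ C (f H)) :
    ∃ (Q' : Finset (Pr k) → Finset (Pr k)) (N : Finset (Pr k) → Finset (Fin k × Fin k)),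
      IsLocal Q' (fun H => (f H, N H)) ∧ ∀ H,
      (∀ a ∈ N H, a.1 ∈ C (f H) ∧ a.2 ∉ C (f H) ∧ a.2 ∉ T ∧ ∃ e ∈ H, ends e = {a.1, a.2}) ∧
      (∀ a ∈ N H, ∀ b ∈ N H, a.1 = b.1 → a = b) ∧
      (∀ a ∈ N H, ∀ b ∈ N H, a.2 = b.2 → a = b) ∧
      (∀ e ∉ Q' H, ¬ Disjoint (ends e) (T ∪ (N H).image Prod.fst) ∨
        ends e ⊆ C (f H) ∪ (N H).image Prod.snd) ∧
      (∀ e ∈ Q' H, Disjoint (ends e) T) ∧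
      (∀ e ∈ H, e ∈ Q' H → ends e ⊆ C (f H) ∪ (N H).image Prod.snd) := by
  classical
  -- `s` is the set of ordered pairs of blocks that have been processed
  suffices h : ∀ s : Finset (Fin k × Fin k),
      ∃ (Q' : Finset (Pr k) → Finset (Pr k)) (N : Finset (Pr k) → Finset (Fin k × Fin k)),
      IsLocal Q' (fun H => (f H, N H)) ∧ ∀ H,
      (∀ a ∈ N H, a.1 ∈ C (f H) ∧ a.2 ∉ C (f H) ∧ a.2 ∉ T ∧ ∃ e ∈ H, ends e = {a.1, a.2}) ∧
      (∀ a ∈ N H, ∀ b ∈ N H, a.1 = b.1 → a = b) ∧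
      (∀ a ∈ N H, ∀ b ∈ N H, a.2 = b.2 → a = b) ∧
      (∀ a ∈ s, ∀ e ∉ Q' H, ends e = {a.1, a.2} → a.1 ∈ C (f H) → a.2 ∉ C (f H) → a.2 ∉ T →
        a.1 ∈ (N H).image Prod.fst ∨ a.2 ∈ (N H).image Prod.snd) ∧
      (∀ e ∈ Q' H, Disjoint (ends e) T) ∧
      (∀ e ∈ H, e ∈ Q' H → ends e ⊆ C (f H) ∪ (N H).image Prod.snd) ∧ Q H ⊆ Q' H by
    obtain ⟨Q', N, h1, h2⟩ := h Finset.univ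
    refine ⟨Q', N, h1, fun H => ?_⟩
    obtain ⟨a, b, c, d, e, g, hQQ⟩ := h2 H
    refine ⟨a, b, c, ?_, e, g⟩
    intro e he
    have h3 := hQC H e (fun h => he (hQQ h))
    rw [or_iff_not_imp_left, not_not]
    intro hdis
    rw [Finset.disjoint_union_right] at h3 hdis
    have h4 : ¬ Disjoint (ends e) (C (f H)) := fun h => h3 ⟨hdis.1, h⟩
    -- `i` is an endpoint in `C`, `o` is the other one
    have main : ∀ i o, ends e = {i, o} → i ∈ C (f H) → ends e ⊆ C (f H) ∪ (N H).image Prod.snd := by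
      intro i o hio hi
      have hio' : i ∈ ends e ∧ o ∈ ends e := by simp [hio]
      by_cases ho : o ∈ C (f H)
      · rw [hio]
        intro j hj
        simp only [Finset.mem_insert, Finset.mem_singleton] at hj
        rcases hj with rfl | rfl
        · exact Finset.mem_union_left _ hi
        · exact Finset.mem_union_left _ ho
      · have hoT : o ∉ T := Finset.disjoint_left.1 hdis.1 hio'.2
        have := d (i, o) (Finset.mem_univ _) e he hio hi ho hoT
        rcases this with hj | hj
        · exact absurd hj (Finset.disjoint_left.1 hdis.2 hio'.1)
        · rw [hio]
          intro j hj'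
          simp only [Finset.mem_insert, Finset.mem_singleton] at hj'
          rcases hj' with rfl | rfl
          · exact Finset.mem_union_left _ hi
          · exact Finset.mem_union_right _ hj
    rw [Finset.not_disjoint_iff] at h4
    obtain ⟨i, hi, hiC⟩ := h4
    simp only [ends, Finset.mem_insert, Finset.mem_singleton] at hi
    rcases hi with rfl | rfl
    · exact main _ _ rfl hiC
    · exact main _ _ (Finset.pair_comm _ _) hiC
  intro s
  induction s using Finset.induction with
  | empty =>
    refine ⟨Q, fun _ => ∅, hl.comp (fun x => (x, ∅)), fun H => ?_⟩
    refine ⟨by simp, by simp, by simp, by simp, hQT H, ?_, subset_rfl⟩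
    intro e he heQ
    exact (hQH H e he heQ).trans Finset.subset_union_left
  | insert a s has ih =>
    obtain ⟨Q', N, hl', hs⟩ := ih
    by_cases hex : ∃ e : Pr k, ends e = {a.1, a.2}
    swap
    · refine ⟨Q', N, hl', fun H => ?_⟩
      obtain ⟨h1, h2, h3, h4, h5, h6, h7⟩ := hs H
      refine ⟨h1, h2, h3, ?_, h5, h6, h7⟩
      intro b hb e he heb
      rcases Finset.mem_insert.1 hb with rfl | hb
      · exact absurd ⟨e, heb⟩ hex
      · exact h4 b hb e he heb
    obtain ⟨e, hea⟩ := hex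
    let c : σ × Finset (Fin k × Fin k) → Prop := fun x =>
      a.1 ∈ C x.1 ∧ a.2 ∉ C x.1 ∧ a.2 ∉ T ∧ a.1 ∉ x.2.image Prod.fst ∧ a.2 ∉ x.2.image Prod.snd
    let N' : Finset (Pr k) → Finset (Fin k × Fin k) := fun H =>
      if c (f H, N H) ∧ e ∈ H then insert a (N H) else N H
    have hl2 := hl'.step e c (fun x => (x.1, insert a x.2))
    refine ⟨fun H => if c (f H, N H) then insert e (Q' H) else Q' H, N', ?_, fun H => ?_⟩
    · convert hl2 using 2 with H
      simp only [N']
      split_ifs <;> rfl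
    obtain ⟨h1, h2, h3, h4, h5, h6, h7⟩ := hs H
    by_cases hc : c (f H, N H)
    · obtain ⟨c1, c2, c3, c4, c5⟩ := id hc
      have heT : Disjoint (ends e) T := by
        rw [hea, Finset.disjoint_left]
        intro j hj
        simp only [Finset.mem_insert, Finset.mem_singleton] at hj
        rcases hj with rfl | rfl
        · exact Finset.disjoint_left.1 (hCT H) c1
        · exact c3
      by_cases heH : e ∈ H
      · have hN' : N' H = insert a (N H) := by simp [N', hc, heH]
        simp only [hN', hc, if_true]
        refine ⟨?_, ?_, ?_, ?_, ?_, ?_, h7.trans (Finset.subset_insert _ _)⟩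
        · intro b hb
          rcases Finset.mem_insert.1 hb with rfl | hb
          · exact ⟨c1, c2, c3, e, heH, hea⟩
          · exact h1 b hb
        · intro b hb b' hb' hbb
          rcases Finset.mem_insert.1 hb with rfl | hb₁ <;>
          rcases Finset.mem_insert.1 hb' with rfl | hb₁'
          · rfl
          · exact absurd (hbb ▸ Finset.mem_image_of_mem _ hb₁') c4
          · exact absurd (hbb ▸ Finset.mem_image_of_mem _ hb₁) c4
          · exact h2 b hb₁ b' hb₁' hbb
        · intro b hb b' hb' hbb
          rcases Finset.mem_insert.1 hb with rfl | hb₁ <;>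
          rcases Finset.mem_insert.1 hb' with rfl | hb₁'
          · rfl
          · exact absurd (hbb ▸ Finset.mem_image_of_mem _ hb₁') c5
          · exact absurd (hbb ▸ Finset.mem_image_of_mem _ hb₁) c5
          · exact h3 b hb₁ b' hb₁' hbb
        · intro b hb e' he' heb d1 d2 d3
          rw [Finset.mem_insert, not_or] at he'
          rcases Finset.mem_insert.1 hb with rfl | hb
          · exact absurd (ends_injective (heb.trans hea.symm)) he'.1
          · rw [Finset.image_insert, Finset.image_insert]
            exact (h4 b hb e' he'.2 heb d1 d2 d3).imp (Finset.mem_insert_of_mem)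
              (Finset.mem_insert_of_mem)
        · intro e' he'
          rcases Finset.mem_insert.1 he' with rfl | he'
          · exact heT
          · exact h5 e' he'
        · intro e' he'H he'
          rw [Finset.image_insert]
          rcases Finset.mem_insert.1 he' with rfl | he'
          · rw [hea]
            intro j hj
            simp only [Finset.mem_insert, Finset.mem_singleton] at hj
            rcases hj with rfl | rfl
            · exact Finset.mem_union_left _ c1
            · exact Finset.mem_union_right _ (Finset.mem_insert_self _ _)
          · exact (h6 e' he'H he').trans
              (Finset.union_subset_union_right (Finset.subset_insert _ _))
      · have hN' : N' H = N H := by simp [N', heH]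
        simp only [hN', hc, if_true]
        refine ⟨h1, h2, h3, ?_, ?_, ?_, h7.trans (Finset.subset_insert _ _)⟩
        · intro b hb e' he' heb d1 d2 d3
          rw [Finset.mem_insert, not_or] at he'
          rcases Finset.mem_insert.1 hb with rfl | hb
          · exact absurd (ends_injective (heb.trans hea.symm)) he'.1
          · exact h4 b hb e' he'.2 heb d1 d2 d3
        · intro e' he'
          rcases Finset.mem_insert.1 he' with rfl | he'
          · exact heT
          · exact h5 e' he'
        · intro e' he'H he'
          rcases Finset.mem_insert.1 he' with rfl | he'
          · exact absurd he'H heH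
          · exact h6 e' he'H he'
    · have hN' : N' H = N H := by simp [N', hc]
      simp only [hN', hc, if_false]
      refine ⟨h1, h2, h3, ?_, h5, h6, h7⟩
      intro b hb e' he' heb d1 d2 d3
      rcases Finset.mem_insert.1 hb with rfl | hb
      · by_contra hcon
        rw [not_or] at hcon
        exact hc ⟨d1, d2, d3, hcon.1, hcon.2⟩
      · exact h4 b hb e' he' heb d1 d2 d3

/-- The properties of the outcome `(U, C, R)` of the query procedure that computes, for a graph `H`,
a set `U` of blocks outside `T`, a set `R` of disjoint edges of `H` inside `U`, each listed as a pair
of a first and a second endpoint, and a set `C` of blocks that covers the edges of `H` outside `T`.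
Every pair that was not queried (`e ∉ Q`) and avoids `T` meets the set of first endpoints of `R`; so
the second endpoints see no free pair, and can be averaged over by the Cauchy-Schwarz inequality.
The sizes of `U` and `C` are linear in that of `R`. -/
structure IsCore (T : Finset (Fin k)) (H Q : Finset (Pr k)) (U C : Finset (Fin k))
    (R : Finset (Fin k × Fin k)) : Prop where
  disj : Disjoint U T
  card_U : U.card ≤ 3 * R.card
  card_C : C.card ≤ 2 * R.card
  fst_mem : ∀ a ∈ R, a.1 ∈ U
  snd_mem : ∀ a ∈ R, a.2 ∈ U
  edge : ∀ a ∈ R, ∃ e ∈ H, ends e = {a.1, a.2}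
  fst_inj : ∀ a ∈ R, ∀ b ∈ R, a.1 = b.1 → a = b
  snd_inj : ∀ a ∈ R, ∀ b ∈ R, a.2 = b.2 → a = b
  fst_ne_snd : ∀ a ∈ R, ∀ b ∈ R, a.1 ≠ b.2
  unqueried : ∀ e ∉ Q, ¬ Disjoint (ends e) (T ∪ R.image Prod.fst)
  covered : ∀ e ∈ H, ¬ Disjoint (ends e) (T ∪ C)
  queried_disj : ∀ e ∈ Q, Disjoint (ends e) T
  inside : ∀ e, ends e ⊆ U → e ∈ Q
  present : ∀ e ∈ H, e ∈ Q → ends e ⊆ U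

/-- The core procedure has three stages: a greedy matching `M` of `H` outside `T`, a greedy matching
`N` from the blocks `C` covered by `M` to the remaining blocks, and queries of all pairs inside
`U`, the set of blocks covered by `M` and `N`. The set `R` consists of `N`, with first endpoints in
`C`, and of those edges of `M` that do not meet a first endpoint of `N`. -/
lemma exists_core (T : Finset (Fin k)) :
    ∃ (Q : Finset (Pr k) → Finset (Pr k)) (U C : Finset (Pr k) → Finset (Fin k))
      (R : Finset (Pr k) → Finset (Fin k × Fin k)),
      IsLocal Q (fun H => (U H, C H, R H)) ∧ ∀ H, IsCore T H (Q H) (U H) (C H) (R H) := by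
  classical
  obtain ⟨Q₁, M, hl₁, hM⟩ := exists_greedy_matching T
  have hMT : ∀ H, Disjoint (cover (M H)) T := fun H =>
    (Finset.disjoint_biUnion_left _ _ _).2 (hM H).2.2.1
  obtain ⟨Q₂, N, hl₂, hN⟩ := exists_greedy_bipartite_matching T cover hl₁
    (fun H => (hM H).2.2.2.2.1) hMT (fun H => (hM H).2.2.2.1)
    (fun H e he heQ => Finset.subset_biUnion_of_mem ends ((hM H).2.2.2.2.2 e he heQ))
  let U' : Finset (Pr k) × Finset (Fin k × Fin k) → Finset (Fin k) := fun x =>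
    cover x.1 ∪ x.2.image Prod.snd
  let M' : Finset (Pr k) × Finset (Fin k × Fin k) → Finset (Pr k) := fun x =>
    x.1.filter (fun e => Disjoint (ends e) (x.2.image Prod.fst))
  let R' : Finset (Pr k) × Finset (Fin k × Fin k) → Finset (Fin k × Fin k) := fun x =>
    x.2 ∪ (M' x).image Subtype.val
  have hl₃ := (hl₂.query (fun x => Finset.univ.filter fun e => ends e ⊆ U' x)).comp
    (fun x => (U' x, cover x.1, R' x))
  refine ⟨_, _, _, _, hl₃, fun H => ?_⟩
  obtain ⟨m1, m2, m3, m4, m5, m6⟩ := hM H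
  obtain ⟨n1, n2, n3, n4, n5, n6⟩ := hN H
  have hUT : Disjoint (U' (M H, N H)) T := by
    refine Finset.disjoint_union_left.2 ⟨hMT H, ?_⟩
    rw [Finset.disjoint_left]
    intro j hj
    obtain ⟨a, ha, rfl⟩ := Finset.mem_image.1 hj
    exact (n1 a ha).2.2.1
  -- membership in `R`
  have hR : ∀ a, a ∈ R' (M H, N H) → a ∈ N H ∨
      ∃ e ∈ M H, e.1 = a ∧ Disjoint (ends e) ((N H).image Prod.fst) := by
    intro a ha
    rcases Finset.mem_union.1 ha with ha | ha
    · exact Or.inl ha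
    · obtain ⟨e, he, rfl⟩ := Finset.mem_image.1 ha
      rw [Finset.mem_filter] at he
      exact Or.inr ⟨e, he.1, rfl, he.2⟩
  have hfst : ∀ e ∈ M H, e.1.1 ∈ cover (M H) ∧ e.1.2 ∈ cover (M H) := fun e he =>
    ⟨mem_cover.2 ⟨e, he, by simp [ends]⟩, mem_cover.2 ⟨e, he, by simp [ends]⟩⟩
  have hcardR : (R' (M H, N H)).card = (N H).card + (M' (M H, N H)).card := by
    rw [Finset.card_union_of_disjoint, Finset.card_image_of_injective _ Subtype.val_injective]
    rw [Finset.disjoint_left]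
    intro a ha ha'
    obtain ⟨e, he, rfl⟩ := Finset.mem_image.1 ha'
    rw [Finset.mem_filter] at he
    exact (n1 _ ha).2.1 (hfst e he.1).2
  -- every edge of the first matching that is not in `R` meets a first endpoint of `N`
  have hcardM : (M H).card ≤ (R' (M H, N H)).card := by
    rw [hcardR, ← Finset.card_filter_add_card_filter_not
      (s := M H) (fun e => Disjoint (ends e) ((N H).image Prod.fst)), add_comm]
    refine Nat.add_le_add_right ?_ _
    have hch : ∀ e : Pr k, ∃ i, ¬ Disjoint (ends e) ((N H).image Prod.fst) →
        i ∈ ends e ∧ i ∈ (N H).image Prod.fst := by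
      intro e
      by_cases h : Disjoint (ends e) ((N H).image Prod.fst)
      · exact ⟨e.1.1, fun h' => absurd h h'⟩
      · obtain ⟨i, hi⟩ := Finset.not_disjoint_iff.1 h
        exact ⟨i, fun _ => hi⟩
    choose g hg using hch
    refine (Finset.card_le_card_of_injOn (t := (N H).image Prod.fst) g ?_ ?_).trans
      Finset.card_image_le
    · intro e he
      exact (hg e (Finset.mem_filter.1 he).2).2
    · intro e he e' he' hee
      have he := Finset.mem_filter.1 he
      have he' := Finset.mem_filter.1 he'
      by_contra hne
      have hd := m2 e he.1 e' he'.1 hne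
      exact Finset.disjoint_left.1 hd (hg e he.2).1 (hee ▸ (hg e' he'.2).1)
  have hcardC : (cover (M H)).card ≤ 2 * (R' (M H, N H)).card := by
    refine (Finset.card_biUnion_le_card_mul _ _ 2 fun e _ => (card_ends e).le).trans ?_
    omega
  have hpair : ∀ e : Pr k, e ∈ M H → Disjoint (ends e) ((N H).image Prod.fst) →
      ∀ a ∈ N H, a.1 ≠ e.1.1 ∧ a.1 ≠ e.1.2 ∧ a.2 ≠ e.1.1 ∧ a.2 ≠ e.1.2 := by
    intro e he hd a ha
    have h0 : a.1 ∉ ends e := fun h =>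
      Finset.disjoint_left.1 hd h (Finset.mem_image_of_mem _ ha)
    simp only [ends, Finset.mem_insert, Finset.mem_singleton, not_or] at h0
    have h2 := (n1 a ha).2.1
    exact ⟨h0.1, h0.2, fun h => h2 (h ▸ (hfst e he).1), fun h => h2 (h ▸ (hfst e he).2)⟩
  have hdis : ∀ e ∈ M H, ∀ e' ∈ M H, ∀ i, i ∈ ends e → i ∈ ends e' → e = e' := by
    intro e he e' he' i hi hi'
    by_contra hne
    exact Finset.disjoint_left.1 (m2 e he e' he' hne) hi hi'
  constructor
  · exact hUT
  · have h1 : (U' (M H, N H)).card ≤ (cover (M H)).card + ((N H).image Prod.snd).card :=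
      Finset.card_union_le _ _
    have h2 : ((N H).image Prod.snd).card ≤ (N H).card := Finset.card_image_le
    have h3 : (N H).card ≤ (R' (M H, N H)).card := by omega
    omega
  · exact hcardC
  · intro a ha
    rcases hR a ha with h | ⟨e, he, rfl, -⟩
    · exact Finset.mem_union_left _ (n1 a h).1
    · exact Finset.mem_union_left _ (hfst e he).1
  · intro a ha
    rcases hR a ha with h | ⟨e, he, rfl, -⟩
    · exact Finset.mem_union_right _ (Finset.mem_image_of_mem _ h)
    · exact Finset.mem_union_left _ (hfst e he).2
  · intro a ha
    rcases hR a ha with h | ⟨e, he, rfl, -⟩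
    · exact (n1 a h).2.2.2
    · exact ⟨e, m1 he, rfl⟩
  · intro a ha b hb hab
    rcases hR a ha with h | ⟨e, he, rfl, hd⟩ <;> rcases hR b hb with h' | ⟨e', he', rfl, hd'⟩
    · exact n2 a h b h' hab
    · exact absurd hab (hpair e' he' hd' a h).1
    · exact absurd hab.symm (hpair e he hd b h').1
    · rw [hdis e he e' he' e.1.1 (by simp [ends]) (by rw [hab]; simp [ends])]
  · intro a ha b hb hab
    rcases hR a ha with h | ⟨e, he, rfl, hd⟩ <;> rcases hR b hb with h' | ⟨e', he', rfl, hd'⟩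
    · exact n3 a h b h' hab
    · exact absurd hab (hpair e' he' hd' a h).2.2.2
    · exact absurd hab.symm (hpair e he hd b h').2.2.2
    · rw [hdis e he e' he' e.1.2 (by simp [ends]) (by rw [hab]; simp [ends])]
  · intro a ha b hb hab
    rcases hR a ha with h | ⟨e, he, rfl, hd⟩ <;> rcases hR b hb with h' | ⟨e', he', rfl, hd'⟩
    · exact (n1 b h').2.1 (hab ▸ (n1 a h).1)
    · exact (hpair e' he' hd' a h).2.1 hab
    · exact (hpair e he hd b h').2.2.1 hab.symm
    · have := hdis e he e' he' e.1.1 (by simp [ends]) (by rw [hab]; simp [ends])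
      subst this
      exact e.2.ne hab
  · intro e he
    simp only [Finset.mem_union, Finset.mem_filter, Finset.mem_univ, true_and, not_or] at he
    have h1 := (n4 e he.1).resolve_right he.2
    exact fun h => h1 (h.mono_right (Finset.union_subset_union_right
      (Finset.image_subset_image Finset.subset_union_left)))
  · intro e he
    by_cases heQ : e ∈ Q₁ H
    · have := m6 e he heQ
      rw [Finset.not_disjoint_iff]
      exact ⟨e.1.1, by simp [ends], Finset.mem_union_right _ (hfst e this).1⟩
    · exact m4 e heQ
  · intro e he
    simp only [Finset.mem_union, Finset.mem_filter, Finset.mem_univ, true_and] at he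
    rcases he with he | he
    · exact n5 e he
    · exact hUT.mono_left he
  · intro e he
    simp only [Finset.mem_union, Finset.mem_filter, Finset.mem_univ, true_and]
    exact Or.inr he
  · intro e he heQ
    simp only [Finset.mem_union, Finset.mem_filter, Finset.mem_univ, true_and] at heQ
    rcases heQ with h | h
    · exact n6 e he h
    · exact h

end Core

/-! ### Characters and sums over tuples -/

section Chr

variable {n k : ℕ} (G : SimpleGraph (BlockVertex n k)) (x : ℝ)

open Classical in
/-- The centred indicator of a pair of vertices being an edge, scaled such that `1 + chr` is `x`
times the indicator of the pair being an edge; here `1 / x` is the edge probability. -/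
noncomputable def chr (u v : BlockVertex n k) : ℝ := if G.Adj u v then x - 1 else -1

/-- The character of a pair of blocks, evaluated at the vertices that a tuple `t` picks. -/
noncomputable def chrPr (e : Pr k) (t : Fin k → Fin n) : ℝ :=
  chr G x (e.1.1, t e.1.1) (e.1.2, t e.1.2)

/-- Products of characters over distinct small sets of vertices are nearly orthogonal on every
block. This is the only property of a random graph that is used. -/
def NearOrtho (ℓ : ℕ) (lam : ℝ) : Prop :=
  ∀ (a : Fin k) (X X' : Finset (BlockVertex n k)), X ≠ X' → X.card ≤ ℓ → X'.card ≤ ℓ →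
    (∀ v ∈ X, v.1 ≠ a) → (∀ v ∈ X', v.1 ≠ a) →
    |∑ u : Fin n, (∏ v ∈ X, chr G x (a, u) v) * ∏ v ∈ X', chr G x (a, u) v| ≤ lam

variable {G x}

lemma chr_comm (u v : BlockVertex n k) : chr G x u v = chr G x v u := by
  have := G.adj_comm u v
  unfold chr
  split_ifs <;> tauto

lemma abs_chr_le (hx : 2 ≤ x) (u v : BlockVertex n k) : |chr G x u v| ≤ x := by
  unfold chr
  split_ifs
  · rw [abs_of_nonneg (by linarith)]; linarith
  · rw [abs_neg, abs_one]; linarith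

open Classical in
lemma one_add_chr (u v : BlockVertex n k) : 1 + chr G x u v = if G.Adj u v then x else 0 := by
  unfold chr; split_ifs <;> ring

lemma one_add_chr_nonneg (hx : 2 ≤ x) (u v : BlockVertex n k) : 0 ≤ 1 + chr G x u v := by
  rw [one_add_chr]; split_ifs <;> linarith

lemma chrPr_congr {e : Pr k} {t t' : Fin k → Fin n} (h : ∀ i ∈ ends e, t i = t' i) :
    chrPr G x e t = chrPr G x e t' := by
  unfold chrPr
  rw [h e.1.1 (by simp [ends]), h e.1.2 (by simp [ends])]

lemma chrPr_eq_chr {e : Pr k} {i j : Fin k} (h : ends e = {i, j}) (t : Fin k → Fin n) :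
    chrPr G x e t = chr G x (i, t i) (j, t j) := by
  have hij : (e.1.1 = i ∧ e.1.2 = j) ∨ (e.1.1 = j ∧ e.1.2 = i) := by
    have h1 := Finset.ext_iff.1 h e.1.1
    have h2 := Finset.ext_iff.1 h e.1.2
    have h3 := Finset.ext_iff.1 h i
    have h4 := Finset.ext_iff.1 h j
    have := e.2.ne
    simp only [ends, Finset.mem_insert, Finset.mem_singleton, true_or, or_true, true_iff,
      iff_true] at h1 h2 h3 h4
    grind
  unfold chrPr
  rcases hij with ⟨h1, h2⟩ | ⟨h1, h2⟩
  · rw [h1, h2]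
  · rw [h1, h2, chr_comm]

lemma abs_prod_chrPr_le (hx : 2 ≤ x) (P : Finset (Pr k)) (t : Fin k → Fin n) :
    |∏ e ∈ P, chrPr G x e t| ≤ x ^ P.card := by
  rw [Finset.abs_prod, ← Finset.prod_const]
  exact Finset.prod_le_prod (fun _ _ => abs_nonneg _) fun _ _ => abs_chr_le hx _ _

end Chr

section Tuples

variable {n k : ℕ}

/-- The coordinates in `D` of a tuple may be resampled independently. -/
lemma sum_sum_piecewise (Q : Fin k → Finset (Fin n)) (D : Finset (Fin k))
    (F : (Fin k → Fin n) → ℝ) :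
    ∑ t ∈ Fintype.piFinset Q, ∑ s ∈ Fintype.piFinset Q, F (D.piecewise s t) =
      (Fintype.piFinset Q).card * ∑ t ∈ Fintype.piFinset Q, F t := by
  have h : ∑ t ∈ Fintype.piFinset Q, ∑ s ∈ Fintype.piFinset Q, F (D.piecewise s t) =
      ∑ t ∈ Fintype.piFinset Q, ∑ _s ∈ Fintype.piFinset Q, F t := by
    rw [← Finset.sum_product', ← Finset.sum_product']
    have hmem : ∀ p ∈ Fintype.piFinset Q ×ˢ Fintype.piFinset Q,
        (D.piecewise p.2 p.1, D.piecewise p.1 p.2) ∈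
          Fintype.piFinset Q ×ˢ Fintype.piFinset Q := by
      intro p hp
      simp only [Finset.mem_product, Fintype.mem_piFinset] at hp ⊢
      constructor <;> intro i <;> by_cases hi : i ∈ D <;> simp [hi, hp.1 i, hp.2 i]
    have hinv : ∀ p : (Fin k → Fin n) × (Fin k → Fin n),
        (D.piecewise (D.piecewise p.1 p.2) (D.piecewise p.2 p.1),
          D.piecewise (D.piecewise p.2 p.1) (D.piecewise p.1 p.2)) = p := by
      rintro ⟨t, s⟩
      ext i <;> by_cases hi : i ∈ D <;> simp [hi]
    exact Finset.sum_bij' (fun p _ => (D.piecewise p.2 p.1, D.piecewise p.1 p.2))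
      (fun p _ => (D.piecewise p.2 p.1, D.piecewise p.1 p.2)) hmem hmem
      (fun p _ => hinv p) (fun p _ => hinv p) (fun p _ => rfl)
  rw [h, Finset.mul_sum]
  simp

lemma sum_piFinset_prod (Q : Fin k → Finset (Fin n)) (f : Fin k → Fin n → ℝ) :
    ∑ t ∈ Fintype.piFinset Q, ∏ i, f i (t i) = ∏ i, ∑ v ∈ Q i, f i v :=
  (Finset.prod_univ_sum Q f).symm

variable {G : SimpleGraph (BlockVertex n k)} {x : ℝ}

/-- The coordinates outside `U` can be integrated out of a weight `∏ (1 + χ_e)` over pairs that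
leave `U` when common neighbourhoods have at most `κ` times their expected size. -/
lemma sum_free_le (hx : 2 ≤ x) {Q : Fin k → Finset (Fin n)} {U : Finset (Fin k)}
    {Fr : Finset (Pr k)} {κ : ℝ} (hκ : 1 ≤ κ)
    (hFr : ∀ e ∈ Fr, ∃ i ∈ U, ∃ j ∉ U, ends e = {i, j})
    (hcod : ∀ t ∈ Fintype.piFinset Q, ∀ j ∉ U,
      ∑ v ∈ Q j, ∏ e ∈ Fr with j ∈ ends e, (1 + chrPr G x e (Function.update t j v)) ≤
        κ * (Q j).card)
    {y : (Fin k → Fin n) → ℝ} (hy : ∀ t, 0 ≤ y t)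
    (hyU : ∀ t t', (∀ i ∈ U, t i = t' i) → y t = y t') :
    ∑ t ∈ Fintype.piFinset Q, (∏ e ∈ Fr, (1 + chrPr G x e t)) * y t ≤
      κ ^ k * ∑ t ∈ Fintype.piFinset Q, y t := by
  classical
  rcases (Fintype.piFinset Q).eq_empty_or_nonempty with hemp | hne
  · simp [hemp]
  set c : ℝ := ((Fintype.piFinset Q).card : ℝ) with hc
  have hcpos : 0 < c := by rw [hc]; exact_mod_cast hne.card_pos
  -- the outer endpoint of a free pair
  let o : Pr k → Fin k := fun e => if e.1.1 ∈ U then e.1.2 else e.1.1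
  have ho : ∀ e ∈ Fr, o e ∉ U ∧ o e ∈ ends e ∧ ∀ i ∈ ends e, i ≠ o e → i ∈ U := by
    intro e he
    obtain ⟨i, hi, j, hj, hij⟩ := hFr e he
    have h1 : e.1.1 ∈ ({i, j} : Finset (Fin k)) := hij ▸ by simp [ends]
    have h2 : e.1.2 ∈ ({i, j} : Finset (Fin k)) := hij ▸ by simp [ends]
    have := e.2.ne
    simp only [Finset.mem_insert, Finset.mem_singleton] at h1 h2
    simp only [o, ends, Finset.mem_insert, Finset.mem_singleton]
    split_ifs <;> grind
  -- with the coordinates in `U` fixed, the weight is a product over the outer coordinates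
  have hinner : ∀ t ∈ Fintype.piFinset Q,
      ∑ s ∈ Fintype.piFinset Q, ∏ e ∈ Fr, (1 + chrPr G x e (Uᶜ.piecewise s t)) ≤ κ ^ k * c := by
    intro t ht
    have h1 : ∀ s, ∏ e ∈ Fr, (1 + chrPr G x e (Uᶜ.piecewise s t)) =
        ∏ j, ∏ e ∈ Fr with o e = j, (1 + chrPr G x e (Function.update t j (s j))) := by
      intro s
      rw [← Finset.prod_fiberwise_of_maps_to (s := Fr) (t := Finset.univ) (g := o) (by simp)]
      refine Finset.prod_congr rfl fun j _ => Finset.prod_congr rfl fun e he => ?_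
      rw [Finset.mem_filter] at he
      obtain ⟨o1, o2, o3⟩ := ho e he.1
      rw [chrPr_congr (t := Uᶜ.piecewise s t) (t' := Function.update t j (s j))]
      intro i hi
      by_cases hij : i = j
      · subst hij
        rw [he.2] at o1
        simp [o1]
      · have := o3 i hi (by rw [he.2]; exact hij)
        simp [this, hij]
    simp only [h1]
    rw [sum_piFinset_prod Q
      (fun j v => ∏ e ∈ Fr with o e = j, (1 + chrPr G x e (Function.update t j v)))]
    have hcard : κ ^ k * c = ∏ j : Fin k, κ * ((Q j).card : ℝ) := by
      rw [Finset.prod_mul_distrib, hc, Fintype.card_piFinset]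
      simp
    rw [hcard]
    refine Finset.prod_le_prod (fun j _ => Finset.sum_nonneg fun v _ =>
      Finset.prod_nonneg fun e _ => one_add_chr_nonneg hx _ _) fun j _ => ?_
    by_cases hj : j ∈ U
    · have : (Fr.filter fun e => o e = j) = ∅ := by
        rw [Finset.filter_eq_empty_iff]
        intro e he h
        exact (ho e he).1 (h ▸ hj)
      rw [this]
      simp only [Finset.prod_empty, Finset.sum_const, nsmul_eq_mul, mul_one]
      exact le_mul_of_one_le_left (Nat.cast_nonneg _) hκ
    · have : (Fr.filter fun e => o e = j) = Fr.filter fun e => j ∈ ends e := by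
        refine Finset.filter_congr fun e he => ⟨?_, ?_⟩
        · rintro rfl; exact (ho e he).2.1
        · intro h
          by_contra hne
          exact hj ((ho e he).2.2 j h (Ne.symm hne))
      rw [this]
      exact hcod t ht j hj
  have h2 := sum_sum_piecewise Q Uᶜ (fun t => (∏ e ∈ Fr, (1 + chrPr G x e t)) * y t)
  have h3 : ∑ t ∈ Fintype.piFinset Q, ∑ s ∈ Fintype.piFinset Q,
      (∏ e ∈ Fr, (1 + chrPr G x e (Uᶜ.piecewise s t))) * y (Uᶜ.piecewise s t) ≤
      ∑ t ∈ Fintype.piFinset Q, (κ ^ k * c) * y t := by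
    refine Finset.sum_le_sum fun t ht => ?_
    have : ∀ s, y (Uᶜ.piecewise s t) = y t := fun s => hyU _ _ fun i hi => by simp [hi]
    simp only [this]
    rw [← Finset.sum_mul]
    exact mul_le_mul_of_nonneg_right (hinner t ht) (hy t)
  rw [h2, ← Finset.mul_sum, ← hc] at h3
  have h4 : c * (∑ t ∈ Fintype.piFinset Q, (∏ e ∈ Fr, (1 + chrPr G x e t)) * y t) ≤
      c * (κ ^ k * ∑ t ∈ Fintype.piFinset Q, y t) := by
    calc _ ≤ _ := h3
      _ = _ := by ring
  exact le_of_mul_le_mul_left h4 hcpos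

end Tuples

section Matched

variable {n k : ℕ} {G : SimpleGraph (BlockVertex n k)} {x : ℝ}

/-- The sum of a product of characters over the coordinates outside `B`, for two tuples `s` and `s'`
on `B`: every matched coordinate `i` gains a factor `τ` unless `s` and `s'` agree at its partner
`β i`. -/
lemma abs_sum_matched_le (hx : 2 ≤ x) {ℓ : ℕ} {lam τ : ℝ} (hG : NearOrtho G x ℓ lam)
    (hτ : 0 ≤ τ) (hlam : lam ≤ n * τ) {Q : Fin k → Finset (Fin n)}
    {I B : Finset (Fin k)} {β : Fin k → Fin k} {P : Finset (Pr k)}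
    (hIB : Disjoint I B) (hβ : ∀ i ∈ I, β i ∈ B) (hB : B.card ≤ ℓ)
    (hP : ∀ e ∈ P, ∃ i ∉ B, ∃ j ∈ B, ends e = {i, j})
    (hIP : ∀ i ∈ I, ∃ e ∈ P, ends e = {i, β i})
    (s s' : Fin k → Fin n) :
    |∑ t ∈ Fintype.piFinset (fun i => if i ∈ I then Finset.univ else Q i),
      (∏ e ∈ P, chrPr G x e (B.piecewise s t)) * ∏ e ∈ P, chrPr G x e (B.piecewise s' t)| ≤
    x ^ (2 * P.card) * ((∏ i ∈ Iᶜ, ((Q i).card : ℝ)) *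
      ∏ i ∈ I, (n * ((if s (β i) = s' (β i) then 1 else 0) + τ))) := by
  classical
  have hx0 : 0 ≤ x := by linarith
  -- the endpoints of a pair outside and inside `B`
  let o : Pr k → Fin k := fun e => if e.1.1 ∈ B then e.1.2 else e.1.1
  let p : Pr k → Fin k := fun e => if e.1.1 ∈ B then e.1.1 else e.1.2
  have hop : ∀ e ∈ P, o e ∉ B ∧ p e ∈ B ∧ ends e = {o e, p e} := by
    intro e he
    obtain ⟨i, hi, j, hj, hij⟩ := hP e he
    have h1 : e.1.1 ∈ ({i, j} : Finset (Fin k)) := hij ▸ by simp [ends]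
    have h2 : e.1.2 ∈ ({i, j} : Finset (Fin k)) := hij ▸ by simp [ends]
    have := e.2.ne
    simp only [Finset.mem_insert, Finset.mem_singleton] at h1 h2
    simp only [o, p, ends]
    split_ifs with h
    · exact ⟨by grind, h, Finset.pair_comm _ _⟩
    · exact ⟨h, by grind, rfl⟩
  -- for fixed coordinates in `B`, the product of characters factors over the coordinates `i`
  let g : (Fin k → Fin n) → Fin k → Fin n → ℝ := fun s i v =>
    ∏ e ∈ P with o e = i, chr G x (i, v) (p e, s (p e))
  have hg : ∀ s t, ∏ e ∈ P, chrPr G x e (B.piecewise s t) = ∏ i, g s i (t i) := by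
    intro s t
    rw [← Finset.prod_fiberwise_of_maps_to (s := P) (t := Finset.univ) (g := o) (by simp)]
    refine Finset.prod_congr rfl fun i _ => Finset.prod_congr rfl fun e he => ?_
    rw [Finset.mem_filter] at he
    obtain ⟨h1, h2, h3⟩ := hop e he.1
    rw [chrPr_eq_chr h3, ← he.2]
    simp [h1, h2]
  have hgabs : ∀ s i v, |g s i v| ≤ x ^ (P.filter fun e => o e = i).card := by
    intro s i v
    rw [Finset.abs_prod, ← Finset.prod_const]
    exact Finset.prod_le_prod (fun _ _ => abs_nonneg _) fun _ _ => abs_chr_le hx _ _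
  have hgg : ∀ i v, |g s i v * g s' i v| ≤ x ^ (2 * (P.filter fun e => o e = i).card) := by
    intro i v
    rw [abs_mul, two_mul, pow_add]
    exact mul_le_mul (hgabs _ _ _) (hgabs _ _ _) (abs_nonneg _) (pow_nonneg hx0 _)
  simp only [hg, ← Finset.prod_mul_distrib]
  rw [sum_piFinset_prod _ (fun i v => g s i v * g s' i v), Finset.abs_prod]
  have hpow : x ^ (2 * P.card) = ∏ i : Fin k, x ^ (2 * (P.filter fun e => o e = i).card) := by
    rw [Finset.prod_pow_eq_pow_sum, ← Finset.mul_sum,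
      ← Finset.card_eq_sum_card_fiberwise (f := o) (by simp)]
  have hsplit : (∏ i ∈ Iᶜ, ((Q i).card : ℝ)) *
      ∏ i ∈ I, (n * ((if s (β i) = s' (β i) then 1 else 0) + τ)) =
      ∏ i : Fin k, if i ∈ I then (n * ((if s (β i) = s' (β i) then 1 else 0) + τ))
        else ((Q i).card : ℝ) := by
    rw [Finset.prod_ite, mul_comm]
    congr 1 <;> refine Finset.prod_congr ?_ fun _ _ => rfl <;> ext <;> simp
  rw [hsplit, hpow, ← Finset.prod_mul_distrib]
  refine Finset.prod_le_prod (fun _ _ => abs_nonneg _) fun i _ => ?_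
  by_cases hi : i ∈ I
  · simp only [hi, if_true]
    by_cases hss : s (β i) = s' (β i)
    · simp only [hss, if_true]
      refine (Finset.abs_sum_le_sum_abs _ _).trans ((Finset.sum_le_sum fun v _ => hgg i v).trans ?_)
      rw [Finset.sum_const, nsmul_eq_mul, Finset.card_univ, Fintype.card_fin, mul_comm]
      refine mul_le_mul_of_nonneg_left ?_ (pow_nonneg hx0 _)
      exact le_mul_of_one_le_right (Nat.cast_nonneg _) (by linarith)
    -- the sets of vertices `X s` and `X s'` that coordinate `i` is compared with differ at `β i`,
    -- so that near orthogonality applies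
    · simp only [hss, if_false, zero_add]
      have hinj : ∀ s : Fin k → Fin n, Set.InjOn (fun e => (p e, s (p e)))
          (P.filter fun e => o e = i : Finset (Pr k)) := by
        intro s e he e' he' hee
        have he := Finset.mem_filter.1 he
        have he' := Finset.mem_filter.1 he'
        have hpp : p e = p e' := congrArg Prod.fst hee
        apply ends_injective
        rw [(hop e he.1).2.2, (hop e' he'.1).2.2, he.2, he'.2, hpp]
      let X : (Fin k → Fin n) → Finset (BlockVertex n k) := fun s =>
        (P.filter fun e => o e = i).image fun e => (p e, s (p e))
      have hgX : ∀ s v, g s i v = ∏ y ∈ X s, chr G x (i, v) y := fun s v =>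
        (Finset.prod_image (hinj s)).symm
      have hXcard : ∀ s, (X s).card ≤ ℓ := by
        intro s
        refine le_trans ?_ hB
        refine Finset.card_le_card_of_injOn Prod.fst ?_ ?_
        · intro y hy
          obtain ⟨e, he, rfl⟩ := Finset.mem_image.1 hy
          exact (hop e (Finset.mem_filter.1 he).1).2.1
        · intro y hy y' hy' hyy
          obtain ⟨e, he, rfl⟩ := Finset.mem_image.1 hy
          obtain ⟨e', he', rfl⟩ := Finset.mem_image.1 hy'
          simp only at hyy
          simp only [hyy]
      have hXi : ∀ s, ∀ y ∈ X s, y.1 ≠ i := by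
        intro s y hy
        obtain ⟨e, he, rfl⟩ := Finset.mem_image.1 hy
        have h := hop e (Finset.mem_filter.1 he).1
        intro h'
        exact h.1 ((Finset.mem_filter.1 he).2.symm ▸ h' ▸ h.2.1)
      have hne : X s ≠ X s' := by
        obtain ⟨e, he, hei⟩ := hIP i hi
        have h := hop e he
        have hiB : i ∉ B := Finset.disjoint_left.1 hIB hi
        have hpo : p e = β i ∧ o e = i := by
          have h1 : p e ∈ ({i, β i} : Finset (Fin k)) := by rw [← hei, h.2.2]; simp
          have h2 : o e ∈ ({i, β i} : Finset (Fin k)) := by rw [← hei, h.2.2]; simp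
          simp only [Finset.mem_insert, Finset.mem_singleton] at h1 h2
          constructor
          · rcases h1 with h1 | h1
            · exact absurd (h1 ▸ h.2.1) hiB
            · exact h1
          · rcases h2 with h2 | h2
            · exact h2
            · exact absurd (h2 ▸ hβ i hi) h.1
        intro hXX
        have h1 : (β i, s (β i)) ∈ X s :=
          Finset.mem_image.2 ⟨e, Finset.mem_filter.2 ⟨he, hpo.2⟩, by rw [hpo.1]⟩
        rw [hXX] at h1
        obtain ⟨e', -, he'⟩ := Finset.mem_image.1 h1
        simp only [Prod.mk.injEq] at he'
        rw [he'.1] at he'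
        exact hss he'.2.symm
      simp only [hgX]
      refine (hG i (X s) (X s') hne (hXcard s) (hXcard s') (hXi s) (hXi s')).trans
        (hlam.trans ?_)
      exact le_mul_of_one_le_left (by positivity) (one_le_pow₀ (by linarith))
  · simp only [hi, if_false]
    refine (Finset.abs_sum_le_sum_abs _ _).trans ((Finset.sum_le_sum fun v _ => hgg i v).trans ?_)
    rw [Finset.sum_const, nsmul_eq_mul, mul_comm]

/-- Two independent tuples rarely agree at the partner of a matched coordinate. -/
lemma sum_agree_le {τ : ℝ} {Q : Fin k → Finset (Fin n)} {I : Finset (Fin k)} {β : Fin k → Fin k}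
    (hτ : 0 ≤ τ) (hβ : Set.InjOn β I) (hQ : ∀ i ∈ I, 1 ≤ τ * (Q (β i)).card) (s : Fin k → Fin n) :
    ∑ s' ∈ Fintype.piFinset Q, ∏ i ∈ I, ((if s (β i) = s' (β i) then 1 else 0) + τ) ≤
      (Fintype.piFinset Q).card * (2 * τ) ^ I.card := by
  classical
  let h : Fin k → Fin n → ℝ := fun j v =>
    if j ∈ I.image β then (if s j = v then 1 else 0) + τ else 1
  have h1 : ∀ s' : Fin k → Fin n,
      ∏ i ∈ I, ((if s (β i) = s' (β i) then 1 else 0) + τ) = ∏ j, h j (s' j) := by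
    intro s'
    simp only [h]
    rw [Finset.prod_ite_mem, Finset.univ_inter, Finset.prod_image hβ]
  simp only [h1]
  rw [sum_piFinset_prod Q h]
  have h2 : ((Fintype.piFinset Q).card : ℝ) * (2 * τ) ^ I.card =
      ∏ j, ((Q j).card : ℝ) * (if j ∈ I.image β then 2 * τ else 1) := by
    rw [Finset.prod_mul_distrib, Finset.prod_ite_mem, Finset.univ_inter, Finset.prod_const,
      Finset.card_image_of_injOn hβ, Fintype.card_piFinset]
    simp
  rw [h2]
  refine Finset.prod_le_prod (fun j _ => Finset.sum_nonneg fun v _ => ?_) fun j _ => ?_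
  · simp only [h]; split_ifs <;> linarith
  · by_cases hj : j ∈ I.image β
    · simp only [h, hj, if_true]
      rw [Finset.sum_add_distrib, Finset.sum_const, nsmul_eq_mul]
      obtain ⟨i, hi, rfl⟩ := Finset.mem_image.1 hj
      have h3 := hQ i hi
      have h4 : ∑ v ∈ Q (β i), (if s (β i) = v then (1 : ℝ) else 0) ≤ 1 := by
        rw [Finset.sum_ite_eq]
        split_ifs <;> norm_num
      linarith
    · simp only [h, hj, if_false]
      simp

/-- The Cauchy-Schwarz step: after squaring, the sum over the coordinates outside `B` is taken
first. -/
lemma sum_sq_matched_le (hx : 2 ≤ x) {ℓ : ℕ} {lam τ m : ℝ} (hG : NearOrtho G x ℓ lam)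
    (hτ : 0 ≤ τ) (hlam : lam ≤ n * τ) (hm : 0 < m) {Q : Fin k → Finset (Fin n)}
    {I : Finset (Fin k)} {β : Fin k → Fin k} {P : Finset (Pr k)} (hβ : Set.InjOn β I)
    (hIB : Disjoint I (I.image β)) (hI : I.card ≤ ℓ)
    (hP : ∀ e ∈ P, ∃ i ∉ I.image β, ∃ j ∈ I.image β, ends e = {i, j})
    (hIP : ∀ i ∈ I, ∃ e ∈ P, ends e = {i, β i})
    (hQI : ∀ i ∈ I, m ≤ (Q i).card) (hQ : ∀ i ∈ I, 1 ≤ τ * (Q (β i)).card)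
    {ρ : (Fin k → Fin n) → ℝ} {ρ₀ : ℝ} (hρ0 : 0 ≤ ρ₀) (hρ : ∀ s, |ρ s| ≤ ρ₀) :
    ∑ t ∈ Fintype.piFinset Q,
      (∑ s ∈ Fintype.piFinset Q, ρ s * ∏ e ∈ P, chrPr G x e ((I.image β).piecewise s t)) ^ 2 ≤
    ρ₀ ^ 2 * x ^ (2 * P.card) * ((Fintype.piFinset Q).card : ℝ) ^ 3 * (2 * τ * (n / m)) ^ I.card := by
  classical
  have hx0 : 0 ≤ x := by linarith
  set B := I.image β with hB
  set Q' : Fin k → Finset (Fin n) := fun i => if i ∈ I then Finset.univ else Q i with hQ'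
  set K : (Fin k → Fin n) → (Fin k → Fin n) → ℝ := fun t s =>
    ∏ e ∈ P, chrPr G x e (B.piecewise s t) with hK
  have hsub : Fintype.piFinset Q ⊆ Fintype.piFinset Q' := by
    refine Fintype.piFinset_subset _ _ fun i => ?_
    simp only [hQ']
    split_ifs <;> simp
  have hcard : (∏ i ∈ Iᶜ, ((Q i).card : ℝ)) * (n : ℝ) ^ I.card ≤
      (Fintype.piFinset Q).card * (n / m) ^ I.card := by
    rw [Fintype.card_piFinset, Nat.cast_prod,
      ← Finset.prod_compl_mul_prod I (fun i => ((Q i).card : ℝ)), mul_assoc]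
    have hle : (n : ℝ) ^ I.card ≤ (∏ i ∈ I, ((Q i).card : ℝ)) * (n / m) ^ I.card := by
      rw [← Finset.prod_const, ← Finset.prod_const, ← Finset.prod_mul_distrib]
      refine Finset.prod_le_prod (fun _ _ => Nat.cast_nonneg _) fun i hi => ?_
      rw [mul_div_assoc', le_div_iff₀ hm, mul_comm]
      exact mul_le_mul_of_nonneg_right (hQI i hi) (Nat.cast_nonneg _)
    exact mul_le_mul_of_nonneg_left hle (Finset.prod_nonneg fun _ _ => Nat.cast_nonneg _)
  -- a sum of squares does not decrease when the sides of the matched blocks are enlarged to full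
  -- blocks, on which the characters are nearly orthogonal
  calc ∑ t ∈ Fintype.piFinset Q, (∑ s ∈ Fintype.piFinset Q, ρ s * K t s) ^ 2
      ≤ ∑ t ∈ Fintype.piFinset Q', (∑ s ∈ Fintype.piFinset Q, ρ s * K t s) ^ 2 :=
        Finset.sum_le_sum_of_subset_of_nonneg hsub fun _ _ _ => sq_nonneg _
    _ = ∑ s ∈ Fintype.piFinset Q, ∑ s' ∈ Fintype.piFinset Q, ρ s * ρ s' *
          ∑ t ∈ Fintype.piFinset Q', K t s * K t s' := by
        have hsq : ∀ t, (∑ s ∈ Fintype.piFinset Q, ρ s * K t s) ^ 2 =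
            ∑ s ∈ Fintype.piFinset Q, ∑ s' ∈ Fintype.piFinset Q,
              (ρ s * K t s) * (ρ s' * K t s') := fun t => by
          rw [sq, Finset.sum_mul_sum]
        rw [Finset.sum_congr rfl fun t _ => hsq t, Finset.sum_comm]
        refine Finset.sum_congr rfl fun s _ => ?_
        rw [Finset.sum_comm]
        refine Finset.sum_congr rfl fun s' _ => ?_
        rw [Finset.mul_sum]
        exact Finset.sum_congr rfl fun t _ => by ring
    _ ≤ ∑ s ∈ Fintype.piFinset Q, ∑ s' ∈ Fintype.piFinset Q, ρ₀ ^ 2 * (x ^ (2 * P.card) *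
          ((∏ i ∈ Iᶜ, ((Q i).card : ℝ)) *
          ∏ i ∈ I, (n * ((if s (β i) = s' (β i) then 1 else 0) + τ)))) := by
        refine Finset.sum_le_sum fun s _ => Finset.sum_le_sum fun s' _ => ?_
        refine (le_abs_self _).trans ?_
        rw [abs_mul, abs_mul, sq]
        refine mul_le_mul (mul_le_mul (hρ s) (hρ s') (abs_nonneg _) hρ0) ?_ (abs_nonneg _)
          (mul_nonneg hρ0 hρ0)
        exact abs_sum_matched_le hx hG hτ hlam hIB (fun i hi => Finset.mem_image_of_mem β hi)
          (Finset.card_image_le.trans hI) hP hIP s s'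
    _ = ρ₀ ^ 2 * x ^ (2 * P.card) * ((∏ i ∈ Iᶜ, ((Q i).card : ℝ)) * (n : ℝ) ^ I.card) *
          ∑ s ∈ Fintype.piFinset Q, ∑ s' ∈ Fintype.piFinset Q,
            ∏ i ∈ I, ((if s (β i) = s' (β i) then 1 else 0) + τ) := by
        rw [Finset.mul_sum]
        refine Finset.sum_congr rfl fun s _ => ?_
        rw [Finset.mul_sum]
        refine Finset.sum_congr rfl fun s' _ => ?_
        rw [Finset.prod_mul_distrib, Finset.prod_const]
        ring
    _ ≤ ρ₀ ^ 2 * x ^ (2 * P.card) * ((Fintype.piFinset Q).card * (n / m) ^ I.card) *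
          ∑ s ∈ Fintype.piFinset Q, (Fintype.piFinset Q).card * (2 * τ) ^ I.card := by
        refine mul_le_mul (mul_le_mul_of_nonneg_left hcard (by positivity))
          (Finset.sum_le_sum fun s _ => sum_agree_le hτ hβ hQ s) ?_ (by positivity)
        refine Finset.sum_nonneg fun s _ => Finset.sum_nonneg fun s' _ =>
          Finset.prod_nonneg fun i _ => ?_
        split_ifs <;> linarith
    _ = _ := by
        rw [Finset.sum_const, nsmul_eq_mul, mul_pow (2 * τ)]
        ring

end Matched

section Leaf

variable {n k : ℕ} {G : SimpleGraph (BlockVertex n k)} {x : ℝ}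

/-- The contribution of one interval of graphs to the weight of a rectangle: `P` is the set of
present pairs, all inside `U`, and `Fr` the set of free pairs, each joining a block of `U` that is
not a partner of a matched block to a block outside `U`. Every matched block gains `2 τ n / m`
(in the square). -/
lemma sq_sum_interval_le (hx : 2 ≤ x) {ℓ : ℕ} {lam τ m κ : ℝ} (hG : NearOrtho G x ℓ lam)
    (hτ : 0 ≤ τ) (hlam : lam ≤ n * τ) (hm : 0 < m) (hκ : 1 ≤ κ)
    {Q Q₀ : Fin k → Finset (Fin n)} (hQQ : ∀ i, Q₀ i ⊆ Q i) {U : Finset (Fin k)}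
    {I : Finset (Fin k)} {β : Fin k → Fin k} {P Fr : Finset (Pr k)} (hβ : Set.InjOn β I)
    (hIB : Disjoint I (I.image β)) (hI : I.card ≤ ℓ)
    (hP : ∀ e ∈ P, ends e ⊆ U) (hFr : ∀ e ∈ Fr, ∃ i ∈ U, ∃ j ∉ U, i ∉ I.image β ∧ ends e = {i, j})
    (hBU : I.image β ⊆ U)
    (hIP : ∀ i ∈ I, ∃ e ∈ P, ends e = {i, β i})
    (hQI : ∀ i ∈ I, m ≤ (Q i).card) (hQ : ∀ i ∈ I, 1 ≤ τ * (Q (β i)).card)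
    (hcod : ∀ t ∈ Fintype.piFinset Q, ∀ j ∉ U,
      ∑ v ∈ Q j, ∏ e ∈ Fr with j ∈ ends e, (1 + chrPr G x e (Function.update t j v)) ≤
        κ * (Q j).card) :
    (∑ t ∈ Fintype.piFinset Q₀, (∏ e ∈ P, chrPr G x e t) * ∏ e ∈ Fr, (1 + chrPr G x e t)) ^ 2 ≤
      (κ ^ k) ^ 2 * ((Fintype.piFinset Q).card : ℝ) ^ 2 * x ^ (2 * P.card) *
        (2 * τ * (n / m)) ^ I.card := by
  classical
  have hx0 : 0 ≤ x := by linarith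
  have hsub : Fintype.piFinset Q₀ ⊆ Fintype.piFinset Q := Fintype.piFinset_subset _ _ hQQ
  rcases (Fintype.piFinset Q).eq_empty_or_nonempty with hemp | hne
  · rw [hemp, Finset.subset_empty] at hsub
    rw [hsub, hemp]
    simp
  set c : ℝ := ((Fintype.piFinset Q).card : ℝ) with hc
  have hcpos : 0 < c := by rw [hc]; exact_mod_cast hne.card_pos
  set B := I.image β with hB
  -- the present pairs are split according to the number of endpoints in `B`
  set PA := P.filter fun e => Disjoint (ends e) B with hPA
  set PB := (P.filter fun e => ¬ Disjoint (ends e) B).filter fun e => ends e ⊆ B with hPB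
  set PM := (P.filter fun e => ¬ Disjoint (ends e) B).filter fun e => ¬ ends e ⊆ B with hPM
  have hprod : ∀ f : Pr k → ℝ, ∏ e ∈ P, f e =
      (∏ e ∈ PA, f e) * ((∏ e ∈ PB, f e) * ∏ e ∈ PM, f e) := fun f => by
    rw [Finset.prod_filter_mul_prod_filter_not, Finset.prod_filter_mul_prod_filter_not]
  have hcardP : P.card = PA.card + (PB.card + PM.card) := by
    rw [Finset.card_filter_add_card_filter_not, Finset.card_filter_add_card_filter_not]
  have hPMP : ∀ e ∈ PM, e ∈ P := fun e he =>
    (Finset.mem_filter.1 (Finset.mem_filter.1 he).1).1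
  have hPM' : ∀ e ∈ PM, ∃ i ∉ B, ∃ j ∈ B, ends e = {i, j} := by
    intro e he
    have h1 := (Finset.mem_filter.1 he).2
    have h2 := (Finset.mem_filter.1 (Finset.mem_filter.1 he).1).2
    rw [Finset.not_disjoint_iff] at h2
    rw [Finset.not_subset] at h1
    obtain ⟨i, hi, hiB⟩ := h1
    obtain ⟨j, hj, hjB⟩ := h2
    refine ⟨i, hiB, j, hjB, ?_⟩
    symm
    refine Finset.eq_of_subset_of_card_le ?_ ?_
    · intro a ha
      simp only [Finset.mem_insert, Finset.mem_singleton] at ha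
      rcases ha with rfl | rfl <;> assumption
    · rw [card_ends, Finset.card_pair]
      rintro rfl; exact hiB hjB
  have hIPM : ∀ i ∈ I, ∃ e ∈ PM, ends e = {i, β i} := by
    intro i hi
    obtain ⟨e, he, hei⟩ := hIP i hi
    have hiB : i ∉ B := Finset.disjoint_left.1 hIB hi
    refine ⟨e, ?_, hei⟩
    refine Finset.mem_filter.2 ⟨Finset.mem_filter.2 ⟨he, ?_⟩, ?_⟩
    · rw [Finset.not_disjoint_iff]
      exact ⟨β i, by simp [hei], Finset.mem_image_of_mem β hi⟩
    · exact fun h => hiB (h (by simp [hei]))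
  -- `φ` and `ρ` collect the factors that depend on the coordinates outside `B` and inside `B`;
  -- `y` is the sum over the latter
  let W : (Fin k → Fin n) → ℝ := fun t => ∏ e ∈ Fr, (1 + chrPr G x e t)
  have hW0 : ∀ t, 0 ≤ W t := fun t => Finset.prod_nonneg fun e _ => one_add_chr_nonneg hx _ _
  let φ : (Fin k → Fin n) → ℝ := fun t =>
    (∏ i ∈ Bᶜ, if t i ∈ Q₀ i then (1 : ℝ) else 0) * ∏ e ∈ PA, chrPr G x e t
  let ρ : (Fin k → Fin n) → ℝ := fun s =>
    (∏ i ∈ B, if s i ∈ Q₀ i then (1 : ℝ) else 0) * ∏ e ∈ PB, chrPr G x e s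
  let y : (Fin k → Fin n) → ℝ := fun t =>
    ∑ s ∈ Fintype.piFinset Q, ρ s * ∏ e ∈ PM, chrPr G x e (B.piecewise s t)
  have hind : ∀ (S : Finset (Fin k)) (t : Fin k → Fin n),
      |∏ i ∈ S, if t i ∈ Q₀ i then (1 : ℝ) else 0| ≤ 1 := by
    intro S t
    rw [Finset.abs_prod]
    refine Finset.prod_le_one (fun _ _ => abs_nonneg _) fun i _ => ?_
    split_ifs <;> simp
  have hφ : ∀ t, |φ t| ≤ x ^ PA.card := by
    intro t
    rw [abs_mul]
    exact (mul_le_of_le_one_left (abs_nonneg _) (hind _ _)).trans (abs_prod_chrPr_le hx _ _)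
  have hρ : ∀ t, |ρ t| ≤ x ^ PB.card := by
    intro t
    rw [abs_mul]
    exact (mul_le_of_le_one_left (abs_nonneg _) (hind _ _)).trans (abs_prod_chrPr_le hx _ _)
  set Z := ∑ t ∈ Fintype.piFinset Q₀, (∏ e ∈ P, chrPr G x e t) * W t with hZ
  have hZ1 : Z = ∑ t ∈ Fintype.piFinset Q,
      (∏ i, if t i ∈ Q₀ i then (1 : ℝ) else 0) * ((∏ e ∈ P, chrPr G x e t) * W t) := by
    rw [hZ, ← Finset.sum_subset hsub]
    · refine Finset.sum_congr rfl fun t ht => ?_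
      rw [Finset.prod_congr rfl fun i _ => if_pos (Fintype.mem_piFinset.1 ht i)]
      simp
    · intro t _ ht
      rw [Fintype.mem_piFinset, not_forall] at ht
      obtain ⟨i, hi⟩ := ht
      rw [Finset.prod_eq_zero (Finset.mem_univ i) (if_neg hi), zero_mul]
  -- the coordinates in `B` are resampled; no free pair involves them
  have hZ2 : c * Z = ∑ t ∈ Fintype.piFinset Q, W t * (φ t * y t) := by
    rw [hZ1, hc, ← sum_sum_piecewise Q B]
    refine Finset.sum_congr rfl fun t _ => ?_
    simp only [y]
    rw [Finset.mul_sum, Finset.mul_sum]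
    refine Finset.sum_congr rfl fun s _ => ?_
    have e1 : W (B.piecewise s t) = W t := by
      refine Finset.prod_congr rfl fun e he => ?_
      obtain ⟨i, hi, j, hj, hiB, hij⟩ := hFr e he
      rw [chrPr_congr (t' := t)]
      intro a ha
      have : a ∉ B := by
        rw [hij, Finset.mem_insert, Finset.mem_singleton] at ha
        rcases ha with rfl | rfl
        · exact hiB
        · exact fun h => hj (hBU h)
      simp [this]
    have e2 : ∏ e ∈ PA, chrPr G x e (B.piecewise s t) = ∏ e ∈ PA, chrPr G x e t := by
      refine Finset.prod_congr rfl fun e he => chrPr_congr fun a ha => ?_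
      have := Finset.disjoint_left.1 (Finset.mem_filter.1 he).2 ha
      simp [this]
    have e3 : ∏ e ∈ PB, chrPr G x e (B.piecewise s t) = ∏ e ∈ PB, chrPr G x e s := by
      refine Finset.prod_congr rfl fun e he => chrPr_congr fun a ha => ?_
      have := (Finset.mem_filter.1 he).2 ha
      simp [this]
    have e4 : (∏ i, if (B.piecewise s t) i ∈ Q₀ i then (1 : ℝ) else 0) =
        (∏ i ∈ Bᶜ, if t i ∈ Q₀ i then (1 : ℝ) else 0) *
          ∏ i ∈ B, if s i ∈ Q₀ i then (1 : ℝ) else 0 := by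
      rw [← Finset.prod_compl_mul_prod B]
      congr 1
      · refine Finset.prod_congr rfl fun i hi => ?_
        have := Finset.mem_compl.1 hi
        simp [this]
      · refine Finset.prod_congr rfl fun i hi => ?_
        simp [hi]
    rw [e1, e4, hprod, e2, e3]
    simp only [φ, ρ]
    ring
  have hPMU : ∀ e ∈ PM, ends e ⊆ U := fun e he => hP e (hPMP e he)
  have hyU : ∀ t t', (∀ i ∈ U, t i = t' i) → |y t| = |y t'| := by
    intro t t' h
    have : y t = y t' := by
      refine Finset.sum_congr rfl fun s _ => ?_
      congr 1
      refine Finset.prod_congr rfl fun e he => chrPr_congr fun a ha => ?_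
      by_cases haB : a ∈ B
      · simp [haB]
      · simp [haB, h a (hPMU e he ha)]
    rw [this]
  have hcZ : c * |Z| ≤ x ^ PA.card * (κ ^ k * ∑ t ∈ Fintype.piFinset Q, |y t|) := by
    rw [← abs_of_pos hcpos, ← abs_mul, hZ2]
    calc |∑ t ∈ Fintype.piFinset Q, W t * (φ t * y t)|
        ≤ ∑ t ∈ Fintype.piFinset Q, x ^ PA.card * (W t * |y t|) := by
          refine (Finset.abs_sum_le_sum_abs _ _).trans (Finset.sum_le_sum fun t _ => ?_)
          rw [abs_mul, abs_mul, abs_of_nonneg (hW0 t)]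
          calc W t * (|φ t| * |y t|) = |φ t| * (W t * |y t|) := by ring
            _ ≤ _ := mul_le_mul_of_nonneg_right (hφ t) (mul_nonneg (hW0 t) (abs_nonneg _))
      _ = x ^ PA.card * ∑ t ∈ Fintype.piFinset Q, W t * |y t| := (Finset.mul_sum _ _ _).symm
      _ ≤ _ := by
          refine mul_le_mul_of_nonneg_left ?_ (pow_nonneg hx0 _)
          refine sum_free_le hx hκ ?_ hcod (fun t => abs_nonneg _) hyU
          intro e he
          obtain ⟨i, hi, j, hj, -, hij⟩ := hFr e he
          exact ⟨i, hi, j, hj, hij⟩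
  have hCS : (∑ t ∈ Fintype.piFinset Q, |y t|) ^ 2 ≤ c * ∑ t ∈ Fintype.piFinset Q, y t ^ 2 := by
    have := sq_sum_le_card_mul_sum_sq (s := Fintype.piFinset Q) (f := fun t => |y t|)
    simpa only [sq_abs] using this
  have hy2 := sum_sq_matched_le hx hG hτ hlam hm hβ hIB hI hPM' hIPM hQI hQ
    (pow_nonneg hx0 _) hρ
  rw [← hB, ← hc] at hy2
  have hfin : (c * |Z|) ^ 2 ≤ c ^ 2 * ((κ ^ k) ^ 2 * c ^ 2 * x ^ (2 * P.card) *
      (2 * τ * (n / m)) ^ I.card) := by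
    calc (c * |Z|) ^ 2 ≤ (x ^ PA.card * (κ ^ k * ∑ t ∈ Fintype.piFinset Q, |y t|)) ^ 2 :=
          pow_le_pow_left₀ (by positivity) hcZ 2
      _ = (x ^ PA.card) ^ 2 * (κ ^ k) ^ 2 * (∑ t ∈ Fintype.piFinset Q, |y t|) ^ 2 := by ring
      _ ≤ (x ^ PA.card) ^ 2 * (κ ^ k) ^ 2 * (c * ((x ^ PB.card) ^ 2 * x ^ (2 * PM.card) * c ^ 3 *
          (2 * τ * (n / m)) ^ I.card)) := by
          refine mul_le_mul_of_nonneg_left (hCS.trans ?_) (by positivity)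
          exact mul_le_mul_of_nonneg_left hy2 hcpos.le
      _ = _ := by rw [hcardP]; ring
  rw [mul_pow, sq_abs] at hfin
  exact le_of_mul_le_mul_left hfin (by positivity)

end Leaf

/-! ### Common neighbourhoods -/

section Codegree

variable {n k : ℕ} {G : SimpleGraph (BlockVertex n k)} {x : ℝ}

/-- If the characters of the subsets of `S` have small sums over `Q`, then the common neighbourhood
of `S` in `Q` has about the expected size. -/
lemma sum_prod_one_add_chr_le {j : Fin k} {Q : Finset (Fin n)} {S : Finset (BlockVertex n k)}
    {b : ℝ} (hb : ∀ X ⊆ S, X.Nonempty → |∑ u ∈ Q, ∏ v ∈ X, chr G x (j, u) v| ≤ b) (hb0 : 0 ≤ b) :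
    ∑ u ∈ Q, ∏ v ∈ S, (1 + chr G x (j, u) v) ≤ Q.card + 2 ^ S.card * b := by
  classical
  simp only [Finset.prod_one_add]
  rw [Finset.sum_comm, ← Finset.sum_erase_add _ _ (Finset.empty_mem_powerset S)]
  have h1 : ∑ X ∈ S.powerset.erase ∅, ∑ u ∈ Q, ∏ v ∈ X, chr G x (j, u) v ≤
      ∑ _X ∈ S.powerset.erase ∅, b := by
    refine Finset.sum_le_sum fun X hX => (le_abs_self _).trans (hb X ?_ ?_)
    · exact Finset.mem_powerset.1 (Finset.mem_of_mem_erase hX)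
    · exact Finset.nonempty_iff_ne_empty.2 (Finset.ne_of_mem_erase hX)
  have h2 : ∑ _X ∈ S.powerset.erase ∅, b ≤ 2 ^ S.card * b := by
    rw [Finset.sum_const, nsmul_eq_mul]
    refine mul_le_mul_of_nonneg_right ?_ hb0
    have := (Finset.card_erase_le (s := S.powerset) (a := ∅)).trans (Finset.card_powerset S).le
    exact_mod_cast this
  have h3 : ∑ u ∈ Q, ∏ v ∈ (∅ : Finset (BlockVertex n k)), chr G x (j, u) v = Q.card := by simp
  rw [h3]
  linarith

lemma NearOrtho.sum_prod_one_add_chr_le {ℓ : ℕ} {lam : ℝ} (hG : NearOrtho G x ℓ lam)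
    (hlam : 0 ≤ lam) {j : Fin k} {S : Finset (BlockVertex n k)} (hS : S.card ≤ ℓ)
    (hSj : ∀ v ∈ S, v.1 ≠ j) :
    ∑ u : Fin n, ∏ v ∈ S, (1 + chr G x (j, u) v) ≤ n + 2 ^ S.card * lam := by
  have := CliqueSA.sum_prod_one_add_chr_le (G := G) (x := x) (j := j) (Q := Finset.univ) (S := S)
    (b := lam) ?_ hlam
  · simpa using this
  · intro X hX hne
    have := hG j X ∅ hne.ne_empty ((Finset.card_le_card hX).trans hS) (by simp)
      (fun v hv => hSj v (hX hv)) (by simp)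
    simpa using this

/-- Few small sets of vertices have a character whose sum over a given set `Q` is large. -/
lemma NearOrtho.card_bad_le (hx : 2 ≤ x) {ℓ : ℕ} {lam θ : ℝ} (hG : NearOrtho G x ℓ lam)
    (hlam : 0 ≤ lam) (hθ : 0 ≤ θ) {j : Fin k} {Q : Finset (Fin n)}
    {𝓑 : Finset (Finset (BlockVertex n k))} (hcard : ∀ X ∈ 𝓑, X.card ≤ ℓ)
    (hj : ∀ X ∈ 𝓑, ∀ v ∈ X, v.1 ≠ j)
    (hbad : ∀ X ∈ 𝓑, θ ≤ |∑ u ∈ Q, ∏ v ∈ X, chr G x (j, u) v|) :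
    ((𝓑.card : ℝ) * θ) ^ 2 ≤ n * (𝓑.card * (n * x ^ (2 * ℓ)) + (𝓑.card : ℝ) ^ 2 * lam) := by
  classical
  let f : Finset (BlockVertex n k) → Fin n → ℝ := fun X u => ∏ v ∈ X, chr G x (j, u) v
  -- with these signs, the signed sum of the characters over `Q` is large, while its second moment
  -- over the block is small by near orthogonality
  let ε : Finset (BlockVertex n k) → ℝ := fun X => SignType.sign (∑ u ∈ Q, f X u)
  have hε : ∀ X, |ε X| ≤ 1 := by
    intro X
    simp only [ε]
    rcases lt_trichotomy (∑ u ∈ Q, f X u) 0 with h | h | h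
    · simp [sign_neg h]
    · simp [h]
    · simp [sign_pos h]
  have h1 : (𝓑.card : ℝ) * θ ≤ ∑ u ∈ Q, ∑ X ∈ 𝓑, ε X * f X u := by
    rw [Finset.sum_comm, ← nsmul_eq_mul, ← Finset.sum_const]
    refine Finset.sum_le_sum fun X hX => ?_
    rw [← Finset.mul_sum]
    exact (hbad X hX).trans (sign_mul_self _).ge
  have h2 : (∑ u ∈ Q, ∑ X ∈ 𝓑, ε X * f X u) ^ 2 ≤
      n * ∑ u : Fin n, (∑ X ∈ 𝓑, ε X * f X u) ^ 2 := by
    refine sq_sum_le_card_mul_sum_sq.trans ?_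
    refine mul_le_mul ?_ (Finset.sum_le_sum_of_subset_of_nonneg (Finset.subset_univ _)
      fun _ _ _ => sq_nonneg _) (Finset.sum_nonneg fun _ _ => sq_nonneg _) (Nat.cast_nonneg _)
    have := Finset.card_le_univ Q
    rw [Fintype.card_fin] at this
    exact_mod_cast this
  have h3 : ∑ u : Fin n, (∑ X ∈ 𝓑, ε X * f X u) ^ 2 =
      ∑ X ∈ 𝓑, ∑ X' ∈ 𝓑, ε X * ε X' * ∑ u, f X u * f X' u := by
    have hsq : ∀ u, (∑ X ∈ 𝓑, ε X * f X u) ^ 2 =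
        ∑ X ∈ 𝓑, ∑ X' ∈ 𝓑, (ε X * f X u) * (ε X' * f X' u) := fun u => by
      rw [sq, Finset.sum_mul_sum]
    rw [Finset.sum_congr rfl fun u _ => hsq u, Finset.sum_comm]
    refine Finset.sum_congr rfl fun X _ => ?_
    rw [Finset.sum_comm]
    refine Finset.sum_congr rfl fun X' _ => ?_
    rw [Finset.mul_sum]
    exact Finset.sum_congr rfl fun u _ => by ring
  have hf : ∀ X ∈ 𝓑, ∀ u, |f X u| ≤ x ^ ℓ := by
    intro X hX u
    rw [Finset.abs_prod]
    calc ∏ v ∈ X, |chr G x (j, u) v| ≤ ∏ _v ∈ X, x :=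
          Finset.prod_le_prod (fun _ _ => abs_nonneg _) fun _ _ => abs_chr_le hx _ _
      _ = x ^ X.card := Finset.prod_const _
      _ ≤ x ^ ℓ := pow_le_pow_right₀ (by linarith) (hcard X hX)
  have h4 : ∀ X ∈ 𝓑, ∑ X' ∈ 𝓑, ε X * ε X' * ∑ u, f X u * f X' u ≤
      n * x ^ (2 * ℓ) + 𝓑.card * lam := by
    intro X hX
    have hpt : ∀ X' ∈ 𝓑, ε X * ε X' * ∑ u, f X u * f X' u ≤
        (if X = X' then n * x ^ (2 * ℓ) else 0) + lam := by
      intro X' hX'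
      refine (le_abs_self _).trans ?_
      rw [abs_mul, abs_mul]
      refine (mul_le_of_le_one_left (abs_nonneg _)
        (mul_le_one₀ (hε X) (abs_nonneg _) (hε X'))).trans ?_
      split_ifs with h
      · refine ((Finset.abs_sum_le_sum_abs _ _).trans (Finset.sum_le_sum fun u _ => ?_)).trans
          (b := ∑ _u : Fin n, x ^ (2 * ℓ)) ?_
        · rw [abs_mul, two_mul, pow_add]
          exact mul_le_mul (hf X hX u) (hf X' hX' u) (abs_nonneg _)
            (pow_nonneg (by linarith) _)
        · simp [hlam]
      · rw [zero_add]
        exact hG j X X' h (hcard X hX) (hcard X' hX') (hj X hX) (hj X' hX')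
    refine (Finset.sum_le_sum hpt).trans ?_
    rw [Finset.sum_add_distrib, Finset.sum_ite_eq, if_pos hX, Finset.sum_const, nsmul_eq_mul]
  have h5 : ∑ u : Fin n, (∑ X ∈ 𝓑, ε X * f X u) ^ 2 ≤
      𝓑.card * (n * x ^ (2 * ℓ)) + (𝓑.card : ℝ) ^ 2 * lam := by
    rw [h3]
    refine (Finset.sum_le_sum h4).trans ?_
    rw [Finset.sum_const, nsmul_eq_mul]
    apply le_of_eq; ring
  calc ((𝓑.card : ℝ) * θ) ^ 2 ≤ (∑ u ∈ Q, ∑ X ∈ 𝓑, ε X * f X u) ^ 2 :=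
        pow_le_pow_left₀ (by positivity) h1 2
    _ ≤ _ := h2.trans (mul_le_mul_of_nonneg_left h5 (Nat.cast_nonneg _))

/-- The weight `∏ (1 + χ_e)` over pairs at a block `j`, as a function of the vertex chosen in `j`,
is the scaled indicator of a common neighbourhood. -/
lemma exists_prod_one_add_chrPr_eq {j : Fin k} {F : Finset (Pr k)} {A : Finset (Fin k)}
    (hF : ∀ e ∈ F, ∃ i ∈ A, i ≠ j ∧ ends e = {i, j}) (t : Fin k → Fin n) :
    ∃ S : Finset (BlockVertex n k), S ⊆ A.image (fun i => (i, t i)) ∧ (∀ y ∈ S, y.1 ≠ j) ∧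
      ∀ v, ∏ e ∈ F, (1 + chrPr G x e (Function.update t j v)) =
        ∏ y ∈ S, (1 + chr G x (j, v) y) := by
  classical
  have : Nonempty (Fin k) := ⟨j⟩
  choose! g hgA hgj hge using hF
  refine ⟨F.image fun e => (g e, t (g e)), ?_, ?_, fun v => ?_⟩
  · intro y hy
    obtain ⟨e, he, rfl⟩ := Finset.mem_image.1 hy
    exact Finset.mem_image_of_mem _ (hgA e he)
  · intro y hy
    obtain ⟨e, he, rfl⟩ := Finset.mem_image.1 hy
    exact hgj e he
  · rw [Finset.prod_image]
    · refine Finset.prod_congr rfl fun e he => ?_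
      rw [chrPr_eq_chr (hge e he), chr_comm]
      simp [hgj e he]
    · intro e he e' he' hee
      have hgg : g e = g e' := congrArg Prod.fst hee
      exact ends_injective ((hge e he).trans (hgg ▸ (hge e' he').symm))

end Codegree

/-! ### Cores relative to a set of fixed blocks -/

section CoreFacts

variable {k : ℕ}

lemma card_le_of_matching {M : Finset (Pr k)} {S : Finset (Fin k)}
    (hM : ∀ e ∈ M, ∀ e' ∈ M, e ≠ e' → Disjoint (ends e) (ends e'))
    (hS : ∀ e ∈ M, ¬ Disjoint (ends e) S) : M.card ≤ S.card := by
  classical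
  have hch : ∀ e : Pr k, ∃ i, e ∈ M → i ∈ ends e ∧ i ∈ S := by
    intro e
    by_cases h : e ∈ M
    · obtain ⟨i, hi⟩ := Finset.not_disjoint_iff.1 (hS e h)
      exact ⟨i, fun _ => hi⟩
    · exact ⟨e.1.1, fun h' => absurd h' h⟩
  choose g hg using hch
  refine Finset.card_le_card_of_injOn g (fun e he => (hg e he).2) ?_
  intro e he e' he' hee
  by_contra hne
  exact Finset.disjoint_left.1 (hM e he e' he' hne) (hg e he).1 (hee ▸ (hg e' he').1)

/-- The queries of the greedy matching procedure on all blocks. -/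
noncomputable def matchQ : Finset (Pr k) → Finset (Pr k) := (exists_greedy_matching ∅).choose

/-- The greedy maximal matching of a graph on the blocks. -/
noncomputable def greedy : Finset (Pr k) → Finset (Pr k) :=
  (exists_greedy_matching ∅).choose_spec.choose

lemma isLocal_greedy : IsLocal (matchQ (k := k)) greedy :=
  (exists_greedy_matching ∅).choose_spec.choose_spec.1

lemma greedy_subset (H : Finset (Pr k)) : greedy H ⊆ H :=
  ((exists_greedy_matching ∅).choose_spec.choose_spec.2 H).1

lemma greedy_disjoint (H : Finset (Pr k)) :
    ∀ e ∈ greedy H, ∀ e' ∈ greedy H, e ≠ e' → Disjoint (ends e) (ends e') :=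
  ((exists_greedy_matching ∅).choose_spec.choose_spec.2 H).2.1

lemma mem_greedy {H : Finset (Pr k)} {e : Pr k} (he : e ∈ H) (heQ : e ∈ matchQ H) :
    e ∈ greedy H :=
  ((exists_greedy_matching ∅).choose_spec.choose_spec.2 H).2.2.2.2.2 e he heQ

lemma not_disjoint_cover_greedy {H : Finset (Pr k)} {e : Pr k} (he : e ∈ H) :
    ¬ Disjoint (ends e) (cover (greedy H)) := by
  by_cases heQ : e ∈ matchQ H
  · rw [Finset.not_disjoint_iff]
    exact ⟨e.1.1, by simp [ends], mem_cover.2 ⟨e, mem_greedy he heQ, by simp [ends]⟩⟩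
  · have := ((exists_greedy_matching ∅).choose_spec.choose_spec.2 H).2.2.2.1 e heQ
    rwa [Finset.empty_union] at this

lemma card_cover_le (M : Finset (Pr k)) : (cover M).card ≤ 2 * M.card := by
  rw [mul_comm]
  exact Finset.card_biUnion_le_card_mul _ _ 2 fun e _ => (card_ends e).le

/-- The queries of the core procedure that avoids the blocks in `T`. -/
noncomputable def coreQ (T : Finset (Fin k)) : Finset (Pr k) → Finset (Pr k) :=
  (exists_core T).choose

/-- The blocks of the core of a graph outside `T`. -/
noncomputable def coreU (T : Finset (Fin k)) : Finset (Pr k) → Finset (Fin k) :=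
  (exists_core T).choose_spec.choose

/-- The vertex cover that the core procedure finds. -/
noncomputable def coreC (T : Finset (Fin k)) : Finset (Pr k) → Finset (Fin k) :=
  (exists_core T).choose_spec.choose_spec.choose

/-- The matching that the core procedure finds. -/
noncomputable def coreR (T : Finset (Fin k)) : Finset (Pr k) → Finset (Fin k × Fin k) :=
  (exists_core T).choose_spec.choose_spec.choose_spec.choose

lemma isLocal_core (T : Finset (Fin k)) :
    IsLocal (coreQ T) (fun H => (coreU T H, coreC T H, coreR T H)) :=
  (exists_core T).choose_spec.choose_spec.choose_spec.choose_spec.1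

lemma isCore (T : Finset (Fin k)) (H : Finset (Pr k)) :
    IsCore T H (coreQ T H) (coreU T H) (coreC T H) (coreR T H) :=
  (exists_core T).choose_spec.choose_spec.choose_spec.choose_spec.2 H

variable {T : Finset (Fin k)} {H Q : Finset (Pr k)} {U C : Finset (Fin k)}
  {R : Finset (Fin k × Fin k)}

lemma IsCore.card_image_fst (h : IsCore T H Q U C R) :
    (R.image Prod.fst).card = R.card :=
  Finset.card_image_of_injOn fun a ha b hb hab => h.fst_inj a ha b hb hab

lemma exists_partner (R : Finset (Fin k × Fin k)) :
    ∃ β : Fin k → Fin k, ∀ i ∈ R.image Prod.fst, (i, β i) ∈ R := by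
  have : ∀ i, ∃ b, i ∈ R.image Prod.fst → (i, b) ∈ R := by
    intro i
    by_cases hi : i ∈ R.image Prod.fst
    · obtain ⟨a, ha, rfl⟩ := Finset.mem_image.1 hi
      exact ⟨a.2, fun _ => ha⟩
    · exact ⟨i, fun h => absurd h hi⟩
  exact ⟨fun i => (this i).choose, fun i => (this i).choose_spec⟩

lemma IsCore.card_greedy_le (h : IsCore T H Q U C R) :
    (greedy H).card ≤ T.card + 2 * R.card := by
  refine (card_le_of_matching (greedy_disjoint H)
    fun e he => h.covered e (greedy_subset H he)).trans ?_
  exact (Finset.card_union_le _ _).trans (Nat.add_le_add_left h.card_C _)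

lemma IsCore.card_le_greedy (h : IsCore T H Q U C R) : R.card ≤ 2 * (greedy H).card := by
  classical
  refine le_trans ?_ (card_cover_le _)
  have hR : ∀ a ∈ R, a.1 ∈ cover (greedy H) ∨ a.2 ∈ cover (greedy H) := by
    intro a ha
    obtain ⟨e, he, hea⟩ := h.edge a ha
    obtain ⟨i, hi, hi'⟩ := Finset.not_disjoint_iff.1 (not_disjoint_cover_greedy he)
    rw [hea, Finset.mem_insert, Finset.mem_singleton] at hi
    rcases hi with rfl | rfl
    · exact Or.inl hi'
    · exact Or.inr hi'
  refine Finset.card_le_card_of_injOn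
    (fun a => if a.1 ∈ cover (greedy H) then a.1 else a.2) ?_ ?_
  · intro a ha
    dsimp only
    split_ifs with h1
    · exact h1
    · exact (hR a ha).resolve_left h1
  · intro a ha b hb hab
    dsimp only at hab
    split_ifs at hab
    · exact h.fst_inj a ha b hb hab
    · exact absurd hab (h.fst_ne_snd a ha b hb)
    · exact absurd hab.symm (h.fst_ne_snd b hb a ha)
    · exact h.snd_inj a ha b hb hab

end CoreFacts

/-! ### Counting the intervals -/

section Counting

variable {k : ℕ}

lemma card_pairs_inside_le (W : Finset (Fin k)) :
    (Finset.univ.filter fun e : Pr k => ends e ⊆ W).card ≤ W.card ^ 2 := by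
  classical
  rw [sq, ← Finset.card_product]
  refine Finset.card_le_card_of_injOn Subtype.val ?_ Subtype.val_injective.injOn
  intro e he
  have := (Finset.mem_filter.1 he).2
  exact Finset.mem_product.2 ⟨this (by simp [ends]), this (by simp [ends])⟩

lemma one_add_inv_pow_le (k : ℕ) : (1 + (k : ℝ)⁻¹) ^ k ≤ 3 := by
  rcases Nat.eq_zero_or_pos k with rfl | hk
  · norm_num
  · have hk' : (0 : ℝ) < k := by exact_mod_cast hk
    calc (1 + (k : ℝ)⁻¹) ^ k ≤ (Real.exp (k : ℝ)⁻¹) ^ k := by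
          refine pow_le_pow_left₀ (by positivity) ?_ k
          rw [add_comm]; exact Real.add_one_le_exp _
      _ = Real.exp 1 := by
          rw [← Real.exp_nat_mul, mul_inv_cancel₀ hk'.ne']
      _ ≤ 3 := Real.exp_one_lt_three.le

/-- Graphs inside `V P ∪ T` are few when weighted by `k ^ {-|V P|} 2 ^ {-|V P ∪ T| ^ 2}`. -/
lemma sum_weights_le (T : Finset (Fin k)) (𝓕 : Finset (Finset (Pr k)))
    (V : Finset (Pr k) → Finset (Fin k)) (hV : ∀ P ∈ 𝓕, ∀ e ∈ P, ends e ⊆ V P ∪ T) :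
    ∑ P ∈ 𝓕, ((k : ℝ)⁻¹ ^ (V P).card * (2⁻¹ : ℝ) ^ ((V P ∪ T).card ^ 2)) ≤ 3 := by
  classical
  rw [← Finset.sum_fiberwise_of_maps_to (s := 𝓕) (t := Finset.univ) (g := V) (by simp)]
  calc ∑ W, ∑ P ∈ 𝓕 with V P = W, ((k : ℝ)⁻¹ ^ (V P).card * (2⁻¹ : ℝ) ^ ((V P ∪ T).card ^ 2))
      ≤ ∑ W : Finset (Fin k), (k : ℝ)⁻¹ ^ W.card := by
        refine Finset.sum_le_sum fun W _ => ?_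
        have h1 : ∑ P ∈ 𝓕 with V P = W,
            ((k : ℝ)⁻¹ ^ (V P).card * (2⁻¹ : ℝ) ^ ((V P ∪ T).card ^ 2)) =
            ∑ P ∈ 𝓕 with V P = W, ((k : ℝ)⁻¹ ^ W.card * (2⁻¹ : ℝ) ^ ((W ∪ T).card ^ 2)) := by
          refine Finset.sum_congr rfl fun P hP => ?_
          rw [(Finset.mem_filter.1 hP).2]
        rw [h1, Finset.sum_const, nsmul_eq_mul]
        have h2 : (𝓕.filter fun P => V P = W) ⊆
            (Finset.univ.filter fun e : Pr k => ends e ⊆ W ∪ T).powerset := by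
          intro P hP
          obtain ⟨hP1, hP2⟩ := Finset.mem_filter.1 hP
          rw [Finset.mem_powerset]
          intro e he
          exact Finset.mem_filter.2 ⟨Finset.mem_univ _, hP2 ▸ hV P hP1 e he⟩
        have h3 : (𝓕.filter fun P => V P = W).card ≤ 2 ^ ((W ∪ T).card ^ 2) := by
          refine (Finset.card_le_card h2).trans ?_
          rw [Finset.card_powerset]
          exact Nat.pow_le_pow_right (by norm_num) (card_pairs_inside_le _)
        have h4 : ((𝓕.filter fun P => V P = W).card : ℝ) ≤ 2 ^ ((W ∪ T).card ^ 2) := by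
          exact_mod_cast h3
        calc ((𝓕.filter fun P => V P = W).card : ℝ) *
              ((k : ℝ)⁻¹ ^ W.card * (2⁻¹ : ℝ) ^ ((W ∪ T).card ^ 2))
            ≤ 2 ^ ((W ∪ T).card ^ 2) *
              ((k : ℝ)⁻¹ ^ W.card * (2⁻¹ : ℝ) ^ ((W ∪ T).card ^ 2)) :=
              mul_le_mul_of_nonneg_right h4 (by positivity)
          _ = (k : ℝ)⁻¹ ^ W.card * (2 * 2⁻¹ : ℝ) ^ ((W ∪ T).card ^ 2) := by
              rw [mul_pow]; ring
          _ = (k : ℝ)⁻¹ ^ W.card := by norm_num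
    _ = (1 + (k : ℝ)⁻¹) ^ k := by
        have := Finset.prod_one_add (R := ℝ) (s := (Finset.univ : Finset (Fin k)))
          (f := fun _ => (k : ℝ)⁻¹)
        simp only [Finset.prod_const, Finset.card_univ, Fintype.card_fin,
          Finset.powerset_univ] at this
        exact this.symm
    _ ≤ 3 := one_add_inv_pow_le k

end Counting

/-! ### Parameters -/

/-- The parameters of the construction and the pseudorandomness of the graph. All powers of `n` are
written as powers of `z = n ^ (1 / 66000)`: the number of blocks is at most
`n ^ (1 / 66) = z ^ 1000`, products of at most `d` inverse edge probabilities `x` are at most `z`, and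
the products of characters of at most `12 d` vertices are orthogonal up to
`n ^ (6 / 10) = z ^ 39600`. -/
structure Setting {n k : ℕ} (G : SimpleGraph (BlockVertex n k)) (d : ℕ) (x z : ℝ) : Prop where
  n_eq : (n : ℝ) = z ^ (66000 : ℝ)
  k_le : (k : ℝ) ≤ z ^ (1000 : ℝ)
  two_le_x : 2 ≤ x
  one_le_d : 1 ≤ d
  x_pow_le : x ^ d ≤ z
  ortho : NearOrtho G x (12 * d) (z ^ (39600 : ℝ))

section Params

variable {n k d : ℕ} {G : SimpleGraph (BlockVertex n k)} {x z : ℝ}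

lemma Setting.two_le_z (S : Setting G d x z) : 2 ≤ z := by
  refine le_trans ?_ S.x_pow_le
  calc (2 : ℝ) ≤ x := S.two_le_x
    _ ≤ x ^ d := le_self_pow₀ (by linarith [S.two_le_x]) (by have := S.one_le_d; omega)

lemma Setting.z_pos (S : Setting G d x z) : 0 < z := by linarith [S.two_le_z]

lemma Setting.rpow_le (S : Setting G d x z) {a b : ℝ} (h : a ≤ b) : z ^ a ≤ z ^ b :=
  Real.rpow_le_rpow_of_exponent_le (by linarith [S.two_le_z]) h

lemma Setting.rpow_mul (S : Setting G d x z) (a b : ℝ) : z ^ a * z ^ b = z ^ (a + b) :=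
  (Real.rpow_add S.z_pos a b).symm

lemma Setting.rpow_pow (S : Setting G d x z) (a : ℝ) (m : ℕ) : (z ^ a) ^ m = z ^ (a * m) := by
  rw [Real.rpow_mul S.z_pos.le, Real.rpow_natCast]

lemma Setting.rpow_pos (S : Setting G d x z) (a : ℝ) : 0 < z ^ a := Real.rpow_pos_of_pos S.z_pos a

lemma Setting.nat_two_pow_le (S : Setting G d x z) (m : ℕ) : (2 : ℝ) ^ m ≤ z ^ (m : ℝ) := by
  rw [Real.rpow_natCast]
  exact pow_le_pow_left₀ (by norm_num) S.two_le_z m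

lemma Setting.x_pow_le_rpow (S : Setting G d x z) {a m : ℕ} (h : a ≤ d * m) :
    x ^ a ≤ z ^ (m : ℝ) := by
  have hx := S.two_le_x
  rw [Real.rpow_natCast]
  calc x ^ a ≤ x ^ (d * m) := pow_le_pow_right₀ (by linarith) h
    _ = (x ^ d) ^ m := pow_mul _ _ _
    _ ≤ z ^ m := pow_le_pow_left₀ (by positivity) S.x_pow_le m

lemma Setting.two_pow_le_rpow (S : Setting G d x z) {a m : ℕ} (h : a ≤ d * m) :
    (2 : ℝ) ^ a ≤ z ^ (m : ℝ) :=
  (pow_le_pow_left₀ (by norm_num) S.two_le_x a).trans (S.x_pow_le_rpow h)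

lemma Setting.k_pow_le (S : Setting G d x z) (v : ℕ) : (k : ℝ) ^ v ≤ z ^ (1000 * v : ℝ) := by
  rw [← S.rpow_pow]
  exact pow_le_pow_left₀ (Nat.cast_nonneg _) S.k_le v

lemma Setting.n_pos (S : Setting G d x z) : (0 : ℝ) < n := by
  rw [S.n_eq]; exact S.rpow_pos _

/-- The square of the contribution of an interval of graphs, multiplied by the square of the weight
`k ^ v * 2 ^ u ^ 2` that makes the intervals summable. Here `p` bounds the number of present pairs,
`u` and `v` the numbers of blocks involved, and each of the `μ` matched blocks gains `2 z ^ {-θ}`. -/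
lemma Setting.weight_le (S : Setting G d x z) {p u v w μ : ℕ} {θ : ℝ} (hp : p ≤ u ^ 2)
    (hu : 4 * u ≤ d * w) :
    x ^ (2 * p) * (2 * z ^ (-θ)) ^ μ * ((k : ℝ) ^ v * 2 ^ (u ^ 2)) ^ 2 ≤
      z ^ ((w * u : ℝ) + (1 - θ) * μ + 2000 * v) := by
  have hx := S.two_le_x
  have h1 : x ^ (2 * p) * (2 ^ (u ^ 2)) ^ 2 ≤ z ^ (w * u : ℝ) := by
    calc x ^ (2 * p) * (2 ^ (u ^ 2)) ^ 2 ≤ x ^ (2 * u ^ 2) * (x ^ (u ^ 2)) ^ 2 :=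
          mul_le_mul (pow_le_pow_right₀ (by linarith) (by omega))
            (pow_le_pow_left₀ (by positivity) (pow_le_pow_left₀ (by norm_num) hx _) 2)
            (by positivity) (by positivity)
      _ = x ^ (4 * u * u) := by ring
      _ ≤ z ^ ((w * u : ℕ) : ℝ) := S.x_pow_le_rpow (by
          calc 4 * u * u ≤ d * w * u := Nat.mul_le_mul_right _ hu
            _ = d * (w * u) := mul_assoc _ _ _)
      _ = z ^ (w * u : ℝ) := by push_cast; rfl
  have h2 : (2 * z ^ (-θ)) ^ μ ≤ z ^ ((1 - θ) * μ) := by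
    rw [← S.rpow_pow]
    refine pow_le_pow_left₀ (by have := S.rpow_pos (-θ); positivity) ?_ μ
    calc 2 * z ^ (-θ) ≤ z ^ (1 : ℝ) * z ^ (-θ) := by
          refine mul_le_mul_of_nonneg_right ?_ (S.rpow_pos _).le
          rw [Real.rpow_one]; exact S.two_le_z
      _ = z ^ (1 - θ) := by rw [S.rpow_mul]; ring_nf
  have h3 : ((k : ℝ) ^ v) ^ 2 ≤ z ^ (2000 * v : ℝ) := by
    rw [← pow_mul]
    refine (S.k_pow_le _).trans (S.rpow_le ?_)
    push_cast; linarith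
  have h4 := S.rpow_pos (-θ)
  calc x ^ (2 * p) * (2 * z ^ (-θ)) ^ μ * ((k : ℝ) ^ v * 2 ^ (u ^ 2)) ^ 2
      = (x ^ (2 * p) * (2 ^ (u ^ 2)) ^ 2) * (2 * z ^ (-θ)) ^ μ * ((k : ℝ) ^ v) ^ 2 := by ring
    _ ≤ z ^ (w * u : ℝ) * z ^ ((1 - θ) * μ) * z ^ (2000 * v : ℝ) := by
        refine mul_le_mul (mul_le_mul h1 h2 (by positivity) (S.rpow_pos _).le) h3 (by positivity) ?_
        exact mul_nonneg (S.rpow_pos _).le (S.rpow_pos _).le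
    _ = _ := by rw [S.rpow_mul, S.rpow_mul]

/-- Summing over all intervals costs a factor `3` once the counting weights are accounted for. -/
lemma sum_abs_le_of_sq_le (T : Finset (Fin k)) (𝓕 : Finset (Finset (Pr k)))
    (V : Finset (Pr k) → Finset (Fin k)) (hV : ∀ P ∈ 𝓕, ∀ e ∈ P, ends e ⊆ V P ∪ T)
    (Z : Finset (Pr k) → ℝ) {b : ℝ} (hb : 0 ≤ b)
    (hZ : ∀ P ∈ 𝓕, Z P ^ 2 * ((k : ℝ) ^ (V P).card * 2 ^ ((V P ∪ T).card ^ 2)) ^ 2 ≤ b ^ 2) :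
    ∑ P ∈ 𝓕, |Z P| ≤ b * 3 := by
  refine (Finset.sum_le_sum fun P hP => ?_).trans (b := ∑ P ∈ 𝓕, b *
    ((k : ℝ)⁻¹ ^ (V P).card * (2⁻¹ : ℝ) ^ ((V P ∪ T).card ^ 2))) ?_
  · have h1 := hZ P hP
    rw [← mul_pow] at h1
    have h2 := abs_le_of_sq_le_sq h1 hb
    have h3 : (0 : ℝ) < (k : ℝ) ^ (V P).card * 2 ^ ((V P ∪ T).card ^ 2) := by
      have : (0 : ℝ) < (k : ℝ) ^ (V P).card := by
        rcases Nat.eq_zero_or_pos k with rfl | hk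
        · have : (V P).card = 0 := by
            rw [Finset.card_eq_zero, Finset.eq_empty_iff_forall_notMem]
            exact fun i => i.elim0
          rw [this]; norm_num
        · positivity
      positivity
    have h4 : |Z P| * ((k : ℝ) ^ (V P).card * 2 ^ ((V P ∪ T).card ^ 2)) ≤ b := by
      rw [← abs_of_pos h3, ← abs_mul]
      exact h2
    rw [← le_div_iff₀ h3] at h4
    refine h4.trans (le_of_eq ?_)
    rw [inv_pow, inv_pow, ← mul_inv, div_eq_mul_inv]
  · rw [← Finset.mul_sum]
    exact mul_le_mul_of_nonneg_left (sum_weights_le T 𝓕 V hV) hb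

end Params

/-! ### Absolute bounds on the weight of rectangles -/

section Absolute

variable {n k d : ℕ} {G : SimpleGraph (BlockVertex n k)} {x z : ℝ}

/-- Expansion of the sum of characters of a family of graphs over a rectangle into intervals. -/
lemma sum_piFinset_eq_of_isLocal {σ : Type*} {Qy : Finset (Pr k) → Finset (Pr k)}
    {f : Finset (Pr k) → σ} (h : IsLocal Qy f) (A : σ → Prop) [DecidablePred A]
    (Q : Fin k → Finset (Fin n)) :
    ∑ t ∈ Fintype.piFinset Q, ∑ H with A (f H), ∏ e ∈ H, chrPr G x e t =
      ∑ P with P ⊆ Qy P ∧ A (f P), ∑ t ∈ Fintype.piFinset Q,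
        (∏ e ∈ P, chrPr G x e t) * ∏ e ∈ (Qy P)ᶜ, (1 + chrPr G x e t) := by
  rw [Finset.sum_congr rfl fun t _ => sum_prod_eq_of_isLocal h A fun e => chrPr G x e t]
  exact Finset.sum_comm

/-- Common neighbourhoods of few vertices have at most about the expected size in a full block. -/
lemma Setting.codegree_le (S : Setting G d x z) {j : Fin k} {X : Finset (BlockVertex n k)}
    (hX : X.card ≤ 12 * d) (hXj : ∀ v ∈ X, v.1 ≠ j) :
    ∑ u : Fin n, ∏ v ∈ X, (1 + chr G x (j, u) v) ≤ (1 + (k : ℝ)⁻¹) * n := by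
  refine (S.ortho.sum_prod_one_add_chr_le (S.rpow_pos _).le hX hXj).trans ?_
  have hk : (0 : ℝ) < k := by
    have : 0 < k := j.pos
    exact_mod_cast this
  have h1 : (2 : ℝ) ^ X.card ≤ z ^ ((12 : ℕ) : ℝ) :=
    S.two_pow_le_rpow (hX.trans (mul_comm _ _).le)
  have h2 : (2 : ℝ) ^ X.card * z ^ (39600 : ℝ) ≤ (k : ℝ)⁻¹ * n := by
    rw [inv_mul_eq_div, le_div_iff₀ hk]
    calc (2 : ℝ) ^ X.card * z ^ (39600 : ℝ) * k
        ≤ z ^ ((12 : ℕ) : ℝ) * z ^ (39600 : ℝ) * z ^ (1000 : ℝ) :=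
          mul_le_mul (mul_le_mul_of_nonneg_right h1 (S.rpow_pos _).le) S.k_le hk.le
            (mul_nonneg (S.rpow_pos _).le (S.rpow_pos _).le)
      _ ≤ n := by
          rw [S.rpow_mul, S.rpow_mul, S.n_eq]
          exact S.rpow_le (by norm_num)
  linarith

/-- The weight of a rectangle with single vertices in the blocks of `T` that comes from graphs with a
large core: every fixed block gains almost a factor `n`, and so does, to a small power, every pair
in the matching of the core. -/
theorem Setting.abs_sum_le (S : Setting G d x z) {T : Finset (Fin k)} (hT : T.card ≤ 2 * d)
    {Q : Fin k → Finset (Fin n)} (hQ : ∀ i ∈ T, (Q i).card ≤ 1) (μ₀ : ℕ) :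
    |∑ t ∈ Fintype.piFinset Q,
      ∑ H with (greedy H).card ≤ 5 * d ∧ μ₀ ≤ (coreR T H).card, ∏ e ∈ H, chrPr G x e t| ≤
      9 * (n : ℝ) ^ k * z ^ (-63544 * (T.card : ℝ) - 5135 * μ₀) := by
  classical
  have hx := S.two_le_x
  have hn := S.n_pos
  by_cases hemp : ∃ i ∈ T, (Q i).card = 0
  · obtain ⟨i, -, hi⟩ := hemp
    have : Fintype.piFinset Q = ∅ := by
      rw [Finset.eq_empty_iff_forall_notMem]
      intro t ht
      have := Fintype.mem_piFinset.1 ht i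
      rw [Finset.card_eq_zero.1 hi] at this
      exact Finset.notMem_empty _ this
    rw [this, Finset.sum_empty, abs_zero]
    have := S.rpow_pos (-63544 * (T.card : ℝ) - 5135 * μ₀)
    positivity
  have hQ1 : ∀ i ∈ T, (Q i).card = 1 := by
    intro i hi
    have h1 := hQ i hi
    have h2 : (Q i).card ≠ 0 := fun h => hemp ⟨i, hi, h⟩
    omega
  -- the rectangle that is full outside `T`
  let Qb : Fin k → Finset (Fin n) := fun i => if i ∈ T then Q i else Finset.univ
  have hQQ : ∀ i, Q i ⊆ Qb i := by
    intro i
    simp only [Qb]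
    split_ifs <;> simp
  set c : ℝ := ((Fintype.piFinset Qb).card : ℝ) with hc
  have hcard : c = (n : ℝ) ^ k * z ^ (-66000 * (T.card : ℝ)) := by
    have h1 : c * (n : ℝ) ^ T.card = (n : ℝ) ^ k := by
      have h2 : c = ∏ i : Fin k, if i ∈ T then (1 : ℝ) else n := by
        rw [hc, Fintype.card_piFinset, Nat.cast_prod]
        refine Finset.prod_congr rfl fun i _ => ?_
        simp only [Qb]
        split_ifs with hi
        · rw [hQ1 i hi]; norm_num
        · simp
      have h3 : (n : ℝ) ^ T.card = ∏ i : Fin k, if i ∈ T then (n : ℝ) else 1 := by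
        rw [Finset.prod_ite_mem, Finset.univ_inter, Finset.prod_const]
      rw [h2, h3, ← Finset.prod_mul_distrib]
      rw [Finset.prod_congr rfl (g := fun _ => (n : ℝ)) fun i _ => by split_ifs <;> simp]
      simp
    rw [← h1, S.n_eq, S.rpow_pow, mul_assoc, S.rpow_mul]
    rw [show (66000 : ℝ) * (T.card : ℝ) + -66000 * (T.card : ℝ) = 0 by ring, Real.rpow_zero,
      mul_one]
  have hc0 : 0 ≤ c := Nat.cast_nonneg _
  -- the joint query procedure: the condition on `greedy H` must be determined by the queries as well
  let U : Finset (Pr k) → Finset (Fin k) := fun P => coreU T P ∪ cover (greedy P)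
  have hloc : IsLocal (fun H => (coreQ T H ∪ matchQ H) ∪
      Finset.univ.filter fun e => ends e ⊆ U H ∪ T)
      (fun H => ((greedy H).card, (coreR T H).card)) :=
    (((isLocal_core T).union isLocal_greedy).query
      (fun s => Finset.univ.filter fun e => ends e ⊆ s.1.1 ∪ cover s.2 ∪ T)).comp
        fun s => (s.2.card, s.1.2.2.card)
  rw [sum_piFinset_eq_of_isLocal hloc (fun s => s.1 ≤ 5 * d ∧ μ₀ ≤ s.2) Q]
  set 𝓕 := (Finset.univ.filter fun P => P ⊆ (coreQ T P ∪ matchQ P) ∪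
      (Finset.univ.filter fun e => ends e ⊆ U P ∪ T) ∧
      ((greedy P).card ≤ 5 * d ∧ μ₀ ≤ (coreR T P).card)) with h𝓕
  refine (Finset.abs_sum_le_sum_abs _ _).trans ?_
  have hVT : ∀ P, U P \ T ∪ T = U P ∪ T := fun P => Finset.sdiff_union_self_eq_union
  have hin : ∀ P ∈ 𝓕, ∀ e ∈ P, ends e ⊆ U P ∪ T := by
    intro P hP e he
    have h1 := (Finset.mem_filter.1 hP).2.1 he
    rw [Finset.mem_union, Finset.mem_union] at h1
    rcases h1 with (h1 | h1) | h1
    · exact ((isCore T P).present e he h1).trans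
        (Finset.subset_union_left.trans Finset.subset_union_left)
    · exact (Finset.subset_biUnion_of_mem ends (mem_greedy he h1)).trans
        (Finset.subset_union_right.trans Finset.subset_union_left)
    · exact (Finset.mem_filter.1 h1).2
  have hb : 9 * (n : ℝ) ^ k * z ^ (-63544 * (T.card : ℝ) - 5135 * μ₀) =
      (3 * c * z ^ (2456 * (T.card : ℝ) - 5135 * μ₀)) * 3 := by
    rw [hcard]
    have : z ^ (-63544 * (T.card : ℝ) - 5135 * μ₀) =
        z ^ (-66000 * (T.card : ℝ)) * z ^ (2456 * (T.card : ℝ) - 5135 * μ₀) := by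
      rw [S.rpow_mul]; congr 1; ring
    rw [this]; ring
  rw [hb]
  refine sum_abs_le_of_sq_le T 𝓕 (fun P => U P \ T) (fun P hP e he => ?_) _
    (mul_nonneg (by positivity) (S.rpow_pos _).le) fun P hP => ?_
  · rw [hVT]; exact hin P hP e he
  have hcore := isCore T P
  obtain ⟨-, hPQ, hg5, hμ₀⟩ := Finset.mem_filter.1 hP
  set I := (coreR T P).image Prod.fst with hI
  obtain ⟨β, hβR⟩ := exists_partner (coreR T P)
  set μ := (coreR T P).card with hμ
  have hIcard : I.card = μ := hcore.card_image_fst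
  have hμd : μ ≤ 10 * d := by
    have := hcore.card_le_greedy
    omega
  have hgr := hcore.card_greedy_le
  -- `U P` has at most `3 μ` blocks from the core and `2 * (2 μ + |T|)` from the greedy matching
  have hv : (U P \ T).card ≤ 7 * μ + 2 * T.card := by
    have h1 := Finset.card_le_card (Finset.sdiff_subset (s := U P) (t := T))
    have h2 : (U P).card ≤ (coreU T P).card + (cover (greedy P)).card := Finset.card_union_le _ _
    have h3 := hcore.card_U
    have h4 := card_cover_le (greedy P)
    omega
  have hu : (U P \ T ∪ T).card ≤ 7 * μ + 3 * T.card := by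
    have := Finset.card_union_le (U P \ T) T
    omega
  have hβinj : Set.InjOn β I := by
    intro i hi j hj hij
    have := hcore.snd_inj _ (hβR i hi) _ (hβR j hj) hij
    exact congrArg Prod.fst this
  have hτ : (0 : ℝ) ≤ z ^ (-26400 : ℝ) := (S.rpow_pos _).le
  have hnτ : (1 : ℝ) ≤ z ^ (-26400 : ℝ) * n := by
    rw [S.n_eq, S.rpow_mul]
    exact Real.one_le_rpow (by linarith [S.two_le_z]) (by norm_num)
  have hITd : ∀ i ∈ I, i ∈ coreU T P ∧ i ∉ T := by
    intro i hi
    have := hcore.fst_mem _ (hβR i hi)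
    exact ⟨this, Finset.disjoint_left.1 hcore.disj this⟩
  have hBTd : ∀ i ∈ I, β i ∈ coreU T P ∧ β i ∉ T := by
    intro i hi
    have := hcore.snd_mem _ (hβR i hi)
    exact ⟨this, Finset.disjoint_left.1 hcore.disj this⟩
  have hIB : Disjoint I (I.image β) := by
    rw [Finset.disjoint_left]
    intro i hi hi'
    obtain ⟨j, hj, rfl⟩ := Finset.mem_image.1 hi'
    exact hcore.fst_ne_snd _ (hβR _ hi) _ (hβR j hj) rfl
  -- every free pair joins `T ∪ I` to a block outside `U P ∪ T`
  have hfree : ∀ e ∈ ((coreQ T P ∪ matchQ P) ∪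
      Finset.univ.filter fun e => ends e ⊆ U P ∪ T)ᶜ,
      ∃ i ∈ T ∪ I, ∃ j ∉ U P ∪ T, ends e = {i, j} := by
    intro e he
    simp only [Finset.mem_compl, Finset.mem_union, Finset.mem_filter, Finset.mem_univ, true_and,
      not_or] at he
    obtain ⟨i, hi, hi'⟩ := Finset.not_disjoint_iff.1 (hcore.unqueried e he.1.1)
    have hiU : i ∈ U P ∪ T := by
      rcases Finset.mem_union.1 hi' with h | h
      · exact Finset.mem_union_right _ h
      · exact Finset.mem_union_left _ (Finset.mem_union_left _ (hITd i h).1)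
    have hns := he.2
    rw [Finset.not_subset] at hns
    obtain ⟨j, hj, hjU⟩ := hns
    refine ⟨i, hi', j, hjU, ?_⟩
    symm
    refine Finset.eq_of_subset_of_card_le ?_ ?_
    · intro a ha
      simp only [Finset.mem_insert, Finset.mem_singleton] at ha
      rcases ha with rfl | rfl <;> assumption
    · rw [card_ends, Finset.card_pair]
      rintro rfl; exact hjU hiU
  have hTIU : T ∪ I ⊆ U P ∪ T := by
    intro i hi
    rcases Finset.mem_union.1 hi with h | h
    · exact Finset.mem_union_right _ h
    · exact Finset.mem_union_left _ (Finset.mem_union_left _ (hITd i h).1)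
  have key := sq_sum_interval_le (U := U P ∪ T) (P := P) (I := I) (β := β) (Q := Qb) (Q₀ := Q)
    (m := n) (τ := z ^ (-26400 : ℝ)) (κ := 1 + (k : ℝ)⁻¹)
    (Fr := ((coreQ T P ∪ matchQ P) ∪ Finset.univ.filter fun e => ends e ⊆ U P ∪ T)ᶜ)
    hx S.ortho hτ ?_ hn ?_ hQQ hβinj hIB ?_ (hin P hP) ?_ ?_ ?_ ?_ ?_ ?_
  · have hw := S.weight_le (p := P.card) (u := (U P \ T ∪ T).card) (v := (U P \ T).card)
      -- `304 = 4 * (7 * 10 + 3 * 2)`, since `μ ≤ 10 d` and `|T| ≤ 2 d`; the loss `z ^ {-26400}` is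
      -- `lam / n`
      (w := 304) (μ := μ) (θ := 26400) ?_ ?_
    · rw [div_self hn.ne', mul_one, hIcard, ← hc] at key
      have hκ3 := one_add_inv_pow_le k
      have hexp : z ^ ((304 : ℕ) * ((U P \ T ∪ T).card : ℝ) + (1 - 26400) * μ +
          2000 * ((U P \ T).card : ℝ)) ≤ (z ^ (2456 * (T.card : ℝ) - 5135 * μ₀)) ^ 2 := by
        rw [S.rpow_pow]
        refine S.rpow_le ?_
        have a1 : ((U P \ T ∪ T).card : ℝ) ≤ 7 * μ + 3 * T.card := by exact_mod_cast hu
        have a2 : ((U P \ T).card : ℝ) ≤ 7 * μ + 2 * T.card := by exact_mod_cast hv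
        have a3 : (μ₀ : ℝ) ≤ μ := by exact_mod_cast hμ₀
        have a4 : (0 : ℝ) ≤ μ := Nat.cast_nonneg _
        push_cast
        linarith
      have hW0 : 0 ≤ ((k : ℝ) ^ (U P \ T).card * 2 ^ ((U P \ T ∪ T).card ^ 2)) ^ 2 := sq_nonneg _
      calc _ ≤ ((1 + (k : ℝ)⁻¹) ^ k) ^ 2 * c ^ 2 * x ^ (2 * P.card) *
            (2 * z ^ (-26400 : ℝ)) ^ μ *
            ((k : ℝ) ^ (U P \ T).card * 2 ^ ((U P \ T ∪ T).card ^ 2)) ^ 2 :=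
            mul_le_mul_of_nonneg_right key hW0
        _ = (((1 + (k : ℝ)⁻¹) ^ k) ^ 2 * c ^ 2) * (x ^ (2 * P.card) *
            (2 * z ^ (-26400 : ℝ)) ^ μ *
            ((k : ℝ) ^ (U P \ T).card * 2 ^ ((U P \ T ∪ T).card ^ 2)) ^ 2) := by ring
        _ ≤ (3 ^ 2 * c ^ 2) * (z ^ (2456 * (T.card : ℝ) - 5135 * μ₀)) ^ 2 := by
            refine mul_le_mul ?_ (hw.trans hexp) (by positivity) (by positivity)
            exact mul_le_mul_of_nonneg_right
              (pow_le_pow_left₀ (by positivity) hκ3 2) (sq_nonneg _)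
        _ = _ := by ring
    · rw [hVT]
      refine le_trans (Finset.card_le_card ?_) (card_pairs_inside_le _)
      intro e he
      exact Finset.mem_filter.2 ⟨Finset.mem_univ _, hin P hP e he⟩
    · omega
  · rw [S.n_eq, S.rpow_mul]
    exact S.rpow_le (by norm_num)
  · have : (0 : ℝ) ≤ (k : ℝ)⁻¹ := by positivity
    linarith
  · omega
  · intro e he
    obtain ⟨i, hi, j, hj, hij⟩ := hfree e he
    refine ⟨i, hTIU hi, j, hj, ?_, hij⟩
    intro hiB
    rcases Finset.mem_union.1 hi with h | h
    · obtain ⟨i', hi', rfl⟩ := Finset.mem_image.1 hiB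
      exact (hBTd i' hi').2 h
    · exact Finset.disjoint_left.1 hIB h hiB
  · intro j hj
    obtain ⟨i, hi, rfl⟩ := Finset.mem_image.1 hj
    exact Finset.mem_union_left _ (Finset.mem_union_left _ (hBTd i hi).1)
  · intro i hi
    exact hcore.edge _ (hβR i hi)
  · intro i hi
    simp [Qb, (hITd i hi).2]
  · intro i hi
    simpa [Qb, (hBTd i hi).2] using hnτ
  · intro t _ j hj
    have hjT : j ∉ T := fun h => hj (Finset.mem_union_right _ h)
    obtain ⟨X, hX, hXj, hXe⟩ := exists_prod_one_add_chrPr_eq (G := G) (x := x) (j := j)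
      (F := (((coreQ T P ∪ matchQ P) ∪
        Finset.univ.filter fun e => ends e ⊆ U P ∪ T)ᶜ).filter fun e => j ∈ ends e)
      (A := T ∪ I) (fun e he => by
        obtain ⟨he1, he2⟩ := Finset.mem_filter.1 he
        obtain ⟨i, hi, j', hj', hij⟩ := hfree e he1
        have hij' : i ≠ j := by rintro rfl; exact hj (hTIU hi)
        refine ⟨i, hi, hij', ?_⟩
        rw [hij, Finset.mem_insert, Finset.mem_singleton] at he2
        rcases he2 with h | h
        · exact absurd h.symm hij'
        · rw [hij, h]) t
    simp only [hXe]
    have hXcard : X.card ≤ 12 * d := by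
      have h1 := (Finset.card_le_card hX).trans Finset.card_image_le
      have h2 := Finset.card_union_le T I
      omega
    have := S.codegree_le hXcard hXj
    simpa [Qb, hjT] using this

end Absolute

/-! ### Nonnegativity on balanced rectangles -/

section Relative

variable {n k d : ℕ} {G : SimpleGraph (BlockVertex n k)} {x z : ℝ}

/-- If the vertices fixed in the blocks of `T` are adjacent to everything and the other sides of the
rectangle are large and have common neighbourhoods of at most about the expected size, then the
contribution of the graphs with a small core is dominated by that of the empty core and hence
nonnegative. -/
theorem Setting.sum_small_core_nonneg (S : Setting G d x z) {T : Finset (Fin k)}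
    {Q : Fin k → Finset (Fin n)}
    (hadj : ∀ t ∈ Fintype.piFinset Q, ∀ e : Pr k, ¬ Disjoint (ends e) T → 1 + chrPr G x e t = x)
    (hsize : ∀ j ∉ T, z ^ (59399 : ℝ) ≤ (Q j).card)
    (hcod : ∀ j ∉ T, ∀ X : Finset (BlockVertex n k), X.card ≤ 12 * d →
      (∀ v ∈ X, v.1 ≠ j ∧ v.1 ∉ T ∧ v.2 ∈ Q v.1) →
      ∑ u ∈ Q j, ∏ v ∈ X, (1 + chr G x (j, u) v) ≤ (1 + (k : ℝ)⁻¹) * (Q j).card) :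
    0 ≤ ∑ t ∈ Fintype.piFinset Q, ∑ H with (coreR T H).card ≤ d, ∏ e ∈ H, chrPr G x e t := by
  classical
  have hx := S.two_le_x
  have hκ1 : 1 ≤ 1 + (k : ℝ)⁻¹ := by
    have : (0 : ℝ) ≤ (k : ℝ)⁻¹ := by positivity
    linarith
  have hloc : IsLocal (coreQ T) (fun H => (coreR T H).card) :=
    (isLocal_core T).comp fun s => s.2.2.card
  rw [sum_piFinset_eq_of_isLocal hloc (fun s => s ≤ d) Q]
  set 𝓕 := Finset.univ.filter fun P => P ⊆ coreQ T P ∧ (coreR T P).card ≤ d with h𝓕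
  set c : ℝ := ((Fintype.piFinset Q).card : ℝ) with hc
  have hc0 : 0 ≤ c := Nat.cast_nonneg _
  let Fr : Finset (Pr k) → Finset (Pr k) := fun P =>
    (coreQ T P)ᶜ.filter fun e => Disjoint (ends e) T
  let Z : Finset (Pr k) → ℝ := fun P => ∑ t ∈ Fintype.piFinset Q,
    (∏ e ∈ P, chrPr G x e t) * ∏ e ∈ Fr P, (1 + chrPr G x e t)
  set N := (Finset.univ.filter fun e : Pr k => ¬ Disjoint (ends e) T).card with hN
  -- the pairs that meet `T` contribute a constant factor
  have hfac : ∀ P, ∑ t ∈ Fintype.piFinset Q,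
      (∏ e ∈ P, chrPr G x e t) * ∏ e ∈ (coreQ T P)ᶜ, (1 + chrPr G x e t) = x ^ N * Z P := by
    intro P
    rw [Finset.mul_sum]
    refine Finset.sum_congr rfl fun t ht => ?_
    rw [← Finset.prod_filter_mul_prod_filter_not (coreQ T P)ᶜ (fun e => Disjoint (ends e) T)]
    have h1 : (coreQ T P)ᶜ.filter (fun e => ¬ Disjoint (ends e) T) =
        Finset.univ.filter fun e : Pr k => ¬ Disjoint (ends e) T := by
      ext e
      simp only [Finset.mem_filter, Finset.mem_compl, Finset.mem_univ, true_and,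
        and_iff_right_iff_imp]
      exact fun h h' => h ((isCore T P).queried_disj e h')
    have h2 : ∏ e ∈ (coreQ T P)ᶜ with ¬ Disjoint (ends e) T, (1 + chrPr G x e t) = x ^ N := by
      rw [h1, hN, ← Finset.prod_const]
      exact Finset.prod_congr rfl fun e he => hadj t ht e (Finset.mem_filter.1 he).2
    rw [h2]
    ring
  rw [Finset.sum_congr rfl fun P _ => hfac P, ← Finset.mul_sum]
  refine mul_nonneg (pow_nonneg (by linarith) _) ?_
  have hRempty : coreR T (∅ : Finset (Pr k)) = ∅ := by
    rw [Finset.eq_empty_iff_forall_notMem]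
    intro a ha
    obtain ⟨e, he, -⟩ := (isCore T ∅).edge a ha
    exact Finset.notMem_empty _ he
  have hmem : ∅ ∈ 𝓕 := by simp [h𝓕, hRempty]
  have hZempty : Z ∅ = c := by
    have : Fr ∅ = ∅ := by
      rw [Finset.eq_empty_iff_forall_notMem]
      intro e he
      obtain ⟨h1, h2⟩ := Finset.mem_filter.1 he
      have := (isCore T ∅).unqueried e (Finset.mem_compl.1 h1)
      rw [hRempty, Finset.image_empty, Finset.union_empty] at this
      exact this h2
    simp only [Z, this]
    simp [hc]
  rw [← Finset.add_sum_erase _ _ hmem, hZempty]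
  -- a nonempty set of present pairs has a nonempty core, which makes its contribution small
  have hmain : ∑ P ∈ 𝓕.erase ∅, |Z P| ≤ (3 * c * z ^ (-6881 : ℝ)) * 3 := by
    refine sum_abs_le_of_sq_le ∅ (𝓕.erase ∅) (coreU T) ?_ Z
      (mul_nonneg (by positivity) (S.rpow_pos _).le) ?_
    · intro P hP e he
      have hP2 := (Finset.mem_filter.1 (Finset.mem_of_mem_erase hP)).2
      rw [Finset.union_empty]
      exact (isCore T P).present e he (hP2.1 he)
    intro P hP
    have hPne := Finset.ne_of_mem_erase hP
    obtain ⟨-, hPQ, hRd⟩ := Finset.mem_filter.1 (Finset.mem_of_mem_erase hP)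
    rw [Finset.union_empty]
    have hcore := isCore T P
    have hin : ∀ e ∈ P, ends e ⊆ coreU T P := fun e he => hcore.present e he (hPQ he)
    set I := (coreR T P).image Prod.fst with hI
    obtain ⟨β, hβR⟩ := exists_partner (coreR T P)
    set μ := (coreR T P).card with hμ
    have hIcard : I.card = μ := hcore.card_image_fst
    have hμ1 : 1 ≤ μ := by
      by_contra hlt
      have hμ0 : μ = 0 := by omega
      have hC : coreC T P = ∅ := by
        have := hcore.card_C
        rw [← Finset.card_eq_zero]; omega
      obtain ⟨e, he⟩ := Finset.nonempty_iff_ne_empty.2 hPne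
      have h1 := hcore.covered e he
      rw [hC, Finset.union_empty] at h1
      exact h1 (hcore.queried_disj e (hPQ he))
    have hu := hcore.card_U
    have hβinj : Set.InjOn β I := by
      intro i hi j hj hij
      have := hcore.snd_inj _ (hβR i hi) _ (hβR j hj) hij
      exact congrArg Prod.fst this
    have hITd : ∀ i ∈ I, i ∈ coreU T P ∧ i ∉ T := by
      intro i hi
      have := hcore.fst_mem _ (hβR i hi)
      exact ⟨this, Finset.disjoint_left.1 hcore.disj this⟩
    have hBTd : ∀ i ∈ I, β i ∈ coreU T P ∧ β i ∉ T := by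
      intro i hi
      have := hcore.snd_mem _ (hβR i hi)
      exact ⟨this, Finset.disjoint_left.1 hcore.disj this⟩
    have hIB : Disjoint I (I.image β) := by
      rw [Finset.disjoint_left]
      intro i hi hi'
      obtain ⟨j, hj, rfl⟩ := Finset.mem_image.1 hi'
      exact hcore.fst_ne_snd _ (hβR _ hi) _ (hβR j hj) rfl
    have hfree : ∀ e ∈ Fr P, ∃ i ∈ I, ∃ j ∉ coreU T P, ends e = {i, j} := by
      intro e he
      obtain ⟨he1, he2⟩ := Finset.mem_filter.1 he
      rw [Finset.mem_compl] at he1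
      obtain ⟨i, hi, hi'⟩ := Finset.not_disjoint_iff.1 (hcore.unqueried e he1)
      have hiI : i ∈ I := (Finset.mem_union.1 hi').resolve_left (Finset.disjoint_left.1 he2 hi)
      have hns : ¬ ends e ⊆ coreU T P := fun h => he1 (hcore.inside e h)
      rw [Finset.not_subset] at hns
      obtain ⟨j, hj, hjU⟩ := hns
      refine ⟨i, hiI, j, hjU, ?_⟩
      symm
      refine Finset.eq_of_subset_of_card_le ?_ ?_
      · intro a ha
        simp only [Finset.mem_insert, Finset.mem_singleton] at ha
        rcases ha with rfl | rfl <;> assumption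
      · rw [card_ends, Finset.card_pair]
        rintro rfl; exact hjU (hITd _ hiI).1
    have key := sq_sum_interval_le (U := coreU T P) (P := P) (I := I) (β := β) (Q := Q) (Q₀ := Q)
      (m := z ^ (59399 : ℝ)) (τ := z ^ (-26400 : ℝ)) (κ := 1 + (k : ℝ)⁻¹) (Fr := Fr P)
      hx S.ortho (S.rpow_pos _).le ?_ (S.rpow_pos _) hκ1 (fun _ => subset_rfl) hβinj hIB ?_ hin
      ?_ ?_ ?_ ?_ ?_ ?_
    · have hw := S.weight_le (p := P.card) (u := (coreU T P).card) (v := (coreU T P).card)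
        -- the sides have `m = z ^ 59399` vertices, so each matched block gains `2 τ n / m` with
        -- `-26400 + 66000 - 59399 = -19799`
        (w := 12) (μ := μ) (θ := 19799) ?_ ?_
      · have hτ : 2 * z ^ (-26400 : ℝ) * (n / z ^ (59399 : ℝ)) = 2 * z ^ (-19799 : ℝ) := by
          rw [S.n_eq, ← Real.rpow_sub S.z_pos, mul_assoc, S.rpow_mul]
          norm_num
        rw [hτ, hIcard, ← hc] at key
        have hκ3 := one_add_inv_pow_le k
        have hexp : z ^ ((12 : ℕ) * ((coreU T P).card : ℝ) + (1 - 19799) * μ +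
            2000 * ((coreU T P).card : ℝ)) ≤ (z ^ (-6881 : ℝ)) ^ 2 := by
          rw [S.rpow_pow]
          refine S.rpow_le ?_
          have a1 : ((coreU T P).card : ℝ) ≤ 3 * μ := by exact_mod_cast hu
          have a3 : (1 : ℝ) ≤ μ := by exact_mod_cast hμ1
          push_cast
          linarith
        have hW0 : 0 ≤ ((k : ℝ) ^ (coreU T P).card * 2 ^ ((coreU T P).card ^ 2)) ^ 2 :=
          sq_nonneg _
        calc _ ≤ ((1 + (k : ℝ)⁻¹) ^ k) ^ 2 * c ^ 2 * x ^ (2 * P.card) *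
              (2 * z ^ (-19799 : ℝ)) ^ μ *
              ((k : ℝ) ^ (coreU T P).card * 2 ^ ((coreU T P).card ^ 2)) ^ 2 :=
              mul_le_mul_of_nonneg_right key hW0
          _ = (((1 + (k : ℝ)⁻¹) ^ k) ^ 2 * c ^ 2) * (x ^ (2 * P.card) *
              (2 * z ^ (-19799 : ℝ)) ^ μ *
              ((k : ℝ) ^ (coreU T P).card * 2 ^ ((coreU T P).card ^ 2)) ^ 2) := by ring
          _ ≤ (3 ^ 2 * c ^ 2) * (z ^ (-6881 : ℝ)) ^ 2 := by
              have := S.rpow_pos (-19799)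
              refine mul_le_mul ?_ (hw.trans hexp) (by positivity) (by positivity)
              exact mul_le_mul_of_nonneg_right
                (pow_le_pow_left₀ (by positivity) hκ3 2) (sq_nonneg _)
          _ = _ := by ring
      · refine le_trans (Finset.card_le_card ?_) (card_pairs_inside_le _)
        intro e he
        exact Finset.mem_filter.2 ⟨Finset.mem_univ _, hin e he⟩
      · omega
    · rw [S.n_eq, S.rpow_mul]
      exact S.rpow_le (by norm_num)
    · omega
    · intro e he
      obtain ⟨i, hi, j, hj, hij⟩ := hfree e he
      exact ⟨i, (hITd i hi).1, j, hj, Finset.disjoint_left.1 hIB hi, hij⟩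
    · intro j hj
      obtain ⟨i, hi, rfl⟩ := Finset.mem_image.1 hj
      exact (hBTd i hi).1
    · intro i hi
      exact hcore.edge _ (hβR i hi)
    · intro i hi
      exact hsize i (hITd i hi).2
    · intro i hi
      calc (1 : ℝ) ≤ z ^ (-26400 : ℝ) * z ^ (59399 : ℝ) := by
            rw [S.rpow_mul]
            exact Real.one_le_rpow (by linarith [S.two_le_z]) (by norm_num)
        _ ≤ _ := mul_le_mul_of_nonneg_left (hsize _ (hBTd i hi).2) (S.rpow_pos _).le
    · intro t ht j hj
      by_cases hjT : j ∈ T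
      · have hemp : ((Fr P).filter fun e => j ∈ ends e) = ∅ := by
          rw [Finset.filter_eq_empty_iff]
          intro e he h
          exact Finset.disjoint_left.1 (Finset.mem_filter.1 he).2 h hjT
        rw [hemp]
        simp only [Finset.prod_empty, Finset.sum_const, nsmul_eq_mul, mul_one]
        exact le_mul_of_one_le_left (Nat.cast_nonneg _) hκ1
      · obtain ⟨X, hX, hXj, hXe⟩ := exists_prod_one_add_chrPr_eq (G := G) (x := x) (j := j)
          (F := (Fr P).filter fun e => j ∈ ends e)
          (A := I) (fun e he => by
            obtain ⟨he1, he2⟩ := Finset.mem_filter.1 he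
            obtain ⟨i, hi, j', hj', hij⟩ := hfree e he1
            have hij' : i ≠ j := by rintro rfl; exact hj (hITd _ hi).1
            refine ⟨i, hi, hij', ?_⟩
            rw [hij, Finset.mem_insert, Finset.mem_singleton] at he2
            rcases he2 with h | h
            · exact absurd h.symm hij'
            · rw [hij, h]) t
        simp only [hXe]
        refine hcod j hjT X ?_ fun v hv => ⟨hXj v hv, ?_⟩
        · have h1 := (Finset.card_le_card hX).trans Finset.card_image_le
          omega
        · obtain ⟨i, hi, rfl⟩ := Finset.mem_image.1 (hX hv)
          exact ⟨(hITd i hi).2, Fintype.mem_piFinset.1 ht i⟩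
  have h9 : (9 : ℝ) * z ^ (-6881 : ℝ) ≤ 1 := by
    have h1 : (9 : ℝ) ≤ z ^ (4 : ℝ) := by
      have := S.nat_two_pow_le 4
      push_cast at this
      linarith
    calc (9 : ℝ) * z ^ (-6881 : ℝ) ≤ z ^ (4 : ℝ) * z ^ (-6881 : ℝ) :=
          mul_le_mul_of_nonneg_right h1 (S.rpow_pos _).le
      _ ≤ z ^ (0 : ℝ) := by rw [S.rpow_mul]; exact S.rpow_le (by norm_num)
      _ = 1 := Real.rpow_zero _
  have h10 : ∑ P ∈ 𝓕.erase ∅, |Z P| ≤ c := by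
    refine hmain.trans ?_
    nlinarith
  have h11 : -(∑ P ∈ 𝓕.erase ∅, |Z P|) ≤ ∑ P ∈ 𝓕.erase ∅, Z P := by
    rw [← Finset.sum_neg_distrib]
    exact Finset.sum_le_sum fun P _ => neg_abs_le _
  linarith

end Relative

/-! ### The dual weight -/

section Dual

variable {n k d : ℕ} {G : SimpleGraph (BlockVertex n k)} {x z : ℝ}

/-- Splitting one side of a rectangle. -/
lemma sum_piFinset_update_union (F : (Fin k → Fin n) → ℝ) (Q : Fin k → Finset (Fin n)) (j : Fin k)
    {A B : Finset (Fin n)} (hAB : Disjoint A B) (hQ : Q j = A ∪ B) :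
    ∑ t ∈ Fintype.piFinset Q, F t = ∑ t ∈ Fintype.piFinset (Function.update Q j A), F t +
      ∑ t ∈ Fintype.piFinset (Function.update Q j B), F t := by
  classical
  have hmem : ∀ (D : Finset (Fin n)) t, t ∈ Fintype.piFinset (Function.update Q j D) ↔
      t j ∈ D ∧ ∀ i, i ≠ j → t i ∈ Q i := by
    intro D t
    rw [Fintype.mem_piFinset]
    constructor
    · intro h
      exact ⟨by simpa using h j, fun i hi => by simpa [hi] using h i⟩
    · rintro ⟨h1, h2⟩ i
      by_cases hi : i = j
      · subst hi; simpa using h1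
      · simpa [hi] using h2 i hi
  rw [← Finset.sum_union]
  · refine Finset.sum_congr ?_ fun _ _ => rfl
    ext t
    rw [Finset.mem_union, hmem, hmem, Fintype.mem_piFinset]
    constructor
    · intro h
      have := h j
      rw [hQ, Finset.mem_union] at this
      exact this.imp (fun h' => ⟨h', fun i _ => h i⟩) (fun h' => ⟨h', fun i _ => h i⟩)
    · intro h i
      by_cases hi : i = j
      · subst hi
        rw [hQ, Finset.mem_union]
        exact h.imp And.left And.left
      · rcases h with h | h <;> exact h.2 i hi
  · rw [Finset.disjoint_left]
    intro t h1 h2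
    exact Finset.disjoint_left.1 hAB ((hmem _ _).1 h1).1 ((hmem _ _).1 h2).1

/-- Removing the vertices in `W` from a rectangle costs at most the weights of the rectangles in
which one of these vertices is fixed. -/
lemma sum_piFinset_remove (F : (Fin k → Fin n) → ℝ) {b : ℝ} (hb : 0 ≤ b)
    (W : Finset (BlockVertex n k)) (Q : Fin k → Finset (Fin n))
    (h : ∀ w ∈ W, ∀ Q' : Fin k → Finset (Fin n), (∀ i, Q' i ⊆ Q i) →
      -b ≤ ∑ t ∈ Fintype.piFinset (Function.update Q' w.1 {w.2}), F t) :
    (∑ t ∈ Fintype.piFinset (fun j => (Q j).filter fun u => (j, u) ∉ W), F t) - W.card * b ≤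
      ∑ t ∈ Fintype.piFinset Q, F t := by
  classical
  induction W using Finset.induction with
  | empty => simp
  | insert w W hw ih =>
    have ih' := ih fun w' hw' => h w' (Finset.mem_insert_of_mem hw')
    refine le_trans ?_ ih'
    rw [Finset.card_insert_of_notMem hw]
    set Q₁ : Fin k → Finset (Fin n) := fun j => (Q j).filter fun u => (j, u) ∉ W with hQ₁
    set Q₂ : Fin k → Finset (Fin n) := fun j => (Q j).filter fun u => (j, u) ∉ insert w W with hQ₂
    have hQ₂' : Q₂ = Function.update Q₁ w.1 ((Q₁ w.1).filter fun u => u ≠ w.2) := by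
      ext j u
      by_cases hj : j = w.1
      · subst hj
        simp only [hQ₂, hQ₁, Function.update_self, Finset.mem_filter, Finset.mem_insert, not_or]
        have : (w.1, u) = w ↔ u = w.2 := by
          constructor
          · intro h; rw [← h]
          · rintro rfl; rfl
        rw [this]; tauto
      · simp only [hQ₂, hQ₁, Function.update_of_ne hj, Finset.mem_filter, Finset.mem_insert, not_or]
        have : (j, u) ≠ w := fun h => hj (by rw [← h])
        tauto
    by_cases hmem : w.2 ∈ Q₁ w.1
    · have h1 := sum_piFinset_update_union F Q₁ w.1
        (A := (Q₁ w.1).filter fun u => u ≠ w.2) (B := {w.2}) (by simp)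
        (by ext u; simp only [Finset.mem_union, Finset.mem_filter, Finset.mem_singleton]
            by_cases hu : u = w.2
            · subst hu; simp [hmem]
            · simp [hu])
      rw [← hQ₂'] at h1
      have h2 := h w (Finset.mem_insert_self _ _) Q₁ fun i => Finset.filter_subset _ _
      rw [h1]
      push_cast
      linarith
    · have h1 : Q₂ = Q₁ := by
        rw [hQ₂', Finset.filter_true_of_mem, Function.update_eq_self]
        rintro u hu rfl
        exact hmem hu
      rw [h1]
      push_cast
      linarith

/-- The unnormalized weight of a tuple: the sum of the characters of all graphs on the blocks with a
small greedy matching. -/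
noncomputable def wt (G : SimpleGraph (BlockVertex n k)) (x : ℝ) (d : ℕ) (t : Fin k → Fin n) : ℝ :=
  ∑ H : Finset (Pr k) with (greedy H).card ≤ 5 * d, ∏ e ∈ H, chrPr G x e t

/-- The part of the weight that comes from graphs with a small core relative to `T`. -/
noncomputable def wtSmall (G : SimpleGraph (BlockVertex n k)) (x : ℝ) (d : ℕ) (T : Finset (Fin k))
    (t : Fin k → Fin n) : ℝ :=
  ∑ H : Finset (Pr k) with (coreR T H).card ≤ d, ∏ e ∈ H, chrPr G x e t

/-- The weight of a rectangle is determined by the graphs with a small core, up to an error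
that is exponentially small in `d`. -/
lemma Setting.abs_sum_wt_sub_le (S : Setting G d x z) {T : Finset (Fin k)} (hT : T.card ≤ 2 * d)
    {Q : Fin k → Finset (Fin n)} (hQ : ∀ i ∈ T, (Q i).card ≤ 1) :
    |∑ t ∈ Fintype.piFinset Q, wt G x d t - ∑ t ∈ Fintype.piFinset Q, wtSmall G x d T t| ≤
      9 * (n : ℝ) ^ k * z ^ (-63544 * (T.card : ℝ) - 5135 * d) := by
  classical
  have h := S.abs_sum_le hT hQ (d + 1)
  have hle : 9 * (n : ℝ) ^ k * z ^ (-63544 * (T.card : ℝ) - 5135 * ((d + 1 : ℕ) : ℝ)) ≤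
      9 * (n : ℝ) ^ k * z ^ (-63544 * (T.card : ℝ) - 5135 * d) := by
    refine mul_le_mul_of_nonneg_left (S.rpow_le ?_) (by positivity)
    push_cast; linarith
  refine le_trans (le_of_eq ?_) (h.trans hle)
  congr 1
  rw [← Finset.sum_sub_distrib]
  refine Finset.sum_congr rfl fun t _ => ?_
  unfold wt wtSmall
  rw [sub_eq_iff_eq_add', ← Finset.sum_filter_add_sum_filter_not _
    (fun H : Finset (Pr k) => (coreR T H).card ≤ d), Finset.filter_filter, Finset.filter_filter]
  congr 1
  · refine Finset.sum_congr (Finset.filter_congr fun H _ => ⟨And.right, fun h => ⟨?_, h⟩⟩)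
      fun _ _ => rfl
    have := (isCore T H).card_greedy_le
    omega
  · refine Finset.sum_congr (Finset.filter_congr fun H _ => ?_) fun _ _ => rfl
    rw [not_le]
    rfl

/-- Graphs with a small core do not contribute at tuples that have a non-adjacent pair of vertices
meeting `T`. -/
lemma wtSmall_eq_zero {T : Finset (Fin k)} {t : Fin k → Fin n} {e : Pr k}
    (he : ¬ Disjoint (ends e) T) (h0 : 1 + chrPr G x e t = 0) : wtSmall G x d T t = 0 := by
  classical
  have hloc : IsLocal (coreQ T) (fun H => (coreR T H).card) :=
    (isLocal_core T).comp fun s => s.2.2.card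
  unfold wtSmall
  rw [sum_prod_eq_of_isLocal hloc (fun s => s ≤ d) fun e => chrPr G x e t]
  refine Finset.sum_eq_zero fun P _ => ?_
  rw [Finset.prod_eq_zero (Finset.mem_compl.2 fun h => he ((isCore T P).queried_disj e h)) h0,
    mul_zero]

lemma one_add_chrPr_eq_or (e : Pr k) (t : Fin k → Fin n) :
    1 + chrPr G x e t = x ∨ 1 + chrPr G x e t = 0 := by
  unfold chrPr
  rw [one_add_chr]
  split_ifs <;> simp

/-- The weight of the full rectangle is close to the number of tuples: the empty graph contributes
`1` to the weight of every tuple, and all other graphs have a nonempty core. -/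
lemma Setting.le_sum_wt (S : Setting G d x z) :
    (n : ℝ) ^ k / 2 ≤ ∑ t : Fin k → Fin n, wt G x d t := by
  classical
  have h := S.abs_sum_le (T := ∅) (Q := fun _ => Finset.univ) (by simp) (by simp) 1
  rw [Fintype.piFinset_univ] at h
  have hempty : ∀ H : Finset (Pr k), (coreR ∅ H).card = 0 → H = ∅ := by
    intro H hH
    rw [Finset.eq_empty_iff_forall_notMem]
    intro e he
    have h1 := (isCore ∅ H).covered e he
    have h2 := (isCore ∅ H).card_C
    have h3 : coreC ∅ H = ∅ := by rw [← Finset.card_eq_zero]; omega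
    rw [h3] at h1
    exact h1 (by simp)
  have hsplit : ∀ t : Fin k → Fin n, wt G x d t = 1 +
      ∑ H : Finset (Pr k) with (greedy H).card ≤ 5 * d ∧ 1 ≤ (coreR ∅ H).card,
        ∏ e ∈ H, chrPr G x e t := by
    intro t
    unfold wt
    have hg : (greedy (∅ : Finset (Pr k))).card ≤ 5 * d := by
      rw [Finset.subset_empty.1 (greedy_subset ∅)]; simp
    have hR : (coreR ∅ (∅ : Finset (Pr k))).card = 0 := by
      rw [Finset.card_eq_zero, Finset.eq_empty_iff_forall_notMem]
      intro a ha
      obtain ⟨e, he, -⟩ := (isCore ∅ ∅).edge a ha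
      exact Finset.notMem_empty _ he
    have : (Finset.univ.filter fun H : Finset (Pr k) => (greedy H).card ≤ 5 * d) =
        insert ∅ (Finset.univ.filter fun H : Finset (Pr k) =>
          (greedy H).card ≤ 5 * d ∧ 1 ≤ (coreR ∅ H).card) := by
      ext H
      simp only [Finset.mem_filter, Finset.mem_univ, true_and, Finset.mem_insert]
      constructor
      · intro h
        by_cases h0 : (coreR ∅ H).card = 0
        · exact Or.inl (hempty H h0)
        · exact Or.inr ⟨h, by omega⟩
      · rintro (rfl | h)
        · exact hg
        · exact h.1
    rw [this, Finset.sum_insert]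
    · simp
    · simp only [Finset.mem_filter, hR]
      omega
  rw [Finset.sum_congr rfl fun t _ => hsplit t, Finset.sum_add_distrib]
  have hone : ∑ _t : Fin k → Fin n, (1 : ℝ) = (n : ℝ) ^ k := by simp
  rw [hone]
  have h1 : (18 : ℝ) ≤ z ^ (5 : ℝ) := by
    have := S.nat_two_pow_le 5
    push_cast at this
    linarith
  have h2 : 18 * z ^ (-5135 : ℝ) ≤ 1 := by
    calc _ ≤ z ^ (5 : ℝ) * z ^ (-5135 : ℝ) := mul_le_mul_of_nonneg_right h1 (S.rpow_pos _).le
      _ ≤ z ^ (0 : ℝ) := by rw [S.rpow_mul]; exact S.rpow_le (by norm_num)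
      _ = 1 := Real.rpow_zero _
  rw [Finset.card_empty, show (-63544 * ((0 : ℕ) : ℝ) - 5135 * ((1 : ℕ) : ℝ)) = -5135 by norm_num]
    at h
  have h3 := neg_le_of_abs_le h
  have h4 : 9 * (n : ℝ) ^ k * z ^ (-5135 : ℝ) ≤ (n : ℝ) ^ k / 2 := by
    have : (0 : ℝ) ≤ (n : ℝ) ^ k := by positivity
    nlinarith
  linarith

/-- Rectangles inside the cylinder of a non-adjacent pair of vertices have negligible weight: for
`T` the two blocks of the pair, the graphs with a small core do not contribute. -/
lemma Setting.abs_sum_wt_le_of_not_adj (S : Setting G d x z) {Q : Fin k → Finset (Fin n)}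
    {u v : BlockVertex n k} (huv : u.1 < v.1) (hadj : ¬ G.Adj u v) (hu : Q u.1 ⊆ {u.2})
    (hv : Q v.1 ⊆ {v.2}) :
    |∑ t ∈ Fintype.piFinset Q, wt G x d t| ≤ (n : ℝ) ^ k * z ^ (-3000 * (d : ℝ)) := by
  classical
  have hd := S.one_le_d
  have hT : ({u.1, v.1} : Finset (Fin k)).card = 2 := Finset.card_pair huv.ne
  have h := S.abs_sum_wt_sub_le (T := {u.1, v.1}) (Q := Q) (by omega) (by
    intro i hi
    rw [Finset.mem_insert, Finset.mem_singleton] at hi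
    rcases hi with rfl | rfl
    · exact (Finset.card_le_card hu).trans (by simp)
    · exact (Finset.card_le_card hv).trans (by simp))
  have h0 : ∑ t ∈ Fintype.piFinset Q, wtSmall G x d {u.1, v.1} t = 0 := by
    refine Finset.sum_eq_zero fun t ht => ?_
    refine wtSmall_eq_zero (e := ⟨(u.1, v.1), huv⟩) ?_ ?_
    · rw [Finset.not_disjoint_iff]
      exact ⟨u.1, by simp [ends], by simp⟩
    · have h1 := Finset.mem_singleton.1 (hu (Fintype.mem_piFinset.1 ht u.1))
      have h2 := Finset.mem_singleton.1 (hv (Fintype.mem_piFinset.1 ht v.1))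
      simp only [chrPr]
      rw [one_add_chr, h1, h2, if_neg hadj]
  rw [h0, sub_zero, hT] at h
  refine h.trans ?_
  have h9 : (9 : ℝ) ≤ z ^ (4 : ℝ) := by
    have := S.nat_two_pow_le 4
    push_cast at this
    linarith
  calc 9 * (n : ℝ) ^ k * z ^ (-63544 * ((2 : ℕ) : ℝ) - 5135 * d)
      = (n : ℝ) ^ k * (9 * z ^ (-63544 * ((2 : ℕ) : ℝ) - 5135 * d)) := by ring
    _ ≤ (n : ℝ) ^ k * (z ^ (4 : ℝ) * z ^ (-63544 * ((2 : ℕ) : ℝ) - 5135 * d)) := by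
        refine mul_le_mul_of_nonneg_left ?_ (by positivity)
        exact mul_le_mul_of_nonneg_right h9 (S.rpow_pos _).le
    _ ≤ _ := by
        rw [S.rpow_mul]
        refine mul_le_mul_of_nonneg_left (S.rpow_le ?_) (by positivity)
        have : (0 : ℝ) ≤ d := Nat.cast_nonneg _
        push_cast
        linarith

end Dual

/-! ### Nonnegativity of rectangles up to an error -/

section Positivity

variable {n k d : ℕ} {G : SimpleGraph (BlockVertex n k)} {x z : ℝ}

lemma Setting.two_mul_rpow_le (S : Setting G d x z) (a : ℝ) : 2 * z ^ a ≤ z ^ (a + 1) := by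
  calc 2 * z ^ a ≤ z ^ (1 : ℝ) * z ^ a := by
        refine mul_le_mul_of_nonneg_right ?_ (S.rpow_pos _).le
        rw [Real.rpow_one]; exact S.two_le_z
    _ = z ^ (a + 1) := by rw [S.rpow_mul, add_comm]

/-- Few sets of vertices split a given side of a rectangle in an unbalanced way. -/
lemma Setting.card_bad_le (S : Setting G d x z) (j : Fin k) (Q : Finset (Fin n))
    {𝓑 : Finset (Finset (BlockVertex n k))} (hcard : ∀ X ∈ 𝓑, X.card ≤ 12 * d)
    (hj : ∀ X ∈ 𝓑, ∀ v ∈ X, v.1 ≠ j)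
    (hbad : ∀ X ∈ 𝓑, z ^ (56100 : ℝ) ≤ |∑ u ∈ Q, ∏ v ∈ X, chr G x (j, u) v|) :
    (𝓑.card : ℝ) ≤ z ^ (19825 : ℝ) := by
  have h := S.ortho.card_bad_le S.two_le_x (S.rpow_pos _).le (S.rpow_pos _).le hcard hj hbad
  set N : ℝ := (𝓑.card : ℝ) with hN
  have hN0 : 0 ≤ N := Nat.cast_nonneg _
  rcases hN0.eq_or_lt with h0 | hpos
  · rw [← h0]; exact (S.rpow_pos _).le
  have hx24 : x ^ (2 * (12 * d)) ≤ z ^ ((24 : ℕ) : ℝ) := S.x_pow_le_rpow (by omega)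
  have e1 : (z ^ (56100 : ℝ)) ^ 2 = z ^ (112200 : ℝ) := by rw [S.rpow_pow]; norm_num
  have e2 : (n : ℝ) * (n * x ^ (2 * (12 * d))) ≤ z ^ (132024 : ℝ) := by
    calc (n : ℝ) * (n * x ^ (2 * (12 * d))) ≤ n * (n * z ^ ((24 : ℕ) : ℝ)) := by gcongr
      _ = z ^ (132024 : ℝ) := by
          rw [S.n_eq, S.rpow_mul, S.rpow_mul]; norm_num
  have e3 : (n : ℝ) * z ^ (39600 : ℝ) = z ^ (105600 : ℝ) := by
    rw [S.n_eq, S.rpow_mul]; norm_num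
  have e4 : z ^ (112199 : ℝ) + z ^ (105600 : ℝ) ≤ z ^ (112200 : ℝ) := by
    have h1 := S.two_mul_rpow_le 112199
    have h2 : z ^ (105600 : ℝ) ≤ z ^ (112199 : ℝ) := S.rpow_le (by norm_num)
    rw [show (112199 : ℝ) + 1 = 112200 by norm_num] at h1
    linarith
  have h1 : N ^ 2 * z ^ (112200 : ℝ) ≤ N * z ^ (132024 : ℝ) + N ^ 2 * z ^ (105600 : ℝ) := by
    rw [mul_pow, e1] at h
    calc _ ≤ _ := h
      _ = N * (n * (n * x ^ (2 * (12 * d)))) + N ^ 2 * (n * z ^ (39600 : ℝ)) := by ring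
      _ ≤ _ := by
          rw [e3]
          exact add_le_add_left (mul_le_mul_of_nonneg_left e2 hN0) _
  have h2 : N * (N * z ^ (112199 : ℝ)) ≤ N * z ^ (132024 : ℝ) := by
    have h3 : N ^ 2 * (z ^ (112199 : ℝ) + z ^ (105600 : ℝ)) ≤ N ^ 2 * z ^ (112200 : ℝ) :=
      mul_le_mul_of_nonneg_left e4 (sq_nonneg _)
    calc N * (N * z ^ (112199 : ℝ)) = N ^ 2 * (z ^ (112199 : ℝ) + z ^ (105600 : ℝ)) -
          N ^ 2 * z ^ (105600 : ℝ) := by ring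
      _ ≤ _ := by linarith
  have h3 := le_of_mul_le_mul_left h2 hpos
  rw [← le_div_iff₀ (S.rpow_pos _), ← Real.rpow_sub S.z_pos] at h3
  exact h3.trans (S.rpow_le (by norm_num))

/-- After the removal of few exceptional vertices, a rectangle with large sides has balanced common
neighbourhoods. -/
lemma Setting.exists_exceptional (S : Setting G d x z) {T : Finset (Fin k)}
    {Q : Fin k → Finset (Fin n)} (hsize : ∀ j ∉ T, z ^ (59400 : ℝ) ≤ (Q j).card) :
    ∃ W : Finset (BlockVertex n k), (∀ w ∈ W, w.1 ∉ T) ∧ (W.card : ℝ) ≤ z ^ (59400 : ℝ) ∧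
      (∀ j ∉ T, z ^ (59399 : ℝ) ≤ ((Q j).filter fun u => (j, u) ∉ W).card) ∧
      ∀ j ∉ T, ∀ X : Finset (BlockVertex n k), X.card ≤ 12 * d →
        (∀ v ∈ X, v.1 ≠ j ∧ v.1 ∉ T ∧ v.2 ∈ (Q v.1).filter fun u => (v.1, u) ∉ W) →
        ∑ u ∈ Q j with (j, u) ∉ W, ∏ v ∈ X, (1 + chr G x (j, u) v) ≤
          (1 + (k : ℝ)⁻¹) * ((Q j).filter fun u => (j, u) ∉ W).card := by
  classical
  let 𝓑 : Fin k → Finset (Finset (BlockVertex n k)) := fun j =>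
    Finset.univ.filter fun X => X.card ≤ 12 * d ∧ (∀ v ∈ X, v.1 ≠ j) ∧
      z ^ (56100 : ℝ) ≤ |∑ u ∈ Q j, ∏ v ∈ X, chr G x (j, u) v|
  have h𝓑 : ∀ j, ∀ X ∈ 𝓑 j, X.card ≤ 12 * d ∧ (∀ v ∈ X, v.1 ≠ j) ∧
      z ^ (56100 : ℝ) ≤ |∑ u ∈ Q j, ∏ v ∈ X, chr G x (j, u) v| := fun j X hX =>
    (Finset.mem_filter.1 hX).2
  -- the exceptional vertices are those that occur in a set which splits some side unevenly
  let W₀ : Finset (BlockVertex n k) := Finset.univ.biUnion fun j => (𝓑 j).biUnion id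
  let W := W₀.filter fun w => w.1 ∉ T
  have hWcard : (W.card : ℝ) ≤ z ^ (20837 : ℝ) := by
    have h1 : (W₀.card : ℝ) ≤ ∑ j : Fin k, ((𝓑 j).card * (12 * d : ℕ) : ℝ) := by
      have h2 : W₀.card ≤ ∑ j : Fin k, (𝓑 j).card * (12 * d) := by
        refine Finset.card_biUnion_le.trans (Finset.sum_le_sum fun j _ => ?_)
        exact Finset.card_biUnion_le_card_mul _ _ _ fun X hX => (h𝓑 j X hX).1
      exact_mod_cast h2
    have h3 : ((12 * d : ℕ) : ℝ) ≤ z ^ ((12 : ℕ) : ℝ) := by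
      have h4 : ((12 * d : ℕ) : ℝ) ≤ 2 ^ (12 * d) := by
        exact_mod_cast (Nat.lt_two_pow_self (n := 12 * d)).le
      exact h4.trans (S.two_pow_le_rpow (mul_comm _ _).le)
    calc (W.card : ℝ) ≤ W₀.card := by exact_mod_cast Finset.card_filter_le _ _
      _ ≤ ∑ j : Fin k, ((𝓑 j).card * (12 * d : ℕ) : ℝ) := h1
      _ ≤ ∑ _j : Fin k, z ^ (19825 : ℝ) * z ^ ((12 : ℕ) : ℝ) := by
          refine Finset.sum_le_sum fun j _ => ?_
          refine mul_le_mul ?_ h3 (Nat.cast_nonneg _) (S.rpow_pos _).le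
          exact S.card_bad_le j (Q j) (fun X hX => (h𝓑 j X hX).1)
            (fun X hX => (h𝓑 j X hX).2.1) fun X hX => (h𝓑 j X hX).2.2
      _ = k * z ^ (19837 : ℝ) := by
          rw [Finset.sum_const, nsmul_eq_mul, S.rpow_mul]
          simp only [Finset.card_univ, Fintype.card_fin]
          norm_num
      _ ≤ z ^ (1000 : ℝ) * z ^ (19837 : ℝ) :=
          mul_le_mul_of_nonneg_right S.k_le (S.rpow_pos _).le
      _ = z ^ (20837 : ℝ) := by rw [S.rpow_mul]; norm_num
  have hfil : ∀ j, ((Q j).card : ℝ) ≤ ((Q j).filter fun u => (j, u) ∉ W).card + z ^ (20837 : ℝ) := by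
    intro j
    have h1 := Finset.card_filter_add_card_filter_not (s := Q j) (fun u => (j, u) ∉ W)
    have h2 : ((Q j).filter fun u => ¬ (j, u) ∉ W).card ≤ W.card := by
      refine Finset.card_le_card_of_injOn (fun u => (j, u)) ?_ ?_
      · intro u hu
        simpa using (Finset.mem_filter.1 hu).2
      · intro u _ u' _ huu
        exact congrArg Prod.snd huu
    have h3 : ((Q j).card : ℝ) ≤ ((Q j).filter fun u => (j, u) ∉ W).card + W.card := by
      exact_mod_cast h1 ▸ Nat.add_le_add_left h2 _
    linarith
  have hsize' : ∀ j ∉ T, z ^ (59399 : ℝ) ≤ ((Q j).filter fun u => (j, u) ∉ W).card := by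
    intro j hj
    have h1 := hsize j hj
    have h2 := hfil j
    have h3 := S.two_mul_rpow_le 59399
    have h4 : z ^ (20837 : ℝ) ≤ z ^ (59399 : ℝ) := S.rpow_le (by norm_num)
    rw [show (59399 : ℝ) + 1 = 59400 by norm_num] at h3
    linarith
  refine ⟨W, fun w hw => (Finset.mem_filter.1 hw).2, hWcard.trans (S.rpow_le (by norm_num)),
    hsize', ?_⟩
  intro j hj X hX hXQ
  have hgood : ∀ Y ⊆ X, Y.Nonempty →
      |∑ u ∈ Q j, ∏ v ∈ Y, chr G x (j, u) v| ≤ z ^ (56100 : ℝ) := by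
    intro Y hY hne
    by_contra hlt
    have hYB : Y ∈ 𝓑 j := Finset.mem_filter.2 ⟨Finset.mem_univ _,
      (Finset.card_le_card hY).trans hX, fun v hv => (hXQ v (hY hv)).1, (not_le.1 hlt).le⟩
    obtain ⟨v, hv⟩ := hne
    obtain ⟨-, hvT, hvQ⟩ := hXQ v (hY hv)
    refine (Finset.mem_filter.1 hvQ).2 (Finset.mem_filter.2 ⟨?_, hvT⟩)
    exact Finset.mem_biUnion.2 ⟨j, Finset.mem_univ _, Finset.mem_biUnion.2 ⟨Y, hYB, hv⟩⟩
  have h1 := CliqueSA.sum_prod_one_add_chr_le hgood (S.rpow_pos _).le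
  have h2 : ∑ u ∈ Q j with (j, u) ∉ W, ∏ v ∈ X, (1 + chr G x (j, u) v) ≤
      ∑ u ∈ Q j, ∏ v ∈ X, (1 + chr G x (j, u) v) :=
    Finset.sum_le_sum_of_subset_of_nonneg (Finset.filter_subset _ _) fun _ _ _ =>
      Finset.prod_nonneg fun _ _ => one_add_chr_nonneg S.two_le_x _ _
  have h3 : (2 : ℝ) ^ X.card * z ^ (56100 : ℝ) ≤ z ^ (56112 : ℝ) := by
    calc _ ≤ z ^ ((12 : ℕ) : ℝ) * z ^ (56100 : ℝ) :=
          mul_le_mul_of_nonneg_right (S.two_pow_le_rpow (hX.trans (mul_comm _ _).le))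
            (S.rpow_pos _).le
      _ = _ := by rw [S.rpow_mul]; norm_num
  have hk : (0 : ℝ) < k := by
    have : 0 < k := j.pos
    exact_mod_cast this
  have h4 : 2 * z ^ (56112 : ℝ) ≤ (k : ℝ)⁻¹ * ((Q j).filter fun u => (j, u) ∉ W).card := by
    rw [inv_mul_eq_div, le_div_iff₀ hk]
    calc 2 * z ^ (56112 : ℝ) * k ≤ z ^ (56112 + 1 : ℝ) * z ^ (1000 : ℝ) :=
          mul_le_mul (S.two_mul_rpow_le _) S.k_le hk.le (S.rpow_pos _).le
      _ ≤ z ^ (59399 : ℝ) := by rw [S.rpow_mul]; exact S.rpow_le (by norm_num)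
      _ ≤ _ := hsize' j hj
  have h5 : z ^ (20837 : ℝ) ≤ z ^ (56112 : ℝ) := S.rpow_le (by norm_num)
  have h6 := hfil j
  linarith

lemma exists_pair {i j : Fin k} (h : i ≠ j) : ∃ e : Pr k, ends e = {i, j} := by
  rcases lt_or_gt_of_ne h with h | h
  · exact ⟨⟨(i, j), h⟩, rfl⟩
  · exact ⟨⟨(j, i), h⟩, Finset.pair_comm _ _⟩

/-- Every rectangle has nearly nonnegative weight. A rectangle with single vertices in the blocks of
`T` is decomposed further by fixing, one after the other, vertices in a small side or exceptional
vertices; each step fixes one more block and loses less than the factor `n` that it gains. The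
process stops at balanced rectangles or when `d` blocks are fixed. -/
theorem Setting.neg_le_sum_wt (S : Setting G d x z) (m : ℕ) :
    ∀ (T : Finset (Fin k)) (Q : Fin k → Finset (Fin n)), T.card + m = d →
      (∀ i ∈ T, (Q i).card ≤ 1) →
      -(27 * (m + 1) * (n : ℝ) ^ k * z ^ (-59400 * (T.card : ℝ) - 4000 * d)) ≤
        ∑ t ∈ Fintype.piFinset Q, wt G x d t := by
  classical
  have hx := S.two_le_x
  have hnk : (0 : ℝ) ≤ (n : ℝ) ^ k := by positivity
  induction m with
  | zero =>
    intro T Q hTd hQ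
    have h := S.abs_sum_le (by omega) hQ 0
    simp only [Nat.zero_le, and_true] at h
    refine le_trans (neg_le_neg ?_) (neg_le_of_abs_le h)
    have hd : (T.card : ℝ) = d := by exact_mod_cast hTd
    rw [hd]
    have h1 : z ^ (-63544 * (d : ℝ) - 5135 * ((0 : ℕ) : ℝ)) ≤ z ^ (-59400 * (d : ℝ) - 4000 * d) := by
      refine S.rpow_le ?_
      have : (0 : ℝ) ≤ d := Nat.cast_nonneg _
      push_cast
      linarith
    calc 9 * (n : ℝ) ^ k * z ^ (-63544 * (d : ℝ) - 5135 * ((0 : ℕ) : ℝ))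
        ≤ 27 * (n : ℝ) ^ k * z ^ (-59400 * (d : ℝ) - 4000 * d) := by
          refine mul_le_mul ?_ h1 (S.rpow_pos _).le (by positivity)
          linarith
      _ = _ := by push_cast; ring
  | succ m ih =>
    intro T Q hTd hQ
    set r : ℝ := (T.card : ℝ) with hr
    have hr0 : 0 ≤ r := Nat.cast_nonneg _
    set Y : ℝ := (n : ℝ) ^ k * z ^ (-59400 * r - 4000 * d) with hY
    have hY0 : 0 ≤ Y := mul_nonneg hnk (S.rpow_pos _).le
    have hgoal : 27 * (((m + 1 : ℕ) : ℝ) + 1) * (n : ℝ) ^ k * z ^ (-59400 * r - 4000 * d) =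
        27 * (m + 1) * Y + 27 * Y := by
      rw [hY]; push_cast; ring
    rw [hgoal]
    have hmY : 0 ≤ 27 * ((m : ℝ) + 1) * Y := by positivity
    -- up to this error, the weight of a rectangle comes from the graphs with a small core
    have hrest : ∀ Q' : Fin k → Finset (Fin n), (∀ i ∈ T, (Q' i).card ≤ 1) →
        |∑ t ∈ Fintype.piFinset Q', wt G x d t - ∑ t ∈ Fintype.piFinset Q', wtSmall G x d T t| ≤
          9 * Y := by
      intro Q' hQ'
      refine (S.abs_sum_wt_sub_le (by omega) hQ').trans ?_
      rw [hY, mul_assoc]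
      refine mul_le_mul_of_nonneg_left (mul_le_mul_of_nonneg_left (S.rpow_le ?_) hnk) (by norm_num)
      have : (0 : ℝ) ≤ d := Nat.cast_nonneg _
      linarith
    rcases (Fintype.piFinset Q).eq_empty_or_nonempty with hemp | ⟨t₀, ht₀⟩
    · rw [hemp, Finset.sum_empty]
      linarith
    have hfix : ∀ t ∈ Fintype.piFinset Q, ∀ i ∈ T, t i = t₀ i := fun t ht i hi =>
      Finset.card_le_one.1 (hQ i hi) _ (Fintype.mem_piFinset.1 ht i) _
        (Fintype.mem_piFinset.1 ht₀ i)
    -- if two of the fixed vertices are not adjacent, the graphs with a small core do not contribute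
    by_cases hclique : ∃ e : Pr k, ends e ⊆ T ∧ 1 + chrPr G x e t₀ = 0
    · obtain ⟨e, heT, he0⟩ := hclique
      have h0 : ∑ t ∈ Fintype.piFinset Q, wtSmall G x d T t = 0 := by
        refine Finset.sum_eq_zero fun t ht => wtSmall_eq_zero (e := e) ?_ ?_
        · rw [Finset.not_disjoint_iff]
          exact ⟨e.1.1, by simp [ends], heT (by simp [ends])⟩
        · rw [chrPr_congr fun i hi => hfix t ht i (heT hi), he0]
      have h1 := hrest Q hQ
      rw [h0, sub_zero] at h1
      have := neg_le_of_abs_le h1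
      linarith
    -- the rectangle of common neighbours of the fixed vertices
    let Q' : Fin k → Finset (Fin n) := fun j => (Q j).filter fun u =>
      j ∈ T ∨ ∀ i ∈ T, 1 + chr G x (j, u) (i, t₀ i) ≠ 0
    have hQ'Q : ∀ j, Q' j ⊆ Q j := fun j => Finset.filter_subset _ _
    have hQ'T : ∀ i ∈ T, (Q' i).card ≤ 1 := fun i hi =>
      (Finset.card_le_card (hQ'Q i)).trans (hQ i hi)
    have hsub : Fintype.piFinset Q' ⊆ Fintype.piFinset Q := Fintype.piFinset_subset _ _ hQ'Q
    have hadj : ∀ t ∈ Fintype.piFinset Q', ∀ e : Pr k, ¬ Disjoint (ends e) T →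
        1 + chrPr G x e t = x := by
      intro t ht e he
      refine (one_add_chrPr_eq_or e t).resolve_right fun h0 => ?_
      by_cases heT : ends e ⊆ T
      · refine hclique ⟨e, heT, ?_⟩
        rw [← chrPr_congr fun i hi => hfix t (hsub ht) i (heT hi), h0]
      · obtain ⟨i, hi, hiT⟩ := Finset.not_disjoint_iff.1 he
        obtain ⟨j, hj, hjT⟩ := Finset.not_subset.1 heT
        have hij : ends e = {j, i} := by
          symm
          refine Finset.eq_of_subset_of_card_le ?_ ?_
          · intro a ha
            simp only [Finset.mem_insert, Finset.mem_singleton] at ha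
            rcases ha with rfl | rfl <;> assumption
          · rw [card_ends, Finset.card_pair]
            rintro rfl; exact hjT hiT
        have h1 := (Finset.mem_filter.1 (Fintype.mem_piFinset.1 ht j)).2.resolve_left hjT i hiT
        rw [chrPr_eq_chr hij, hfix t (hsub ht) i hiT] at h0
        exact h1 h0
    have hsmall : ∑ t ∈ Fintype.piFinset Q, wtSmall G x d T t =
        ∑ t ∈ Fintype.piFinset Q', wtSmall G x d T t := by
      refine (Finset.sum_subset hsub fun t ht ht' => ?_).symm
      rw [Fintype.mem_piFinset, not_forall] at ht'
      obtain ⟨j, hj⟩ := ht'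
      have hjQ := Fintype.mem_piFinset.1 ht j
      have hj' : ¬ (j ∈ T ∨ ∀ i ∈ T, 1 + chr G x (j, t j) (i, t₀ i) ≠ 0) := fun h =>
        hj (Finset.mem_filter.2 ⟨hjQ, h⟩)
      rw [not_or] at hj'
      obtain ⟨hjT, hj'⟩ := hj'
      push Not at hj'
      obtain ⟨i, hiT, hi0⟩ := hj'
      have hji : j ≠ i := by rintro rfl; exact hjT hiT
      obtain ⟨e, he⟩ := exists_pair hji
      refine wtSmall_eq_zero (e := e) ?_ ?_
      · rw [Finset.not_disjoint_iff]
        exact ⟨i, by simp [he], hiT⟩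
      · rw [chrPr_eq_chr he, hfix t ht i hiT, hi0]
    have hQQ' : ∑ t ∈ Fintype.piFinset Q', wt G x d t - 18 * Y ≤
        ∑ t ∈ Fintype.piFinset Q, wt G x d t := by
      have h1 := neg_le_of_abs_le (hrest Q hQ)
      have h2 := le_of_abs_le (hrest Q' hQ'T)
      rw [hsmall] at h1
      linarith
    -- removal of a set of vertices: each of them fixes one more block, where induction applies
    set b : ℝ := 27 * (m + 1) * (n : ℝ) ^ k * z ^ (-59400 * (r + 1) - 4000 * d) with hb
    have hb0 : 0 ≤ b := mul_nonneg (by positivity) (S.rpow_pos _).le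
    have hremove : ∀ W : Finset (BlockVertex n k), (∀ w ∈ W, w.1 ∉ T) →
        (W.card : ℝ) ≤ z ^ (59400 : ℝ) →
        (∑ t ∈ Fintype.piFinset (fun j => (Q' j).filter fun u => (j, u) ∉ W), wt G x d t) -
          27 * (m + 1) * Y ≤ ∑ t ∈ Fintype.piFinset Q', wt G x d t := by
      intro W hWT hW
      refine le_trans ?_ (sum_piFinset_remove (wt G x d) hb0 W Q' ?_)
      · refine sub_le_sub_left ?_ _
        calc (W.card : ℝ) * b ≤ z ^ (59400 : ℝ) * b := mul_le_mul_of_nonneg_right hW hb0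
          _ = 27 * (m + 1) * ((n : ℝ) ^ k *
              (z ^ (59400 : ℝ) * z ^ (-59400 * (r + 1) - 4000 * d))) := by rw [hb]; ring
          _ = 27 * (m + 1) * Y := by
              rw [S.rpow_mul, hY]
              congr 3
              ring
      · intro w hw Q₁ hQ₁
        have h1 := ih (insert w.1 T) (Function.update Q₁ w.1 {w.2})
          (by rw [Finset.card_insert_of_notMem (hWT w hw)]; omega) (by
            intro i hi
            by_cases hiw : i = w.1
            · subst hiw; simp
            · have := (Finset.mem_insert.1 hi).resolve_left hiw
              rw [Function.update_of_ne hiw]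
              exact (Finset.card_le_card (hQ₁ i)).trans (hQ'T i this))
        rw [Finset.card_insert_of_notMem (hWT w hw)] at h1
        push_cast at h1
        exact h1
    by_cases hsize : ∀ j ∉ T, z ^ (59400 : ℝ) ≤ (Q' j).card
    · -- all sides are large: the exceptional vertices are removed
      obtain ⟨W, hWT, hWc, hW1, hW2⟩ := S.exists_exceptional hsize
      have h1 := hremove W hWT hWc
      set Q₂ : Fin k → Finset (Fin n) := fun j => (Q' j).filter fun u => (j, u) ∉ W with hQ₂
      have hQ₂Q' : ∀ j, Q₂ j ⊆ Q' j := fun j => Finset.filter_subset _ _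
      have h2 := S.sum_small_core_nonneg (T := T) (Q := Q₂)
        (fun t ht => hadj t (Fintype.piFinset_subset _ _ hQ₂Q' ht)) hW1 hW2
      have h3 := neg_le_of_abs_le (hrest Q₂ fun i hi =>
        (Finset.card_le_card (hQ₂Q' i)).trans (hQ'T i hi))
      have h4 : 0 ≤ ∑ t ∈ Fintype.piFinset Q₂, wtSmall G x d T t := h2
      linarith
    · -- a side is small: all its vertices are removed, and nothing is left
      push Not at hsize
      obtain ⟨j, hjT, hj⟩ := hsize
      have h1 := hremove ((Q' j).image fun u => (j, u))
        (by
          intro w hw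
          obtain ⟨u, -, rfl⟩ := Finset.mem_image.1 hw
          exact hjT)
        (le_trans (by exact_mod_cast Finset.card_image_le) hj.le)
      have h2 : Fintype.piFinset (fun i => (Q' i).filter fun u =>
          (i, u) ∉ (Q' j).image fun u => (j, u)) = ∅ := by
        rw [Finset.eq_empty_iff_forall_notMem]
        intro t ht
        have h3 := Finset.mem_filter.1 (Fintype.mem_piFinset.1 ht j)
        exact h3.2 (Finset.mem_image.2 ⟨t j, h3.1, rfl⟩)
      rw [h2, Finset.sum_empty] at h1
      linarith

/-- Every rectangle has nearly nonnegative weight. -/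
theorem Setting.neg_le_sum_wt_piFinset (S : Setting G d x z) (Q : Fin k → Finset (Fin n)) :
    -((n : ℝ) ^ k * z ^ (-3000 * (d : ℝ))) ≤ ∑ t ∈ Fintype.piFinset Q, wt G x d t := by
  have h := S.neg_le_sum_wt d ∅ Q (by simp) (by simp)
  refine le_trans (neg_le_neg ?_) h
  have h1 : 27 * ((d : ℝ) + 1) ≤ z ^ ((6 : ℕ) : ℝ) := by
    have h2 : (d : ℝ) + 1 ≤ 2 ^ d := by
      exact_mod_cast (Nat.lt_two_pow_self (n := d))
    have h3 : (2 : ℝ) ^ d ≤ z :=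
      (pow_le_pow_left₀ (by norm_num) S.two_le_x d).trans S.x_pow_le
    have h4 : (27 : ℝ) ≤ z ^ 5 :=
      le_trans (by norm_num) (pow_le_pow_left₀ (by norm_num) S.two_le_z 5)
    rw [Real.rpow_natCast]
    calc 27 * ((d : ℝ) + 1) ≤ z ^ 5 * z :=
          mul_le_mul h4 (h2.trans h3) (by positivity) (pow_nonneg S.z_pos.le _)
      _ = z ^ 6 := by ring
  have hd : (1 : ℝ) ≤ d := by exact_mod_cast S.one_le_d
  calc 27 * ((d : ℝ) + 1) * (n : ℝ) ^ k * z ^ (-59400 * ((∅ : Finset (Fin k)).card : ℝ) - 4000 * d)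
      ≤ z ^ ((6 : ℕ) : ℝ) * (n : ℝ) ^ k *
          z ^ (-59400 * ((∅ : Finset (Fin k)).card : ℝ) - 4000 * d) := by
        refine mul_le_mul_of_nonneg_right (mul_le_mul_of_nonneg_right h1 (by positivity))
          (S.rpow_pos _).le
    _ = (n : ℝ) ^ k *
          (z ^ ((6 : ℕ) : ℝ) * z ^ (-59400 * ((∅ : Finset (Fin k)).card : ℝ) - 4000 * d)) := by
        ring
    _ ≤ (n : ℝ) ^ k * z ^ (-3000 * (d : ℝ)) := by
        rw [S.rpow_mul]
        refine mul_le_mul_of_nonneg_left (S.rpow_le ?_) (by positivity)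
        push_cast
        simp only [Finset.card_empty, Nat.cast_zero]
        linarith

end Positivity

/-! ### Random graphs are nearly orthogonal -/

section Concentration

open Measure unitInterval


/-- Disjoint groups of coordinates of a product measure are independent. -/
lemma iIndepFun_curry {ι α κ E : Type*} [MeasurableSpace E] (P : ι → Measure E)
    [∀ i, IsProbabilityMeasure (P i)] {f : α × κ → ι} (hf : Function.Injective f) :
    iIndepFun (fun (a : α) (ω : ι → E) (b : κ) => ω (f (a, b))) (infinitePi P) := by
  rw [iIndepFun_iff_map_fun_eq_infinitePi_map (by fun_prop)]
  have h1 : (infinitePi P).map (fun ω (a : α) (b : κ) => ω (f (a, b))) =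
      infinitePi fun a => infinitePi fun b => P (f (a, b)) := by
    rw [← infinitePi_map_curry (fun a b => P (f (a, b)))]
    have h2 := map_infinitePi_infinitePi_of_inj (P := P) hf
    change _ = Measure.map _ (infinitePi fun i => P (f i))
    rw [← h2, Measure.map_map (by fun_prop) (by fun_prop)]
    rfl
  rw [h1]
  congr 1
  funext a
  have hfa : Function.Injective fun b => f (a, b) := fun b b' h => (Prod.mk.inj (hf h)).2
  exact (map_infinitePi_infinitePi_of_inj (P := P) hfa).symm

open Classical in
/-- The centred and scaled indicator of an edge of probability `1 / x`. -/
noncomputable def edgeVal (x : ℝ) (q : Prop) : ℝ := if q then x - 1 else -1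

lemma abs_edgeVal_le {x : ℝ} (hx : 2 ≤ x) (q : Prop) : |edgeVal x q| ≤ x := by
  unfold edgeVal
  split_ifs
  · rw [abs_of_nonneg (by linarith)]; linarith
  · rw [abs_neg, abs_one]; linarith

/-- The law of a single edge. -/
noncomputable def edgeLaw (p : I) : Measure Prop :=
  toNNReal p • dirac True + toNNReal (σ p) • dirac False

lemma integral_edgeLaw (p : I) (g : Prop → ℝ) :
    ∫ q, g q ∂edgeLaw p = p * g True + (1 - p) * g False := by
  unfold edgeLaw
  rw [integral_add_measure .of_finite .of_finite, integral_smul_nnreal_measure,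
    integral_smul_nnreal_measure, integral_dirac, integral_dirac]
  rfl

variable {ι κ : Type*} [Fintype κ] {n : ℕ} {P : ι → Measure Prop}
  [∀ i, IsProbabilityMeasure (P i)] {f : Fin n × κ → ι} {p : I} {x : ℝ}

/-- The products of edge indicators over two distinct sets are uncorrelated: an edge at a vertex in
exactly one of the sets has mean zero and is independent of the others. -/
lemma integral_prod_edgeVal (hf : Function.Injective f) (hP : ∀ i, P (f i) = edgeLaw p)
    (hpx : p * x = 1) {S S' : Finset κ} (hS : S ≠ S') (u : Fin n) :
    ∫ ω, (∏ v ∈ S, edgeVal x (ω (f (u, v)))) * ∏ v ∈ S', edgeVal x (ω (f (u, v)))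
      ∂infinitePi P = 0 := by
  classical
  let h : κ → Prop → ℝ := fun v q =>
    (if v ∈ S then edgeVal x q else 1) * (if v ∈ S' then edgeVal x q else 1)
  have hind : iIndepFun (fun (v : κ) (ω : ι → Prop) => ω (f (u, v))) (infinitePi P) :=
    (iIndepFun_infinitePi (P := P) (X := fun _ q => q) fun _ => measurable_id).precomp
      fun b b' hb => (Prod.mk.inj (hf hb)).2
  have h1 := hind.integral_fun_prod_comp (f := h)
    (fun v => (measurable_pi_apply _).aemeasurable)
    (fun v => (measurable_of_countable _).aestronglyMeasurable)
  have h2 : ∀ ω : ι → Prop, ∏ v, h v (ω (f (u, v))) =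
      (∏ v ∈ S, edgeVal x (ω (f (u, v)))) * ∏ v ∈ S', edgeVal x (ω (f (u, v))) := by
    intro ω
    rw [Finset.prod_mul_distrib, Finset.prod_ite_mem, Finset.prod_ite_mem, Finset.univ_inter,
      Finset.univ_inter]
  simp only [h2] at h1
  rw [h1]
  have hv : ∃ v, ¬ (v ∈ S ↔ v ∈ S') := by
    by_contra hcon
    push Not at hcon
    exact hS (Finset.ext hcon)
  obtain ⟨v, hv⟩ := hv
  refine Finset.prod_eq_zero (Finset.mem_univ v) ?_
  have h3 : h v = edgeVal x := by
    funext q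
    simp only [h]
    by_cases h4 : v ∈ S <;> by_cases h5 : v ∈ S' <;> simp_all
  have h6 : ∫ ω, h v (ω (f (u, v))) ∂infinitePi P = ∫ q, h v q ∂P (f (u, v)) := by
    rw [← infinitePi_map_eval P (f (u, v)),
      integral_map (measurable_pi_apply _).aemeasurable
        (measurable_of_countable _).aestronglyMeasurable]
  rw [h6, hP, integral_edgeLaw, h3]
  unfold edgeVal
  simp only [if_true, if_false]
  linear_combination hpx

/-- Hoeffding's inequality for the correlation of two products of edge indicators. -/
lemma measure_lt_abs_sum_le (hf : Function.Injective f) (hP : ∀ i, P (f i) = edgeLaw p)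
    (hx : 2 ≤ x) (hpx : p * x = 1) {S S' : Finset κ} (hS : S ≠ S') {ℓ : ℕ} (hSl : S.card ≤ ℓ)
    (hSl' : S'.card ≤ ℓ) {lam : ℝ} (hlam : 0 ≤ lam) :
    (infinitePi P).real {ω | lam < |∑ u : Fin n, (∏ v ∈ S, edgeVal x (ω (f (u, v)))) *
      ∏ v ∈ S', edgeVal x (ω (f (u, v)))|} ≤
      2 * Real.exp (-lam ^ 2 / (2 * (n * (x ^ (2 * ℓ)) ^ 2))) := by
  classical
  set Y : Fin n → (ι → Prop) → ℝ := fun u ω => (∏ v ∈ S, edgeVal x (ω (f (u, v)))) *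
      ∏ v ∈ S', edgeVal x (ω (f (u, v))) with hY
  have hbound : ∀ T : Finset κ, T.card ≤ ℓ → ∀ u (ω : ι → Prop),
      |∏ v ∈ T, edgeVal x (ω (f (u, v)))| ≤ x ^ ℓ := by
    intro T hT u ω
    rw [Finset.abs_prod]
    calc _ ≤ ∏ _v ∈ T, x :=
          Finset.prod_le_prod (fun _ _ => abs_nonneg _) fun _ _ => abs_edgeVal_le hx _
      _ = x ^ T.card := Finset.prod_const _
      _ ≤ x ^ ℓ := pow_le_pow_right₀ (by linarith) hT
  have hx0 : 0 ≤ x := by linarith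
  have hM : ∀ u ω, Y u ω ∈ Set.Icc (-x ^ (2 * ℓ)) (x ^ (2 * ℓ)) := by
    intro u ω
    rw [Set.mem_Icc, ← abs_le, hY, abs_mul, two_mul, pow_add]
    exact mul_le_mul (hbound S hSl u ω) (hbound S' hSl' u ω) (abs_nonneg _) (by positivity)
  have hgrp := iIndepFun_curry P hf
  let F : (κ → Prop) → ℝ := fun q => (∏ v ∈ S, edgeVal x (q v)) * ∏ v ∈ S', edgeVal x (q v)
  have hF : Measurable F := by
    refine Measurable.mul ?_ ?_ <;>
    · refine Finset.measurable_prod _ fun v _ => ?_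
      exact (measurable_of_countable (edgeVal x)).comp (measurable_pi_apply v)
  have hind : iIndepFun Y (infinitePi P) := hgrp.comp (fun _ => F) fun _ => hF
  have hYm : ∀ u, Measurable (Y u) := fun u => hF.comp (by fun_prop)
  have hsub : ∀ u, HasSubgaussianMGF (Y u) ((‖x ^ (2 * ℓ) - -x ^ (2 * ℓ)‖₊ / 2) ^ 2)
      (infinitePi P) := fun u =>
    hasSubgaussianMGF_of_mem_Icc_of_integral_eq_zero (hYm u).aemeasurable
      (.of_forall (hM u)) (integral_prod_edgeVal hf hP hpx hS u)
  have hc : ((∑ _u : Fin n, (‖x ^ (2 * ℓ) - -x ^ (2 * ℓ)‖₊ / 2) ^ 2 : NNReal) : ℝ) =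
      n * (x ^ (2 * ℓ)) ^ 2 := by
    push_cast
    rw [Finset.sum_const, nsmul_eq_mul, Finset.card_univ, Fintype.card_fin,
      sub_neg_eq_add, Real.norm_eq_abs, abs_of_nonneg (by positivity)]
    ring
  have htail := (HasSubgaussianMGF.sum_of_iIndepFun (s := Finset.univ) hind
    (fun u _ => hsub u))
  have h1 := htail.measure_ge_le hlam
  have h2 := htail.neg.measure_ge_le hlam
  rw [hc] at h1 h2
  calc _ ≤ (infinitePi P).real ({ω | lam ≤ ∑ u, Y u ω} ∪ {ω | lam ≤ (-fun ω => ∑ u, Y u ω) ω}) := by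
        refine measureReal_mono ?_
        intro ω hω
        have hω' : lam < |∑ u, Y u ω| := hω
        rcases lt_abs.1 hω' with h | h
        · exact Or.inl h.le
        · exact Or.inr h.le
    _ ≤ _ := measureReal_union_le _ _
    _ ≤ _ := by linarith

/-- The number of subsets of size at most `ℓ` of a set with `m` elements is at most
`3 * (m + 1) ^ ℓ`. -/
lemma card_filter_card_le {V : Type*} [Fintype V] (ℓ : ℕ) :
    ((Finset.univ.filter fun X : Finset V => X.card ≤ ℓ).card : ℝ) ≤
      3 * ((Fintype.card V : ℝ) + 1) ^ ℓ := by
  classical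
  set m : ℝ := (Fintype.card V : ℝ) + 1 with hm
  have hm1 : 1 ≤ m := by
    have : (0 : ℝ) ≤ Fintype.card V := Nat.cast_nonneg _
    linarith
  have hm0 : 0 < m := by linarith
  have hinv : m⁻¹ ≤ 1 := inv_le_one_of_one_le₀ hm1
  have hinv0 : 0 ≤ m⁻¹ := by positivity
  have h1 : ∑ X : Finset V, m⁻¹ ^ X.card ≤ 3 := by
    have h2 := Finset.prod_one_add (f := fun _ : V => m⁻¹) Finset.univ
    simp only [Finset.prod_const, Finset.powerset_univ, Finset.card_univ] at h2
    rw [← h2]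
    calc (1 + m⁻¹) ^ Fintype.card V ≤ (1 + m⁻¹) ^ (Fintype.card V + 1) :=
          pow_le_pow_right₀ (by linarith) (Nat.le_succ _)
      _ ≤ 3 := by
          have := one_add_inv_pow_le (Fintype.card V + 1)
          rw [hm]
          exact_mod_cast this
  have h3 : ((Finset.univ.filter fun X : Finset V => X.card ≤ ℓ).card : ℝ) * m⁻¹ ^ ℓ ≤ 3 := by
    rw [← nsmul_eq_mul, ← Finset.sum_const]
    calc _ ≤ ∑ X : Finset V with X.card ≤ ℓ, m⁻¹ ^ X.card :=
          Finset.sum_le_sum fun X hX =>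
            pow_le_pow_of_le_one hinv0 hinv (Finset.mem_filter.1 hX).2
      _ ≤ ∑ X : Finset V, m⁻¹ ^ X.card :=
          Finset.sum_le_sum_of_subset_of_nonneg (Finset.filter_subset _ _) fun _ _ _ => by
            positivity
      _ ≤ 3 := h1
  rwa [inv_pow, ← div_eq_mul_inv, div_le_iff₀ (by positivity)] at h3

/-- The random graph is nearly orthogonal, except with the probability given by Hoeffding's
inequality and a union bound over all pairs of small sets of vertices. -/
lemma le_partiteErdosRenyi_nearOrtho (n k : ℕ) {x : ℝ} (hx : 2 ≤ x) (ℓ : ℕ) {lam : ℝ}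
    (hlam : 0 ≤ lam) :
    1 - ENNReal.ofReal (k * (3 * ((k * n : ℝ) + 1) ^ ℓ) ^ 2 *
      (2 * Real.exp (-lam ^ 2 / (2 * (n * (x ^ (2 * ℓ)) ^ 2))))) ≤
      partiteErdosRenyi n k x⁻¹ {G | NearOrtho G x ℓ lam} := by
  classical
  have hx0 : 0 < x := by linarith
  have hmem : x⁻¹ ∈ Set.Icc (0 : ℝ) 1 := ⟨by positivity, inv_le_one_of_one_le₀ (by linarith)⟩
  set p : I := ⟨x⁻¹, hmem⟩ with hp
  have hpx : (p : ℝ) * x = 1 := inv_mul_cancel₀ hx0.ne'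
  set u₀ := (SimpleGraph.completeEquipartiteGraph k n).edgeSet with hu₀
  set P : Sym2 (BlockVertex n k) → Measure Prop := fun e =>
    toNNReal p • dirac (e ∈ u₀) + toNNReal (σ p) • dirac False with hP
  have hPp : ∀ e, IsProbabilityMeasure (P e) := fun e => by rw [hP]; infer_instance
  set μ := infinitePi P with hμ
  have hμp : IsProbabilityMeasure μ := by rw [hμ]; infer_instance
  set Γ : (Sym2 (BlockVertex n k) → Prop) → SimpleGraph (BlockVertex n k) := fun ω =>
    SimpleGraph.fromEdgeSet {e | ω e} with hΓ
  have hS : Measurable fun ω : Sym2 (BlockVertex n k) → Prop => {e | ω e} :=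
    MeasurableEquiv.setOfPred.measurable
  have hΓm : Measurable Γ := SimpleGraph.measurable_fromEdgeSet.comp hS
  have hlaw : partiteErdosRenyi n k x⁻¹ = μ.map Γ := by
    unfold partiteErdosRenyi
    rw [Set.projIcc_of_mem _ hmem, setBernoulli_eq_map,
      Measure.map_map SimpleGraph.measurable_fromEdgeSet hS]
    rfl
  rw [hlaw]
  refine le_trans ?_ (le_map_apply hΓm.aemeasurable _)
  -- the exceptional events
  set 𝒳 : Finset (Finset (BlockVertex n k)) := Finset.univ.filter fun X => X.card ≤ ℓ with h𝒳
  let 𝒯 : Finset (Fin k × Finset (BlockVertex n k) × Finset (BlockVertex n k)) :=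
    (Finset.univ ×ˢ 𝒳 ×ˢ 𝒳).filter fun τ => τ.2.1 ≠ τ.2.2 ∧ (∀ v ∈ τ.2.1, v.1 ≠ τ.1) ∧
      ∀ v ∈ τ.2.2, v.1 ≠ τ.1
  let B : (Fin k × Finset (BlockVertex n k) × Finset (BlockVertex n k)) →
      Set (Sym2 (BlockVertex n k) → Prop) := fun τ =>
    {ω | lam < |∑ u : Fin n, (∏ v ∈ τ.2.1, chr (Γ ω) x (τ.1, u) v) *
      ∏ v ∈ τ.2.2, chr (Γ ω) x (τ.1, u) v|}
  have hsub : (Γ ⁻¹' {G | NearOrtho G x ℓ lam})ᶜ ⊆ ⋃ τ ∈ 𝒯, B τ := by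
    intro ω hω
    have hω' : ¬ NearOrtho (Γ ω) x ℓ lam := hω
    unfold NearOrtho at hω'
    push Not at hω'
    obtain ⟨a, X, X', h1, h2, h3, h4, h5, h6⟩ := hω'
    simp only [Set.mem_iUnion]
    refine ⟨(a, X, X'), Finset.mem_filter.2 ⟨?_, h1, h4, h5⟩, h6⟩
    simp only [Finset.mem_product, h𝒳, Finset.mem_filter, Finset.mem_univ, true_and]
    exact ⟨h2, h3⟩
  have hB : ∀ τ ∈ 𝒯, μ.real (B τ) ≤ 2 * Real.exp (-lam ^ 2 / (2 * (n * (x ^ (2 * ℓ)) ^ 2))) := by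
    rintro ⟨a, X, X'⟩ hτ
    obtain ⟨h1, hne, h4, h5⟩ := Finset.mem_filter.1 hτ
    simp only [Finset.mem_product, h𝒳, Finset.mem_filter, Finset.mem_univ, true_and] at h1
    let κ := {v : BlockVertex n k // v.1 ≠ a}
    let f : Fin n × κ → Sym2 (BlockVertex n k) := fun w => s((a, w.1), w.2.1)
    have hf : Function.Injective f := by
      rintro ⟨u, v⟩ ⟨u', v'⟩ h
      rcases Sym2.eq_iff.1 h with ⟨e1, e2⟩ | ⟨e1, -⟩
      · exact Prod.ext (congrArg Prod.snd e1) (Subtype.ext e2)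
      · exact absurd (congrArg Prod.fst e1).symm v'.2
    have hPf : ∀ w, P (f w) = edgeLaw p := by
      intro w
      have h6 : (f w ∈ u₀) = True := by
        simp only [f, hu₀, SimpleGraph.mem_edgeSet, eq_iff_iff, iff_true]
        exact fun h => w.2.2 h.symm
      simp only [hP, edgeLaw, h6]
    have hchr : ∀ (ω : Sym2 (BlockVertex n k) → Prop) (u : Fin n) (v : κ),
        chr (Γ ω) x (a, u) v.1 = edgeVal x (ω (f (u, v))) := by
      intro ω u v
      have h6 : (Γ ω).Adj (a, u) v.1 ↔ ω (f (u, v)) := by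
        simp only [hΓ, SimpleGraph.fromEdgeSet_adj, f]
        refine and_iff_left fun h => v.2 (congrArg Prod.fst h).symm
      unfold chr edgeVal
      simp only [h6]
    have hprod : ∀ Z : Finset (BlockVertex n k), (∀ v ∈ Z, v.1 ≠ a) → ∀ ω u,
        ∏ v ∈ Z, chr (Γ ω) x (a, u) v =
          ∏ v ∈ Z.subtype (fun v => v.1 ≠ a), edgeVal x (ω (f (u, v))) := by
      intro Z hZ ω u
      rw [← Finset.prod_subtype_of_mem (fun v => chr (Γ ω) x (a, u) v) hZ]
      exact Finset.prod_congr rfl fun v _ => hchr ω u v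
    have hcard : ∀ Z : Finset (BlockVertex n k), Z.card ≤ ℓ →
        (Z.subtype (fun v => v.1 ≠ a)).card ≤ ℓ := by
      intro Z hZ
      rw [Finset.card_subtype]
      exact (Finset.card_filter_le _ _).trans hZ
    have hne' : X.subtype (fun v => v.1 ≠ a) ≠ X'.subtype fun v => v.1 ≠ a := by
      intro h
      refine hne ?_
      rw [← Finset.subtype_map_of_mem h4, ← Finset.subtype_map_of_mem h5, h]
    have h7 := measure_lt_abs_sum_le (P := P) hf hPf hx hpx hne' (hcard X h1.1)
      (hcard X' h1.2) hlam
    refine le_trans (le_of_eq (congrArg _ ?_)) h7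
    ext ω
    simp only [B, Set.mem_ofPred_eq, hprod X h4, hprod X' h5]
    exact Iff.rfl
  have hbad : μ.real (Γ ⁻¹' {G | NearOrtho G x ℓ lam})ᶜ ≤
      k * (3 * ((k * n : ℝ) + 1) ^ ℓ) ^ 2 *
        (2 * Real.exp (-lam ^ 2 / (2 * (n * (x ^ (2 * ℓ)) ^ 2)))) := by
    have h𝒯 : (𝒯.card : ℝ) ≤ k * (3 * ((k * n : ℝ) + 1) ^ ℓ) ^ 2 := by
      have h1 : 𝒯.card ≤ k * (𝒳.card * 𝒳.card) := by
        refine (Finset.card_filter_le _ _).trans ?_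
        rw [Finset.card_product, Finset.card_product, Finset.card_univ, Fintype.card_fin]
      have h2 : (𝒳.card : ℝ) ≤ 3 * ((k * n : ℝ) + 1) ^ ℓ := by
        have h3 := card_filter_card_le (V := BlockVertex n k) ℓ
        rw [Fintype.card_prod, Fintype.card_fin, Fintype.card_fin] at h3
        exact_mod_cast h3
      calc (𝒯.card : ℝ) ≤ k * (𝒳.card * 𝒳.card) := by exact_mod_cast h1
        _ ≤ k * (3 * ((k * n : ℝ) + 1) ^ ℓ) ^ 2 := by
            rw [← sq]
            gcongr
    calc _ ≤ μ.real (⋃ τ ∈ 𝒯, B τ) := measureReal_mono hsub (measure_ne_top μ _)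
      _ ≤ ∑ τ ∈ 𝒯, μ.real (B τ) := measureReal_biUnion_finset_le _ _
      _ ≤ 𝒯.card * (2 * Real.exp (-lam ^ 2 / (2 * (n * (x ^ (2 * ℓ)) ^ 2)))) := by
          rw [← nsmul_eq_mul]
          exact Finset.sum_le_card_nsmul _ _ _ hB
      _ ≤ _ := mul_le_mul_of_nonneg_right h𝒯 (by positivity)
  rw [tsub_le_iff_right]
  calc (1 : ENNReal) = μ Set.univ := measure_univ.symm
    _ ≤ μ (Γ ⁻¹' {G | NearOrtho G x ℓ lam}) + μ (Γ ⁻¹' {G | NearOrtho G x ℓ lam})ᶜ := by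
        rw [← Set.union_compl_self (Γ ⁻¹' {G | NearOrtho G x ℓ lam})]
        exact measure_union_le _ _
    _ ≤ _ := by
        gcongr
        rw [← ENNReal.ofReal_toReal (measure_ne_top μ (Γ ⁻¹' {G | NearOrtho G x ℓ lam})ᶜ)]
        exact ENNReal.ofReal_le_ofReal hbad

end Concentration

section Asymptotics

/-- For large `n` the exponential bound beats the number of pairs of sets in the union bound. -/
lemma eventually_log_sq_le : ∀ᶠ n : ℕ in atTop,
    1 ≤ Real.log n ∧ 72 * Real.log n ^ 2 + 2 * Real.log n + 3 ≤
      ((n : ℝ) ^ ((1 : ℝ) / 66000)) ^ (13152 : ℝ) / 2 := by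
  have h1 : ∀ᶠ n : ℕ in atTop, Real.log n ≤ 1 / 20 * (n : ℝ) ^ ((9 : ℝ) / 100) := by
    have h2 := ((isLittleO_log_rpow_atTop (r := 9 / 100) (by norm_num)).def
      (c := 1 / 20) (by norm_num)).and (eventually_ge_atTop 1)
    filter_upwards [tendsto_natCast_atTop_atTop.eventually h2] with n hn
    obtain ⟨h3, h4⟩ := hn
    rw [Real.norm_of_nonneg (Real.log_nonneg h4), Real.norm_of_nonneg (by positivity)] at h3
    exact h3
  have h2 : ∀ᶠ n : ℕ in atTop, 1 ≤ Real.log n :=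
    (Real.tendsto_log_atTop.comp tendsto_natCast_atTop_atTop).eventually_ge_atTop 1
  filter_upwards [h1, h2, eventually_ge_atTop 1] with n h1 h2 h3
  refine ⟨h2, ?_⟩
  have hn : (1 : ℝ) ≤ n := by exact_mod_cast h3
  have h4 : ((n : ℝ) ^ ((9 : ℝ) / 100)) ^ 2 ≤ ((n : ℝ) ^ ((1 : ℝ) / 66000)) ^ (13152 : ℝ) := by
    rw [← Real.rpow_natCast, ← Real.rpow_mul (by linarith), ← Real.rpow_mul (by linarith)]
    exact Real.rpow_le_rpow_of_exponent_le hn (by norm_num)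
  have h5 : Real.log n ^ 2 ≤ (1 / 20 * (n : ℝ) ^ ((9 : ℝ) / 100)) ^ 2 :=
    pow_le_pow_left₀ (by linarith) h1 2
  rw [mul_pow] at h5
  have h6 : Real.log n ≤ Real.log n ^ 2 := by nlinarith
  nlinarith

/-- The error in the union bound is at most `1 / n`: the number of pairs of sets is at most
`exp (O(log n ^ 2))`, while the tail probability is `exp (-z ^ 13152 / 2)`, where
`2 * 39600 - 66000 - 48 = 13152`. -/
lemma union_bound_le {n k d : ℕ} {x z : ℝ} (hn : 2 ≤ n) (hnz : (n : ℝ) = z ^ (66000 : ℝ))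
    (hkn : (k : ℝ) ≤ n) (hx : 2 ≤ x) (hz : 2 ≤ z) (hxz : x ^ d ≤ z) (hd : (d : ℝ) ≤ Real.log n)
    (hlog : 72 * Real.log n ^ 2 + 2 * Real.log n + 3 ≤ z ^ (13152 : ℝ) / 2) :
    k * (3 * ((k * n : ℝ) + 1) ^ (12 * d)) ^ 2 *
      (2 * Real.exp (-(z ^ (39600 : ℝ)) ^ 2 / (2 * (n * (x ^ (2 * (12 * d))) ^ 2)))) ≤
      (n : ℝ)⁻¹ := by
  have hn2 : (2 : ℝ) ≤ n := by exact_mod_cast hn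
  have hn0 : (0 : ℝ) < n := by linarith
  have hz0 : 0 < z := by linarith
  have hx0 : 0 < x := by linarith
  set L := Real.log n with hL
  have hexp : Real.exp L = n := Real.exp_log hn0
  have h1 : ((k * n : ℝ) + 1) ≤ Real.exp (3 * L) := by
    have h2 : Real.exp (3 * L) = (n : ℝ) ^ 3 := by
      rw [← hexp, ← Real.exp_nat_mul]; norm_num
    rw [h2]
    calc (k * n : ℝ) + 1 ≤ n * n + 1 := by gcongr
      _ ≤ (n : ℝ) ^ 3 := by nlinarith [mul_pos hn0 hn0]
  have h18 : (18 : ℝ) ≤ Real.exp 3 := by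
    have h2 := Real.exp_one_gt_d9
    have h3 : Real.exp 3 = Real.exp 1 ^ 3 := by rw [← Real.exp_nat_mul]; norm_num
    rw [h3]
    calc (18 : ℝ) ≤ 2.7 ^ 3 := by norm_num
      _ ≤ _ := pow_le_pow_left₀ (by norm_num) (by linarith) 3
  have h3 : (k : ℝ) * (3 * ((k * n : ℝ) + 1) ^ (12 * d)) ^ 2 * 2 ≤
      Real.exp (L + 3 + 72 * L ^ 2) := by
    have h4 : (((k * n : ℝ) + 1) ^ (12 * d)) ^ 2 ≤ Real.exp (72 * L ^ 2) := by
      rw [← pow_mul]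
      calc ((k * n : ℝ) + 1) ^ (12 * d * 2) ≤ Real.exp (3 * L) ^ (12 * d * 2) :=
            pow_le_pow_left₀ (by positivity) h1 _
        _ = Real.exp (72 * (d * L)) := by
            rw [← Real.exp_nat_mul]; push_cast; ring_nf
        _ ≤ Real.exp (72 * L ^ 2) := by
            refine Real.exp_le_exp.2 ?_
            have hL0 : 0 ≤ L := Real.log_nonneg (by linarith)
            rw [sq]
            gcongr
    calc _ = k * 18 * (((k * n : ℝ) + 1) ^ (12 * d)) ^ 2 := by ring
      _ ≤ Real.exp L * Real.exp 3 * Real.exp (72 * L ^ 2) := by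
          rw [hexp]
          gcongr
      _ = _ := by rw [← Real.exp_add, ← Real.exp_add]
  have h5 : -(z ^ (39600 : ℝ)) ^ 2 / (2 * (n * (x ^ (2 * (12 * d))) ^ 2)) ≤
      -(z ^ (13152 : ℝ) / 2) := by
    rw [neg_div, neg_le_neg_iff, le_div_iff₀ (by positivity)]
    have h6 : (x ^ (2 * (12 * d))) ^ 2 ≤ z ^ (48 : ℝ) := by
      calc (x ^ (2 * (12 * d))) ^ 2 = (x ^ d) ^ 48 := by rw [← pow_mul, ← pow_mul]; congr 1; ring
        _ ≤ z ^ 48 := pow_le_pow_left₀ (by positivity) hxz _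
        _ = z ^ (48 : ℝ) := by rw [← Real.rpow_natCast]; norm_num
    have h7 : (z ^ (39600 : ℝ)) ^ 2 = z ^ (13152 : ℝ) * ((n : ℝ) * z ^ (48 : ℝ)) := by
      rw [hnz, ← Real.rpow_add hz0, ← Real.rpow_add hz0, ← Real.rpow_natCast,
        ← Real.rpow_mul hz0.le]
      norm_num
    rw [h7]
    calc z ^ (13152 : ℝ) / 2 * (2 * (n * (x ^ (2 * (12 * d))) ^ 2)) =
          z ^ (13152 : ℝ) * (n * (x ^ (2 * (12 * d))) ^ 2) := by ring
      _ ≤ _ := by gcongr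
  calc _ = (k : ℝ) * (3 * ((k * n : ℝ) + 1) ^ (12 * d)) ^ 2 * 2 *
        Real.exp (-(z ^ (39600 : ℝ)) ^ 2 / (2 * (n * (x ^ (2 * (12 * d))) ^ 2))) := by ring
    _ ≤ Real.exp (L + 3 + 72 * L ^ 2) * Real.exp (-(z ^ (13152 : ℝ) / 2)) :=
        mul_le_mul h3 (Real.exp_le_exp.2 h5) (Real.exp_pos _).le (Real.exp_pos _).le
    _ = Real.exp (L + 3 + 72 * L ^ 2 + -(z ^ (13152 : ℝ) / 2)) := (Real.exp_add _ _).symm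
    _ ≤ Real.exp (-L) := Real.exp_le_exp.2 (by linarith)
    _ = (n : ℝ)⁻¹ := by rw [Real.exp_neg, hexp]

/-- With high probability, the random graph satisfies all assumptions of the construction. -/
theorem eventually_setting : ∀ᶠ n : ℕ in atTop, ∀ (k : ℕ) (D : ℝ), 132000 ≤ D →
    D ≤ 2 * Real.logb 2 n → (k : ℝ) ≤ (n : ℝ) ^ ((1 : ℝ) / 66) →
    1 - ENNReal.ofReal (n : ℝ)⁻¹ ≤ partiteErdosRenyi n k ((n : ℝ) ^ (-2 / D))
      {G | Setting G ⌊D / 132000⌋₊ ((n : ℝ) ^ (2 / D)) ((n : ℝ) ^ ((1 : ℝ) / 66000))} := by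
  filter_upwards [eventually_log_sq_le, eventually_ge_atTop 2] with n hlog hn2 k D hD hDn hk
  obtain ⟨hlog1, hlog⟩ := hlog
  have hn2' : (2 : ℝ) ≤ n := by exact_mod_cast hn2
  have hn0 : (0 : ℝ) < n := by linarith
  have hD0 : 0 < D := by linarith
  set z : ℝ := (n : ℝ) ^ ((1 : ℝ) / 66000) with hz
  set x : ℝ := (n : ℝ) ^ (2 / D) with hx
  set d : ℕ := ⌊D / 132000⌋₊ with hd
  have hlog2 : 0 < Real.log 2 := Real.log_pos (by norm_num)
  have hDlog : D * Real.log 2 ≤ 2 * Real.log n := by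
    rw [Real.logb, ← mul_div_assoc, le_div_iff₀ hlog2] at hDn
    exact hDn
  have hd1 : 1 ≤ d := by
    rw [hd, Nat.one_le_floor_iff, le_div_iff₀ (by norm_num)]
    linarith
  have hdD : (d : ℝ) ≤ D / 132000 := Nat.floor_le (by positivity)
  have hnz : (n : ℝ) = z ^ (66000 : ℝ) := by
    rw [hz, ← Real.rpow_mul hn0.le]; norm_num
  have hkz : (k : ℝ) ≤ z ^ (1000 : ℝ) := by
    refine hk.trans (le_of_eq ?_)
    rw [hz, ← Real.rpow_mul hn0.le]; norm_num
  have hx2 : 2 ≤ x := by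
    rw [hx, ← Real.log_le_log_iff (by norm_num) (Real.rpow_pos_of_pos hn0 _),
      Real.log_rpow hn0, div_mul_eq_mul_div, le_div_iff₀ hD0]
    linarith
  have hxz : x ^ d ≤ z := by
    rw [hx, hz, ← Real.rpow_natCast, ← Real.rpow_mul hn0.le]
    refine Real.rpow_le_rpow_of_exponent_le (by linarith) ?_
    rw [div_mul_eq_mul_div, div_le_iff₀ hD0]
    linarith
  have hz2 : 2 ≤ z := by
    calc (2 : ℝ) ≤ x := hx2
      _ = x ^ 1 := (pow_one _).symm
      _ ≤ x ^ d := pow_le_pow_right₀ (by linarith) hd1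
      _ ≤ z := hxz
  have hkn : (k : ℝ) ≤ n := by
    refine hk.trans ?_
    calc (n : ℝ) ^ ((1 : ℝ) / 66) ≤ (n : ℝ) ^ (1 : ℝ) :=
          Real.rpow_le_rpow_of_exponent_le (by linarith) (by norm_num)
      _ = n := Real.rpow_one _
  have hdlog : (d : ℝ) ≤ Real.log n := by
    have h2 : (1 / 2 : ℝ) ≤ Real.log 2 := by linarith [Real.log_two_gt_d9]
    have h3 : D * (1 / 2) ≤ D * Real.log 2 := mul_le_mul_of_nonneg_left h2 hD0.le
    linarith
  have hxinv : (n : ℝ) ^ (-2 / D) = x⁻¹ := by rw [hx, neg_div, Real.rpow_neg hn0.le]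
  rw [hxinv]
  have h1 := le_partiteErdosRenyi_nearOrtho n k hx2 (12 * d)
    (Real.rpow_nonneg (by linarith : 0 ≤ z) 39600)
  have h2 := union_bound_le hn2 hnz hkn hx2 hz2 hxz hdlog hlog
  calc 1 - ENNReal.ofReal (n : ℝ)⁻¹ ≤ _ := tsub_le_tsub_left (ENNReal.ofReal_le_ofReal h2) _
    _ ≤ _ := h1
    _ ≤ _ := by
        refine measure_mono fun G hG => ?_
        change Setting G d x z
        exact ⟨hnz, hkz, hx2, hd1, hxz, hG⟩

end Asymptotics

/-! ### Signed weights and refutations -/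

section Refutations

variable {n k : ℕ} {G : SimpleGraph (BlockVertex n k)}

/-- A dual solution: a signed weight on the tuples that pick one vertex from each block. The total
weight is at least `1`, every rectangle has weight at least `-ε`, and the rectangles of tuples that
contain a fixed pair of non-adjacent vertices have weight at most `ε` in absolute value. -/
structure IsDual (G : SimpleGraph (BlockVertex n k)) (ε : ℝ) (w : (Fin k → Fin n) → ℝ) :
    Prop where
  one_le_sum : 1 ≤ ∑ t, w t
  neg_le_sum : ∀ Q : Fin k → Finset (Fin n), -ε ≤ ∑ t ∈ Fintype.piFinset Q, w t
  abs_sum_le : ∀ u v : BlockVertex n k, u.1 < v.1 → ¬ G.Adj u v →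
    ∀ Q : Fin k → Finset (Fin n), Q u.1 ⊆ {u.2} → Q v.1 ⊆ {v.2} →
      |∑ t ∈ Fintype.piFinset Q, w t| ≤ ε

/-- The assignment to the twin variables that a tuple of vertices stands for. -/
def assignment (t : Fin k → Fin n) : BlockVertex n k ⊕ BlockVertex n k → ℝ
  | Sum.inl v => if t v.1 = v.2 then 1 else 0
  | Sum.inr v => 1 - if t v.1 = v.2 then 1 else 0

/-- The indicator function of the rectangle with sides `Q`. -/
def rect (Q : Fin k → Finset (Fin n)) (t : Fin k → Fin n) : ℝ := if ∀ i, t i ∈ Q i then 1 else 0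

lemma rect_mul_rect (Q Q' : Fin k → Finset (Fin n)) (t : Fin k → Fin n) :
    rect Q t * rect Q' t = rect (fun i => Q i ∩ Q' i) t := by
  unfold rect
  simp only [Finset.mem_inter, forall_and]
  split_ifs <;> simp_all

lemma sum_mul_rect (w : (Fin k → Fin n) → ℝ) (Q : Fin k → Finset (Fin n)) :
    ∑ t, w t * rect Q t = ∑ t ∈ Fintype.piFinset Q, w t := by
  classical
  unfold rect
  simp only [mul_ite, mul_one, mul_zero]
  rw [← Finset.sum_filter]
  refine Finset.sum_congr ?_ fun _ _ => rfl
  ext t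
  simp [Fintype.mem_piFinset]

lemma exists_rect_prod {ι : Type*} (s : Finset ι) {F : ι → (Fin k → Fin n) → ℝ}
    (hF : ∀ y, ∃ Q, ∀ t, F y t = rect Q t) : ∃ Q, ∀ t, ∏ y ∈ s, F y t = rect Q t := by
  classical
  induction s using Finset.induction_on with
  | empty => exact ⟨fun _ => Finset.univ, fun t => by simp [rect]⟩
  | insert a s ha ih =>
    obtain ⟨Q, hQ⟩ := ih
    obtain ⟨Q', hQ'⟩ := hF a
    exact ⟨_, fun t => by rw [Finset.prod_insert ha, hQ, hQ', rect_mul_rect]⟩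

lemma assignment_inl_eq_rect (v : BlockVertex n k) (t : Fin k → Fin n) :
    assignment t (Sum.inl v) = rect (Function.update (fun _ => Finset.univ) v.1 {v.2}) t := by
  unfold assignment rect
  refine if_congr ⟨fun h i => ?_, fun h => ?_⟩ rfl rfl
  · by_cases hi : i = v.1
    · subst hi; simp [h]
    · simp [Function.update_of_ne hi]
  · simpa using h v.1

lemma exists_rect_assignment (y : BlockVertex n k ⊕ BlockVertex n k) :
    ∃ Q, ∀ t : Fin k → Fin n, assignment t y = rect Q t := by
  classical
  rcases y with v | v
  · exact ⟨_, assignment_inl_eq_rect v⟩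
  · refine ⟨Function.update (fun _ => Finset.univ) v.1 {v.2}ᶜ, fun t => ?_⟩
    have h : (∀ i, t i ∈ Function.update (fun _ => Finset.univ) v.1 ({v.2}ᶜ : Finset (Fin n)) i) ↔
        ¬ t v.1 = v.2 := by
      refine ⟨fun h => by simpa using h v.1, fun h i => ?_⟩
      by_cases hi : i = v.1
      · subst hi; simp [h]
      · simp [Function.update_of_ne hi]
    unfold assignment rect
    simp only [h]
    split_ifs <;> simp_all

lemma assignment_pow (t : Fin k → Fin n) (y : BlockVertex n k ⊕ BlockVertex n k) {m : ℕ}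
    (hm : m ≠ 0) : assignment t y ^ m = assignment t y := by
  rcases y with v | v <;> unfold assignment <;> dsimp only <;> split_ifs <;> simp [hm]

/-- A monomial is the indicator function of a rectangle. -/
lemma exists_rect_monomial (m : BlockVertex n k ⊕ BlockVertex n k →₀ ℕ) :
    ∃ Q, ∀ t : Fin k → Fin n, ∏ y ∈ m.support, assignment t y ^ m y = rect Q t := by
  obtain ⟨Q, hQ⟩ := exists_rect_prod m.support
    (F := fun y (t : Fin k → Fin n) => assignment t y) exists_rect_assignment
  refine ⟨Q, fun t => ?_⟩
  rw [← hQ]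
  exact Finset.prod_congr rfl fun y hy => assignment_pow t y (Finsupp.mem_support_iff.1 hy)

section Eval

variable {K : Type*} [CommRing K] (φ : K →+* ℝ)

/-- The evaluation of a polynomial at the assignment of a tuple of vertices, with coefficients mapped
to the real numbers by `φ`. -/
def evalAt (t : Fin k → Fin n) : TwinPoly (BlockVertex n k) K →+* ℝ :=
  eval₂Hom φ (assignment t)

lemma evalAt_posVar (t : Fin k → Fin n) (v : BlockVertex n k) :
    evalAt φ t (posVar K v) = assignment t (Sum.inl v) := eval₂_X _ _ _

lemma evalAt_negVar (t : Fin k → Fin n) (v : BlockVertex n k) :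
    evalAt φ t (negVar K v) = assignment t (Sum.inr v) := eval₂_X _ _ _

lemma evalAt_C (t : Fin k → Fin n) (a : K) : evalAt φ t (C a) = φ a := eval₂_C _ _ _

lemma evalAt_boolIdeal (t : Fin k → Fin n) {f : TwinPoly (BlockVertex n k) K}
    (hf : f ∈ boolIdeal (BlockVertex n k) K) : evalAt φ t f = 0 := by
  have h : boolIdeal (BlockVertex n k) K ≤ RingHom.ker (evalAt φ t) := by
    refine Ideal.span_le.2 ?_
    rintro f ((⟨v, rfl⟩ | ⟨v, rfl⟩) | ⟨v, rfl⟩) <;>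
    · simp only [SetLike.mem_coe, RingHom.mem_ker, map_mul, map_sub, map_one, evalAt_posVar,
        evalAt_negVar, assignment]
      split_ifs <;> simp
  exact h hf

lemma evalAt_block (t : Fin k → Fin n) (i : Fin k) :
    evalAt φ t (cliqueFormula K G (Sum.inl i)) = 0 := by
  simp only [cliqueFormula, map_sub, map_sum, map_one, evalAt_posVar, assignment]
  simp

lemma evalAt_eq_sum (t : Fin k → Fin n) (f : TwinPoly (BlockVertex n k) K) :
    evalAt φ t f = ∑ m ∈ f.support, φ (coeff m f) * ∏ y ∈ m.support, assignment t y ^ m y :=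
  eval₂_eq _ _ _

lemma exists_rect_genMonomial (S : Finset (BlockVertex n k) × Finset (BlockVertex n k)) :
    ∃ Q, ∀ t : Fin k → Fin n, evalAt φ t (genMonomial K S) = rect Q t := by
  obtain ⟨Q, hQ⟩ := exists_rect_prod S.1
    (F := fun v (t : Fin k → Fin n) => assignment t (Sum.inl v))
    fun v => exists_rect_assignment _
  obtain ⟨Q', hQ'⟩ := exists_rect_prod S.2
    (F := fun v (t : Fin k → Fin n) => assignment t (Sum.inr v))
    fun v => exists_rect_assignment _
  refine ⟨fun i => Q i ∩ Q' i, fun t => ?_⟩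
  unfold genMonomial
  rw [map_mul, map_prod, map_prod]
  simp only [evalAt_posVar, evalAt_negVar]
  rw [hQ, hQ', rect_mul_rect]

end Eval

/-- The part of the sum of magnitudes that comes from the edge axioms, whose polynomials consist of
a single monomial, and from the nonnegative combination of monomials. -/
lemma sum_edge_add_sum_le {K : Type*} [CommRing K] [LinearOrder K] (φ : K →+* ℝ)
    {M : K} (π : SADerivation (cliqueFormula K G) M) :
    ∑ e : NonEdge G, ∑ m ∈ (π.g (Sum.inr e)).support, |φ (coeff m (π.g (Sum.inr e)))| +
      ∑ S, φ (π.α S) ≤ (π.coeffs.map fun c => |φ c|).sum := by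
  classical
  have : Nontrivial K := φ.domain_nontrivial
  have hadd : ∀ s : Fin k ⊕ NonEdge G → Multiset K, ((∑ j, s j).map fun c => |φ c|).sum =
      ∑ j, ((s j).map fun c => |φ c|).sum := fun s =>
    map_sum (Multiset.sumAddMonoidHom.comp (Multiset.mapAddMonoidHom fun c => |φ c|)) s _
  unfold SADerivation.coeffs
  rw [Multiset.map_add, Multiset.sum_add, hadd, Fintype.sum_sum_type, add_assoc]
  refine le_add_of_nonneg_of_le ?_ (add_le_add ?_ ?_)
  · refine Finset.sum_nonneg fun i _ => Multiset.sum_nonneg ?_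
    intro c hc
    obtain ⟨a, -, rfl⟩ := Multiset.mem_map.1 hc
    exact abs_nonneg _
  · refine Finset.sum_le_sum fun e _ => ?_
    have h1 : cliqueFormula K G (Sum.inr e) =
        monomial (Finsupp.single (Sum.inl e.1.1) 1 + Finsupp.single (Sum.inl e.1.2) 1) 1 := by
      simp only [cliqueFormula, posVar, X, monomial_mul, one_mul]
    rw [h1, support_monomial, if_neg one_ne_zero, Multiset.map_map]
    change _ ≤ ∑ m ∈ (π.g (Sum.inr e)).support ×ˢ _, _
    rw [Finset.sum_product]
    simp
  · rw [Multiset.map_map]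
    change _ ≤ ∑ S with π.α S ≠ 0, |φ (π.α S)|
    rw [Finset.sum_filter]
    refine Finset.sum_le_sum fun S _ => ?_
    split_ifs with h
    · exact le_abs_self _
    · rw [not_not.1 h, map_zero]

/-- A dual solution bounds the coefficients of a derivation from below: average the derivation
over all tuples. The block axioms vanish, and each monomial is a rectangle. -/
theorem IsDual.le_sum_coeffs {ε : ℝ} {w : (Fin k → Fin n) → ℝ} (hw : IsDual G ε w)
    {K : Type*} [CommRing K] [LinearOrder K] (φ : K →+* ℝ) (hφ : ∀ a, 0 ≤ a → 0 ≤ φ a) {M : K}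
    (hM : 0 ≤ φ M) (hε : 0 ≤ ε) (π : SADerivation (cliqueFormula K G) M) :
    φ M ≤ ε * (π.coeffs.map fun c => |φ c|).sum := by
  classical
  have hid : ∀ t : Fin k → Fin n, ∑ e : NonEdge G, evalAt φ t (π.g (Sum.inr e)) *
      evalAt φ t (cliqueFormula K G (Sum.inr e)) +
      ∑ S, φ (π.α S) * evalAt φ t (genMonomial K S) = -φ M := by
    intro t
    have h := evalAt_boolIdeal φ t π.identity
    simp only [map_sub, map_add, map_neg, map_sum, map_mul, evalAt_C, Fintype.sum_sum_type,
      evalAt_block, mul_zero, Finset.sum_const_zero, zero_add] at h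
    linarith
  -- the contribution of the edge axioms
  have hedge : ∀ e : NonEdge G,
      -(ε * ∑ m ∈ (π.g (Sum.inr e)).support, |φ (coeff m (π.g (Sum.inr e)))|) ≤
      ∑ t, w t * (evalAt φ t (π.g (Sum.inr e)) *
        evalAt φ t (cliqueFormula K G (Sum.inr e))) := by
    intro e
    have h1 : ∀ m : BlockVertex n k ⊕ BlockVertex n k →₀ ℕ,
        |∑ t, w t * ((∏ y ∈ m.support, assignment t y ^ m y) *
          evalAt φ t (cliqueFormula K G (Sum.inr e)))| ≤ ε := by
      intro m
      obtain ⟨Q, hQ⟩ := exists_rect_monomial m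
      simp only [cliqueFormula, map_mul, evalAt_posVar, assignment_inl_eq_rect, hQ,
        rect_mul_rect, sum_mul_rect]
      refine hw.abs_sum_le e.1.1 e.1.2 e.2.1 e.2.2 _ ?_ ?_
      · refine Finset.inter_subset_right.trans (Finset.inter_subset_left.trans ?_)
        rw [Function.update_self]
      · refine Finset.inter_subset_right.trans (Finset.inter_subset_right.trans ?_)
        rw [Function.update_self]
    have h2 : ∑ t, w t * (evalAt φ t (π.g (Sum.inr e)) *
        evalAt φ t (cliqueFormula K G (Sum.inr e))) =
        ∑ m ∈ (π.g (Sum.inr e)).support, φ (coeff m (π.g (Sum.inr e))) *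
          ∑ t, w t * ((∏ y ∈ m.support, assignment t y ^ m y) *
            evalAt φ t (cliqueFormula K G (Sum.inr e))) := by
      simp only [Finset.mul_sum]
      rw [Finset.sum_comm]
      refine Finset.sum_congr rfl fun t _ => ?_
      rw [evalAt_eq_sum φ t (π.g (Sum.inr e)), Finset.sum_mul, Finset.mul_sum]
      exact Finset.sum_congr rfl fun m _ => by ring
    rw [h2, Finset.mul_sum]
    refine neg_le_of_abs_le ((Finset.abs_sum_le_sum_abs _ _).trans ?_)
    refine Finset.sum_le_sum fun m _ => ?_
    rw [abs_mul, mul_comm]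
    exact mul_le_mul_of_nonneg_right (h1 m) (abs_nonneg _)
  -- the contribution of the nonnegative combination of monomials
  have hgen : ∀ S, -(ε * φ (π.α S)) ≤ ∑ t, w t * (φ (π.α S) * evalAt φ t (genMonomial K S)) := by
    intro S
    obtain ⟨Q, hQ⟩ := exists_rect_genMonomial (n := n) (k := k) φ S
    have h1 : ∑ t, w t * (φ (π.α S) * evalAt φ t (genMonomial K S)) =
        φ (π.α S) * ∑ t ∈ Fintype.piFinset Q, w t := by
      rw [← sum_mul_rect, Finset.mul_sum]
      exact Finset.sum_congr rfl fun t _ => by rw [hQ]; ring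
    rw [h1]
    nlinarith [hw.neg_le_sum Q, hφ _ (π.α_nonneg S)]
  have hsum : ∑ t, w t * -φ M = ∑ e : NonEdge G, ∑ t, w t * (evalAt φ t (π.g (Sum.inr e)) *
        evalAt φ t (cliqueFormula K G (Sum.inr e))) +
      ∑ S, ∑ t, w t * (φ (π.α S) * evalAt φ t (genMonomial K S)) := by
    rw [Finset.sum_comm, Finset.sum_comm (s := Finset.univ (α := Finset _ × Finset _)),
      ← Finset.sum_add_distrib]
    refine Finset.sum_congr rfl fun t _ => ?_
    rw [← Finset.mul_sum, ← Finset.mul_sum, ← mul_add, hid]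
  have h1 := Finset.sum_le_sum fun e (_ : e ∈ (Finset.univ : Finset (NonEdge G))) => hedge e
  have h2 := Finset.sum_le_sum fun S (_ : S ∈ Finset.univ) => hgen S
  have h3 := mul_le_mul_of_nonneg_left (sum_edge_add_sum_le φ π) hε
  have h4 : φ M * 1 ≤ φ M * ∑ t, w t := mul_le_mul_of_nonneg_left hw.one_le_sum hM
  rw [Finset.sum_neg_distrib, ← Finset.mul_sum] at h1 h2
  rw [← Finset.sum_mul] at hsum
  linarith

/-- A refutation has at least `n` coefficients, since it uses a block axiom: the assignment of `0`
to all `x_v` satisfies the edge axioms. -/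
lemma le_card_coeffs {K : Type*} [CommRing K] [LinearOrder K] (φ : K →+* ℝ)
    (hφ : ∀ a, 0 ≤ a → 0 ≤ φ a) {M : K} (hM : 0 < φ M)
    (π : SADerivation (cliqueFormula K G) M) : n ≤ Multiset.card π.coeffs := by
  classical
  have : Nontrivial K := φ.domain_nontrivial
  obtain ⟨i, hi⟩ : ∃ i : Fin k, π.g (Sum.inl i) ≠ 0 := by
    by_contra hcon
    push Not at hcon
    let ψ : TwinPoly (BlockVertex n k) K →+* ℝ :=
      eval₂Hom φ (Sum.elim (fun _ => 0) fun _ => 1)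
    have hpos : ∀ v, ψ (posVar K v) = 0 := fun v => eval₂_X _ _ _
    have hneg : ∀ v, ψ (negVar K v) = 1 := fun v => eval₂_X _ _ _
    have hC : ∀ a, ψ (C a) = φ a := fun a => eval₂_C _ _ _
    have hker : boolIdeal (BlockVertex n k) K ≤ RingHom.ker ψ := by
      refine Ideal.span_le.2 ?_
      rintro f ((⟨v, rfl⟩ | ⟨v, rfl⟩) | ⟨v, rfl⟩) <;>
      simp [RingHom.mem_ker, hpos, hneg]
    have h := hker π.identity
    rw [RingHom.mem_ker] at h
    simp only [map_sub, map_add, map_neg, map_sum, map_mul, hC, Fintype.sum_sum_type, hcon,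
      zero_mul, Finset.sum_const_zero, zero_add, cliqueFormula, hpos, mul_zero,
      genMonomial, map_prod, hneg, Finset.prod_const_one, mul_one] at h
    have h1 : 0 ≤ ∑ S, φ (π.α S) *
        ∏ v ∈ (S : Finset (BlockVertex n k) × Finset (BlockVertex n k)).1, (0 : ℝ) :=
      Finset.sum_nonneg fun S _ =>
        mul_nonneg (hφ _ (π.α_nonneg S)) (Finset.prod_nonneg fun _ _ => le_rfl)
    linarith
  have hsupp : n ≤ (cliqueFormula K G (Sum.inl i)).support.card := by
    have hinj : Function.Injective fun a : Fin n =>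
        (Finsupp.single (Sum.inl (i, a)) 1 : BlockVertex n k ⊕ BlockVertex n k →₀ ℕ) := by
      intro a b hab
      have := Finsupp.single_left_injective one_ne_zero hab
      exact (Prod.mk.inj (Sum.inl_injective this)).2
    have h1 : (Finset.univ.image fun a : Fin n =>
        (Finsupp.single (Sum.inl (i, a)) 1 : BlockVertex n k ⊕ BlockVertex n k →₀ ℕ)) ⊆
        (cliqueFormula K G (Sum.inl i)).support := by
      intro m hm
      obtain ⟨a, -, rfl⟩ := Finset.mem_image.1 hm
      rw [mem_support_iff]
      simp only [cliqueFormula, posVar, coeff_sub, coeff_sum, coeff_X, coeff_one]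
      have h2 : ∀ b : Fin n, (Finsupp.single (Sum.inl (i, b)) 1 :
          BlockVertex n k ⊕ BlockVertex n k →₀ ℕ) = Finsupp.single (Sum.inl (i, a)) 1 ↔ b = a :=
        fun b => hinj.eq_iff (a := b) (b := a)
      have h3 : (0 : BlockVertex n k ⊕ BlockVertex n k →₀ ℕ) ≠
          Finsupp.single (Sum.inl (i, a)) 1 := by
        intro h
        exact one_ne_zero (Finsupp.single_eq_zero.1 h.symm)
      simp [h2, h3]
    calc n = (Finset.univ.image fun a : Fin n =>
        (Finsupp.single (Sum.inl (i, a)) 1 : BlockVertex n k ⊕ BlockVertex n k →₀ ℕ)).card := by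
          rw [Finset.card_image_of_injective _ hinj, Finset.card_univ, Fintype.card_fin]
      _ ≤ _ := Finset.card_le_card h1
  unfold SADerivation.coeffs
  rw [Multiset.card_add, Multiset.card_sum]
  calc n ≤ (π.g (Sum.inl i)).support.card * (cliqueFormula K G (Sum.inl i)).support.card := by
        have h1 : 0 < (π.g (Sum.inl i)).support.card := by
          rw [Finset.card_pos, Finset.nonempty_iff_ne_empty, ne_eq, support_eq_empty]
          exact hi
        exact hsupp.trans (Nat.le_mul_of_pos_left _ h1)
    _ = Multiset.card (((π.g (Sum.inl i)).support ×ˢ (cliqueFormula K G (Sum.inl i)).support).val.map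
      (fun m => coeff m.1 (π.g (Sum.inl i)) * coeff m.2 (cliqueFormula K G (Sum.inl i)))) := by
        rw [Multiset.card_map, Finset.card_val, Finset.card_product]
    _ ≤ _ := (Finset.single_le_sum (f := fun j => Multiset.card
        (((π.g j).support ×ˢ (cliqueFormula K G j).support).val.map
      (fun m => coeff m.1 (π.g j) * coeff m.2 (cliqueFormula K G j))))
        (fun _ _ => Nat.zero_le _) (Finset.mem_univ _)).trans (Nat.le_add_right _ _)

end Refutations

/-! ### Dual solutions for random graphs -/

section Duals

variable {n k d : ℕ} {G : SimpleGraph (BlockVertex n k)} {x z : ℝ}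

/-- The weight `wt`, normalized, is a dual solution. -/
lemma Setting.exists_isDual (S : Setting G d x z) :
    ∃ w, IsDual G (z ^ (-2000 * (d : ℝ))) w := by
  have hN : (0 : ℝ) < (n : ℝ) ^ k := pow_pos S.n_pos k
  set N : ℝ := (n : ℝ) ^ k with hN'
  have hd : (1 : ℝ) ≤ d := by exact_mod_cast S.one_le_d
  have hε : 2 / N * (N * z ^ (-3000 * (d : ℝ))) ≤ z ^ (-2000 * (d : ℝ)) := by
    calc 2 / N * (N * z ^ (-3000 * (d : ℝ))) = 2 * z ^ (-3000 * (d : ℝ)) := by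
          field_simp
      _ ≤ z ^ (-3000 * (d : ℝ) + 1) := S.two_mul_rpow_le _
      _ ≤ z ^ (-2000 * (d : ℝ)) := S.rpow_le (by linarith)
  have hN2 : 0 ≤ 2 / N := by positivity
  refine ⟨fun t => 2 / N * wt G x d t, ?_, fun Q => ?_, fun u v huv hadj Q hu hv => ?_⟩
  · rw [← Finset.mul_sum]
    have h := mul_le_mul_of_nonneg_left S.le_sum_wt hN2
    refine le_trans (le_of_eq ?_) h
    rw [← hN']
    field_simp
  · rw [← Finset.mul_sum]
    have h := mul_le_mul_of_nonneg_left (S.neg_le_sum_wt_piFinset Q) hN2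
    rw [mul_neg] at h
    linarith
  · rw [← Finset.mul_sum, abs_mul, abs_of_nonneg hN2]
    exact (mul_le_mul_of_nonneg_left (S.abs_sum_wt_le_of_not_adj huv hadj hu hv) hN2).trans hε

/-- The uniform weight is a dual solution for every graph: the tuples through a single
vertex have total weight `1 / n`. -/
lemma exists_isDual_uniform (G : SimpleGraph (BlockVertex n k)) (hn : 0 < n) :
    ∃ w, IsDual G (n : ℝ)⁻¹ w := by
  classical
  have hn0 : (0 : ℝ) < n := by exact_mod_cast hn
  have hN : (0 : ℝ) < (n : ℝ) ^ k := pow_pos hn0 k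
  refine ⟨fun _ => ((n : ℝ) ^ k)⁻¹, ?_, fun Q => ?_, fun u v _ _ Q hu _ => ?_⟩
  · simp only [Finset.sum_const, Finset.card_univ, Fintype.card_pi, Fintype.card_fin,
      Finset.prod_const, nsmul_eq_mul, Nat.cast_pow]
    rw [mul_inv_cancel₀ hN.ne']
  · have h : 0 ≤ ∑ _t ∈ Fintype.piFinset Q, ((n : ℝ) ^ k)⁻¹ :=
      Finset.sum_nonneg fun _ _ => by positivity
    have h2 : 0 ≤ (n : ℝ)⁻¹ := by positivity
    linarith
  · rw [Finset.sum_const, nsmul_eq_mul, abs_of_nonneg (by positivity), ← div_eq_mul_inv,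
      div_le_iff₀ hN, inv_mul_eq_div, le_div_iff₀ hn0]
    have h1 : (Fintype.piFinset Q).card * n ≤ n ^ k := by
      rw [Fintype.card_piFinset, ← Finset.mul_prod_erase _ _ (Finset.mem_univ u.1)]
      calc (Q u.1).card * (∏ i ∈ Finset.univ.erase u.1, (Q i).card) * n
          ≤ 1 * (∏ _i ∈ Finset.univ.erase u.1, n) * n := by
            refine Nat.mul_le_mul_right _ (Nat.mul_le_mul ?_ (Finset.prod_le_prod' fun i _ => ?_))
            · simpa using Finset.card_le_card hu
            · simpa using Finset.card_le_univ (Q i)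
        _ = n ^ k := by
            rw [one_mul, Finset.prod_const, ← pow_succ,
              Finset.card_erase_add_one (Finset.mem_univ _), Finset.card_univ, Fintype.card_fin]
    exact_mod_cast h1

end Duals

section AsymptoticallyAlmostSurely

instance (n k : ℕ) (p : ℝ) : IsProbabilityMeasure (partiteErdosRenyi n k p) := by
  unfold partiteErdosRenyi
  exact Measure.isProbabilityMeasure_map SimpleGraph.measurable_fromEdgeSet.aemeasurable

lemma HoldsAAS.of_one_sub_le {k : ℕ → ℕ} {D : ℕ → ℝ}
    {P : (n : ℕ) → SimpleGraph (BlockVertex n (k n)) → Prop}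
    (h : ∀ᶠ n : ℕ in atTop, 1 - ENNReal.ofReal (n : ℝ)⁻¹ ≤
      partiteErdosRenyi n (k n) ((n : ℝ) ^ (-2 / D n)) {G | P n G}) : HoldsAAS k D P := by
  have h1 : Tendsto (fun n : ℕ => 1 - ENNReal.ofReal (n : ℝ)⁻¹) atTop (𝓝 1) := by
    have h2 : Tendsto (fun n : ℕ => ENNReal.ofReal (n : ℝ)⁻¹) atTop (𝓝 0) := by
      rw [← ENNReal.ofReal_zero]
      exact (ENNReal.continuous_ofReal.tendsto 0).comp
        (tendsto_inv_atTop_zero.comp tendsto_natCast_atTop_atTop)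
    simpa using ENNReal.Tendsto.sub (tendsto_const_nhds (x := (1 : ENNReal))) h2 (by simp)
  exact tendsto_of_tendsto_of_tendsto_of_le_of_le' h1 tendsto_const_nhds h
    (.of_forall fun n => prob_le_one)

lemma HoldsAAS.mono {k : ℕ → ℕ} {D : ℕ → ℝ}
    {P P' : (n : ℕ) → SimpleGraph (BlockVertex n (k n)) → Prop} (h : HoldsAAS k D P)
    (hP : ∀ᶠ n : ℕ in atTop, ∀ G, P n G → P' n G) : HoldsAAS k D P' := by
  refine tendsto_of_tendsto_of_tendsto_of_le_of_le' h tendsto_const_nhds ?_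
    (.of_forall fun n => prob_le_one)
  filter_upwards [hP] with n hn
  exact measure_mono fun G hG => hn G hG

/-- Asymptotically almost surely, the random graph has a dual solution. For bounded `D` the uniform
weight suffices. -/
theorem holdsAAS_exists_isDual {k : ℕ → ℕ} {D : ℕ → ℝ} (h : AdmissibleParams k D) :
    HoldsAAS k D fun n G => ∃ w, IsDual G ((n : ℝ) ^ (-((1 : ℝ) / 10 ^ 7 * D n))) w := by
  refine HoldsAAS.of_one_sub_le ?_
  filter_upwards [h, eventually_setting, eventually_ge_atTop 1] with n ⟨hD0, hDn, hk⟩ hS hn1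
  have hn : (1 : ℝ) ≤ n := by exact_mod_cast hn1
  have hmono : ∀ {G : SimpleGraph (BlockVertex n (k n))} {ε ε' : ℝ}, ε ≤ ε' →
      (∃ w, IsDual G ε w) → ∃ w, IsDual G ε' w := by
    rintro G ε ε' hε ⟨w, h1, h2, h3⟩
    exact ⟨w, h1, fun Q => (neg_le_neg hε).trans (h2 Q),
      fun u v huv hadj Q hu hv => (h3 u v huv hadj Q hu hv).trans hε⟩
  rcases le_or_gt 132000 (D n) with hD | hD
  · refine (hS (k n) (D n) hD hDn hk).trans (measure_mono fun G hG => ?_)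
    refine hmono ?_ (Setting.exists_isDual hG)
    rw [← Real.rpow_mul (by linarith)]
    refine Real.rpow_le_rpow_of_exponent_le hn ?_
    -- `z ^ (-2000 d) = n ^ (-d / 33)`, and `33 * 264000 ≤ 10 ^ 7`
    have h1 : D n / 264000 ≤ ⌊D n / 132000⌋₊ := by
      have h2 := Nat.lt_floor_add_one (D n / 132000)
      have h3 : (1 : ℝ) ≤ D n / 132000 := by rw [le_div_iff₀ (by norm_num)]; linarith
      have h4 : (1 : ℝ) ≤ ⌊D n / 132000⌋₊ := by
        exact_mod_cast (Nat.one_le_floor_iff _).2 h3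
      linarith
    linarith
  · have huniv : {G : SimpleGraph (BlockVertex n (k n)) |
        ∃ w, IsDual G ((n : ℝ) ^ (-((1 : ℝ) / 10 ^ 7 * D n))) w} = Set.univ := by
      refine Set.eq_univ_of_forall fun G => hmono ?_ (exists_isDual_uniform G hn1)
      rw [← Real.rpow_neg_one]
      exact Real.rpow_le_rpow_of_exponent_le hn (by linarith)
    rw [huniv, measure_univ]
    exact tsub_le_self

/-- The lower bound on the sum of the magnitudes of the coefficients over any ordered ring. -/
lemma IsDual.rpow_le_sum_coeffs {n k : ℕ} {G : SimpleGraph (BlockVertex n k)} (hn : 1 ≤ n)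
    {b : ℝ} {w : (Fin k → Fin n) → ℝ} (hw : IsDual G ((n : ℝ) ^ (-b)) w) {K : Type*} [CommRing K]
    [LinearOrder K] (φ : K →+* ℝ) (hφ : ∀ a, 0 ≤ a → 0 ≤ φ a) {M : K} (hM : 1 ≤ φ M)
    (π : SADerivation (cliqueFormula K G) M) :
    (n : ℝ) ^ b ≤ (π.coeffs.map fun c => |φ c|).sum := by
  have hn0 : (0 : ℝ) < n := by exact_mod_cast hn
  have hpos := Real.rpow_pos_of_pos hn0 b
  have h1 := hw.le_sum_coeffs φ hφ (by linarith) (Real.rpow_nonneg hn0.le _) π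
  rw [Real.rpow_neg hn0.le, inv_mul_eq_div] at h1
  have h2 := hM.trans h1
  rwa [one_le_div hpos] at h2

end AsymptoticallyAlmostSurely

/-! ### Sizes of refutations -/

section Sizes

variable {V ι : Type*} [Fintype V] [Fintype ι]

lemma card_coeffs_le_size {p : ι → TwinPoly V ℚ} {M : ℚ} (π : SADerivation p M) :
    Multiset.card π.coeffs ≤ π.size := by
  unfold SADerivation.size
  rw [← Multiset.card_map bitLength]
  refine le_trans (by simp) (Multiset.card_nsmul_le_sum (s := π.coeffs.map bitLength) (a := 1)
    fun c hc => ?_)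
  obtain ⟨q, -, rfl⟩ := Multiset.mem_map.1 hc
  unfold bitLength
  omega

lemma SADerivation.BoundedCoeffs.sum_le {p : ι → TwinPoly V ℚ} {M : ℚ} {π : SADerivation p M}
    {b : ℝ} (h : π.BoundedCoeffs b) :
    (π.coeffs.map fun c : ℚ => |(c : ℝ)|).sum ≤ Multiset.card π.coeffs * b := by
  rw [← nsmul_eq_mul, ← Multiset.card_map fun c : ℚ => |(c : ℝ)|]
  refine Multiset.sum_le_card_nsmul _ _ fun r hr => ?_
  obtain ⟨c, hc, rfl⟩ := Multiset.mem_map.1 hr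
  exact h c hc

lemma UnarySARefutation.cast_size {p : ι → TwinPoly V ℤ} (π : UnarySARefutation p) :
    (π.size : ℝ) = (π.derivation.coeffs.map fun c : ℤ => |(c : ℝ)|).sum := by
  unfold UnarySARefutation.size
  rw [← Nat.coe_castAddMonoidHom, map_multiset_sum, Multiset.map_map]
  congr 1
  refine Multiset.map_congr rfl fun c _ => ?_
  simp [Nat.cast_natAbs]

end Sizes
end CliqueSA

open CliqueSA in
theorem mainTheorem1 :
    -- coefficient size
    (∃ c : ℝ, 0 < c ∧ ∀ (k : ℕ → ℕ) (D : ℕ → ℝ), AdmissibleParams k D →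
      HoldsAAS k D (fun n G => ∀ π : SARefutation (cliqueFormula ℝ G),
        (n : ℝ) ^ (c * D n) ≤ π.coeffSize)) ∧
    -- size of refutations with polynomially bounded coefficients
    (∀ a : ℝ, 0 < a → ∃ c : ℝ, 0 < c ∧ ∀ (k : ℕ → ℕ) (D : ℕ → ℝ), AdmissibleParams k D →
      HoldsAAS k D (fun n G => ∀ π : SARefutation (cliqueFormula ℚ G),
        π.BoundedCoeffs ((n : ℝ) ^ a) → (n : ℝ) ^ (c * D n) ≤ (π.size : ℝ))) ∧
    -- size of unary refutations
    (∃ c : ℝ, 0 < c ∧ ∀ (k : ℕ → ℕ) (D : ℕ → ℝ), AdmissibleParams k D →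
      HoldsAAS k D (fun n G => ∀ π : UnarySARefutation (cliqueFormula ℤ G),
        (n : ℝ) ^ (c * D n) ≤ (π.size : ℝ))) := by
  refine ⟨⟨1 / 10 ^ 7, by norm_num, fun k D h => ?_⟩, fun a ha => ?_,
    ⟨1 / 10 ^ 7, by norm_num, fun k D h => ?_⟩⟩
  · refine (holdsAAS_exists_isDual h).mono ?_
    filter_upwards [eventually_ge_atTop 1] with n hn G ⟨w, hw⟩ π
    exact hw.rpow_le_sum_coeffs hn (RingHom.id ℝ) (fun _ h => h) le_rfl π
  · refine ⟨min (1 / (2 * 10 ^ 7)) (1 / (2 * 10 ^ 7 * a)), by positivity, fun k D h => ?_⟩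
    refine (holdsAAS_exists_isDual h).mono ?_
    filter_upwards [h, eventually_ge_atTop 1] with n ⟨hD, _⟩ hn G ⟨w, hw⟩ π hπ
    have hn1 : (1 : ℝ) ≤ n := by exact_mod_cast hn
    have hn0 : (0 : ℝ) < n := by linarith
    have hcast : ∀ q : ℚ, 0 ≤ q → 0 ≤ Rat.castHom ℝ q := fun q hq => by
      simpa using hq
    have hsize : (Multiset.card π.coeffs : ℝ) ≤ π.size := by
      exact_mod_cast card_coeffs_le_size π
    rcases le_or_gt (D n) (2 * 10 ^ 7 * a) with hDa | hDa
    · -- the exponent is at most `1`, and there are at least `n` coefficients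
      have h1 : min (1 / (2 * 10 ^ 7)) (1 / (2 * 10 ^ 7 * a)) * D n ≤ 1 := by
        calc _ ≤ 1 / (2 * 10 ^ 7 * a) * D n := by gcongr; exact min_le_right _ _
          _ ≤ 1 := by rw [one_div_mul_eq_div, div_le_one (by positivity)]; exact hDa
      have h2 : (n : ℝ) ≤ Multiset.card π.coeffs := by
        exact_mod_cast le_card_coeffs (Rat.castHom ℝ) hcast (by simp) π
      calc _ ≤ (n : ℝ) ^ (1 : ℝ) := Real.rpow_le_rpow_of_exponent_le hn1 h1
        _ = n := Real.rpow_one _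
        _ ≤ _ := h2.trans hsize
    · -- the bound on the coefficients loses at most the factor `n ^ (D n / (2 * 10 ^ 7))`
      have h1 : min (1 / (2 * 10 ^ 7)) (1 / (2 * 10 ^ 7 * a)) * D n ≤ 1 / 10 ^ 7 * D n - a := by
        calc _ ≤ 1 / (2 * 10 ^ 7) * D n := by gcongr; exact min_le_left _ _
          _ ≤ _ := by linarith
      have h2 := hw.rpow_le_sum_coeffs hn (Rat.castHom ℝ) hcast (by simp) π
      have h3 : (n : ℝ) ^ (1 / 10 ^ 7 * D n) ≤ Multiset.card π.coeffs * (n : ℝ) ^ a :=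
        h2.trans hπ.sum_le
      calc _ ≤ (n : ℝ) ^ (1 / 10 ^ 7 * D n - a) := Real.rpow_le_rpow_of_exponent_le hn1 h1
        _ = (n : ℝ) ^ (1 / 10 ^ 7 * D n) / (n : ℝ) ^ a := Real.rpow_sub hn0 _ _
        _ ≤ Multiset.card π.coeffs := by
            rw [div_le_iff₀ (Real.rpow_pos_of_pos hn0 _)]; exact h3
        _ ≤ _ := hsize
  · refine (holdsAAS_exists_isDual h).mono ?_
    filter_upwards [eventually_ge_atTop 1] with n hn G ⟨w, hw⟩ π
    rw [π.cast_size]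
    refine hw.rpow_le_sum_coeffs hn (Int.castRingHom ℝ) (fun a ha => ?_) ?_ π.derivation
    · simpa using ha
    · have := π.M_pos
      simp only [eq_intCast]
      exact_mod_cast this
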